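/- **Conventions.** Let $p$ be a prime and let $(V,Q)$ be a quadratic space over $\mathbb{Q}$ of dimension $n$, with bilinear form $B(x,y)=Q(x+y)-Q(x)-Q(y)$; Gram matrices are taken with respect to $B$. For a $\mathbb{Z}$-lattice $L\subset V$ (a finitely generated subgroup spanning $V$) and a prime $q$ put $V_q=\mathbb{Q}_q\otimes V$ and $L_q=\mathbb{Z}_qL\subset V_q$. A $\mathbb{Z}_p$-lattice is *even* if $Q$ is $\mathbb{Z}_p$-valued on it, and *maximal* if it is even and not properly contained in another even $\mathbb{Z}_p$-lattice of the same quadratic space. A symmetric matrix is in *$p$-adic normal form* if it is block diagonal with components of scales $1,p,p^2,\dots$, in this order, of the following shape. If $p$ is odd, the component of scale $p^k$ is $p^k\,\mathrm{diag}(1,\dots,1)$ or $p^k\,\mathrm{diag}(1,\dots,1,u)$, where $u$ is the least positive quadratic nonresidue modulo $p$ (components may be empty). If $p=2$, the component of scale $2^k$ is $2^k(U\perp\dots\perp U\perp E^{v_k}\perp\langle\varepsilon_1\rangle\perp\cdots)$ with $U=\begin{pmatrix}0&1\\1&0\end{pmatrix}$, $E=\begin{pmatrix}2&1\\1&2\end{pmatrix}$,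 where $v_k\in\{0,1\}$ and the list $w_k=(\varepsilon_1,\dots)$ is one of $(),(1),(3),(5),(7),(1,1),(1,3),(1,5),(1,7),(3,7),(7,7)$ if $v_k=0$, and one of $(),(1),(3),(5),(7),(1,3),(1,7)$ if $v_k=1$. Call the component of *type a* if $w_k=()$ or $3^{v_k}\prod\varepsilon_i\equiv\pm1 \pmod 8$. It is required that: if $w_k\neq()$, then $v_{k+1}=0$, all entries of $w_{k+1}$ are $1$ or $5$, and the component of scale $2^{k+2}$ is of type a; if the component of scale $2^k$ contains a $U$ or an $E$, or if $w_k\in\{(1,1),(1,5),(3,7),(7,7)\}$, then the component of scale $2^{k+1}$ is of type a. **Algorithm.** Input: a $\mathbb{Z}$-lattice $M\subset V$ such that $M_p$ is maximal, and a symmetric $G\in M_n(\mathbb{Z}_p)$ that is the Gram matrix of an even $\mathbb{Z}_p$-lattice whose quadratic space over $\mathbb{Q}_p$ is isometric to $V_p$. 1. Let $d=p^k$ with $k\ge 0$ minimal such that $p^kG^{-1}$ has entries in $\mathbb{Z}_p$. 2. Let $L=\mathbb{Z}_p^n\subset\mathbb{Q}_p^n$ with Gram matrix $G$. Choose a maximal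 $\mathbb{Z}_p$-lattice $L_{\max}\supseteq L$ and let $L_B$ be the matrix whose rows are a basis of $L_{\max}$, with Gram matrix $G_{\max}$. Choose $T_L\in \mathrm{GL}_n(\mathbb{Z}_p)$ such that $T_LG_{\max}T_L^{\top}$ is in $p$-adic normal form, and put $B=(T_LL_B)^{-1}$. 3. Choose a basis $M_B$ of $M$, with Gram matrix $G_M$, and $T_M\in \mathrm{GL}_n(\mathbb{Z}_p)$ such that $T_MG_MT_M^{\top}$ is in $p$-adic normal form. Put $B'=B\,T_M\,M_B$, let $N\subset V_p$ be the $\mathbb{Z}_p$-lattice spanned by the $n$ vectors of $B'$, and return $(N\cap M)+dM$. **Theorem.** For every such input, each choice in the algorithm can be made, whatever the earlier choices were; and for all choices the returned $L'=(N\cap M)+dM$ is a lattice in $V$ such that $L'_q=M_q$ for all primes $q\neq p$, and $L'_p$ has a basis with Gram matrix $G$. -/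

import Mathlib

open scoped TensorProduct Pointwise Matrix

noncomputable section

namespace LocalMod

/-! ### Lattices, evenness, maximality, localization -/

/-- A submodule `L` of a quadratic space is even if `Q` takes values in `R` on `L`. -/
def IsEven {R F W : Type*} [CommRing R] [Field F] [Algebra R F] [AddCommGroup W] [Module F W]
    [Module R W] (Q : QuadraticForm F W) (L : Submodule R W) : Prop :=
  ∀ x ∈ L, Q x ∈ Set.range (algebraMap R F)

/-- `L` is a maximal `R`-lattice of `(W, Q)`: an even lattice that is not properly contained in
another even lattice of `(W, Q)`. -/
structure IsMaximalLattice {R F W : Type*} [CommRing R] [Field F] [Algebra R F] [AddCommGroup W]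
    [Module F W] [Module R W] [IsScalarTower R F W] (Q : QuadraticForm F W)
    (L : Submodule R W) : Prop where
  isLattice : L.IsLattice F
  even : IsEven Q L
  maximal : ∀ L' : Submodule R W, L'.IsLattice F → IsEven Q L' → L ≤ L' → L' = L

section Local

variable (p : ℕ) [Fact p.Prime] {V : Type*} [AddCommGroup V] [Module ℚ V]

/-- The canonical map `V → V_p = ℚ_p ⊗ V`. -/
def toLocal : V →ₗ[ℤ] ℚ_[p] ⊗[ℚ] V :=
  (TensorProduct.mk ℚ ℚ_[p] V 1).restrictScalars ℤ

/-- The completion `L_p = ℤ_p L ⊆ V_p` of a `ℤ`-submodule `L` of `V`. -/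
def localAt (L : Submodule ℤ V) : Submodule ℤ_[p] (ℚ_[p] ⊗[ℚ] V) :=
  Submodule.span ℤ_[p] (toLocal p '' (L : Set V))

/-- The quadratic form on `V_p` that extends `Q`. -/
abbrev localForm (Q : QuadraticForm ℚ V) : QuadraticForm ℚ_[p] (ℚ_[p] ⊗[ℚ] V) :=
  Q.baseChange ℚ_[p]

end Local

/-- The Gram matrix of the family `e` for the bilinear form
`B(x, y) = Q (x + y) - Q x - Q y`. -/
def gram {F W : Type*} [Field F] [AddCommGroup W] [Module F W] {n : ℕ} (Q : QuadraticForm F W)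
    (e : Fin n → W) : Matrix (Fin n) (Fin n) F :=
  Matrix.of fun i j => QuadraticMap.polar Q (e i) (e j)

/-- `L` has a basis with Gram matrix `G`. -/
def HasGram {R F W : Type*} [CommRing R] [Field F] [Algebra R F] [AddCommGroup W]
    [Module F W] [Module R W] {n : ℕ} (Q : QuadraticForm F W) (L : Submodule R W)
    (G : Matrix (Fin n) (Fin n) R) : Prop :=
  ∃ e : Module.Basis (Fin n) R L, gram Q (fun i => (e i : W)) = G.map (algebraMap R F)

section Standard

variable {p : ℕ} [Fact p.Prime] {n : ℕ}

/-- The quadratic form `x ↦ (xᵀ G x) / 2` on `ℚ_p ^ n`; for symmetric `G` the standard basis has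
Gram matrix `G`. -/
def formOf (G : Matrix (Fin n) (Fin n) ℤ_[p]) : QuadraticForm ℚ_[p] (Fin n → ℚ_[p]) :=
  (2 : ℚ_[p])⁻¹ • (G.map (algebraMap ℤ_[p] ℚ_[p])).toQuadraticForm'

/-- The standard lattice `ℤ_p ^ n` in `ℚ_p ^ n`. -/
def stdLattice (p : ℕ) [Fact p.Prime] (n : ℕ) : Submodule ℤ_[p] (Fin n → ℚ_[p]) :=
  Submodule.span ℤ_[p] (Set.range fun i : Fin n => (Pi.single i 1 : Fin n → ℚ_[p]))

/-- The exponent `k ≥ 0` of the `p`-part `p ^ k` of the denominator of a matrix. -/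
def denomExp (A : Matrix (Fin n) (Fin n) ℚ_[p]) : ℕ :=
  sInf {k : ℕ | ∀ i j, (p : ℚ_[p]) ^ k * A i j ∈ Set.range (algebraMap ℤ_[p] ℚ_[p])}

end Standard

/-! ### The `p`-adic normal form of a Gram matrix -/

/-- The building blocks of normal forms: `one c` is the `1 × 1` matrix `(c)`, and `two a b` is the
`2 × 2` matrix with diagonal entries `a` and off-diagonal entries `b`. -/
inductive Block where
  | one (c : ℤ)
  | two (a b : ℤ)

/-- The number of rows of the block diagonal matrix with the given blocks. -/
def blockSize : List Block → ℕ
  | [] => 0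
  | .one _ :: l => 1 + blockSize l
  | .two _ _ :: l => 2 + blockSize l

/-- The entries of the block diagonal matrix with the given blocks. -/
def blockEntry : List Block → ℕ → ℕ → ℤ
  | [], _, _ => 0
  | .one c :: l, i, j =>
      if i = 0 ∧ j = 0 then c
      else if 1 ≤ i ∧ 1 ≤ j then blockEntry l (i - 1) (j - 1) else 0
  | .two a b :: l, i, j =>
      if i < 2 ∧ j < 2 then (if i = j then a else b)
      else if 2 ≤ i ∧ 2 ≤ j then blockEntry l (i - 2) (j - 2) else 0

/-- `J` is the block diagonal matrix with the given blocks. -/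
def IsBlockDiagonal {n : ℕ} (J : Matrix (Fin n) (Fin n) ℤ) (l : List Block) : Prop :=
  blockSize l = n ∧ ∀ i j : Fin n, J i j = blockEntry l i j

/-- The least natural number that is not a square modulo `p` (`p` odd). -/
def leastNonresidue (p : ℕ) : ℕ := sInf {u : ℕ | ¬ IsSquare (u : ZMod p)}

/-- The component of scale `p ^ k` of a normal form, `p` odd: `p ^ k` times the diagonal matrix
`(1, …, 1)` or `(1, …, 1, u)`, with `u` the least nonresidue. -/
structure OddComponent where
  /-- the number of entries `1` -/
  ones : ℕ
  /-- whether there is a last entry `u` -/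
  nonres : Bool

/-- The blocks of a component of scale `p ^ k`, `p` odd. -/
def OddComponent.blocks (p k : ℕ) (c : OddComponent) : List Block :=
  List.replicate c.ones (.one (p ^ k)) ++
    (if c.nonres then [.one (p ^ k * leastNonresidue p)] else [])

/-- Normal form at an odd prime: block diagonal, with components of scales `1, p, p ^ 2, …`. -/
def IsOddNormalForm (p : ℕ) {n : ℕ} (J : Matrix (Fin n) (Fin n) ℤ) : Prop :=
  ∃ (K : ℕ) (c : ℕ → OddComponent),
    IsBlockDiagonal J ((List.range K).flatMap fun k => (c k).blocks p k)

/-- The component of scale `2 ^ k` of a `2`-adic normal form: `2 ^ k` times the orthogonal sum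
`U ⊥ … ⊥ U (⊥ V) ⊥ ⟨ε₁⟩ ⊥ …`, with `U = (0, 1; 1, 0)` and `V = (2, 1; 1, 2)`. -/
structure TwoComponent where
  /-- the number of copies of `U` -/
  u : ℕ
  /-- whether there is a copy of `V` -/
  v : Bool
  /-- the list of the units `ε₁, …` -/
  w : List ℕ

/-- The blocks of a component of scale `2 ^ k`. -/
def TwoComponent.blocks (k : ℕ) (c : TwoComponent) : List Block :=
  List.replicate c.u (.two 0 (2 ^ k)) ++ (if c.v then [.two (2 * 2 ^ k) (2 ^ k)] else []) ++
    c.w.map fun ε => .one (2 ^ k * ε)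

/-- The homogeneous normal forms: a list with one representative for each isometry class of
homogeneous `2`-adic lattices of a given scale and rank. -/
def TwoComponent.IsHomogeneousNormal (c : TwoComponent) : Prop :=
  c.w ∈ (if c.v then [[], [1], [3], [5], [7], [1, 3], [1, 7]]
    else [[], [1], [3], [5], [7], [1, 1], [1, 3], [1, 5], [1, 7], [3, 7], [7, 7]])

/-- There is no summand `⟨ε⟩`, or the determinant of the component, divided by its power of `2`,
is `± 1` modulo `8`. -/
def TwoComponent.IsTypeA (c : TwoComponent) : Prop :=
  c.w = [] ∨ ((if c.v then 3 else 1) * c.w.prod) % 8 = 1 ∨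
    ((if c.v then 3 else 1) * c.w.prod) % 8 = 7

/-- `2`-adic normal form: block diagonal, with components of scales `1, 2, 4, …`, each of them
homogeneous normal, and subject to the conditions on components of neighbouring scales that select
one representative of each isometry class of `2`-adic lattices. -/
def IsTwoNormalForm {n : ℕ} (J : Matrix (Fin n) (Fin n) ℤ) : Prop :=
  ∃ (K : ℕ) (c : ℕ → TwoComponent),
    IsBlockDiagonal J ((List.range K).flatMap fun k => (c k).blocks k) ∧
    (∀ k, (c k).IsHomogeneousNormal) ∧
    (∀ k, (c k).w ≠ [] → (c (k + 1)).v = false ∧ ∀ ε ∈ (c (k + 1)).w, ε = 1 ∨ ε = 5) ∧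
    (∀ k, (c k).u ≠ 0 ∨ (c k).v = true → (c (k + 1)).IsTypeA) ∧
    (∀ k, (c k).w ∈ [[1, 1], [1, 5], [3, 7], [7, 7]] → (c (k + 1)).IsTypeA) ∧
    (∀ k, (c k).w ≠ [] → (c (k + 2)).IsTypeA)

/-- `p`-adic normal form of a Gram matrix. -/
def IsNormalForm (p : ℕ) {n : ℕ} (J : Matrix (Fin n) (Fin n) ℤ) : Prop :=
  if p = 2 then IsTwoNormalForm J else IsOddNormalForm p J

section Algorithm

variable {p : ℕ} [Fact p.Prime] {n : ℕ}

/-- A `p`-adic integral matrix, viewed over `ℚ_p`. -/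
def toQp (T : Matrix (Fin n) (Fin n) ℤ_[p]) : Matrix (Fin n) (Fin n) ℚ_[p] :=
  T.map (algebraMap ℤ_[p] ℚ_[p])

/-- `T` is a possible return value of `NormalForm(A)`: it lies in `GL_n(ℤ_p)` and `T A Tᵀ` is in
`p`-adic normal form. -/
def IsNormalFormOutput (A : Matrix (Fin n) (Fin n) ℚ_[p]) (T : GL (Fin n) ℤ_[p]) : Prop :=
  ∃ J : Matrix (Fin n) (Fin n) ℤ, IsNormalForm p J ∧
    toQp T.val * A * (toQp T.val)ᵀ = J.map (Int.cast : ℤ → ℚ_[p])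

/-- `Lmax` is a possible return value of `OP-Maximal(L)`, where `L = ℤ_p ^ n` with Gram matrix `G`:
a `ℤ_p`-maximal overlattice of `L`. -/
def IsOPMaximalOutput (G : Matrix (Fin n) (Fin n) ℤ_[p])
    (Lmax : Submodule ℤ_[p] (Fin n → ℚ_[p])) : Prop :=
  stdLattice p n ≤ Lmax ∧ IsMaximalLattice (formOf G) Lmax

/-- The matrix whose rows are the vectors of a basis of `Lmax`. -/
def rows {Lmax : Submodule ℤ_[p] (Fin n → ℚ_[p])} (e : Module.Basis (Fin n) ℤ_[p] Lmax) :
    Matrix (Fin n) (Fin n) ℚ_[p] :=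
  Matrix.of fun i => (e i : Fin n → ℚ_[p])

variable {V : Type*} [AddCommGroup V] [Module ℚ V]

/-- The Gram matrix of `M` with respect to a `ℤ`-basis of `M`, viewed over `ℚ_p`. -/
def gramOfBasis (p : ℕ) [Fact p.Prime] (Q : QuadraticForm ℚ V) {M : Submodule ℤ V}
    (b : Module.Basis (Fin n) ℤ M) : Matrix (Fin n) (Fin n) ℚ_[p] :=
  (gram Q fun i => (b i : V)).map (algebraMap ℚ ℚ_[p])

/-- A run of the algorithm `Local-Modification(M, G, p)`: the values that its variables take. The
variables that are not listed are determined by these. -/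
structure Run (Q : QuadraticForm ℚ V) (M : Submodule ℤ V)
    (G : Matrix (Fin n) (Fin n) ℤ_[p]) where
  Lmax : Submodule ℤ_[p] (Fin n → ℚ_[p])
  Lmax_spec : IsOPMaximalOutput G Lmax
  LB : Module.Basis (Fin n) ℤ_[p] Lmax
  TL : GL (Fin n) ℤ_[p]
  TL_spec : IsNormalFormOutput (gram (formOf G) fun i => (LB i : Fin n → ℚ_[p])) TL
  MB : Module.Basis (Fin n) ℤ M
  TM : GL (Fin n) ℤ_[p]
  TM_spec : IsNormalFormOutput (gramOfBasis p Q MB) TM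

namespace Run

variable {Q : QuadraticForm ℚ V} {M : Submodule ℤ V} {G : Matrix (Fin n) (Fin n) ℤ_[p]}

/-- `d`, the `p`-part of the denominator of `G⁻¹`. -/
def d (_ : Run Q M G) : ℕ := p ^ denomExp (toQp G)⁻¹

/-- `B = (T_L L_B)⁻¹`. -/
def B (r : Run Q M G) : Matrix (Fin n) (Fin n) ℚ_[p] := (toQp r.TL.val * rows r.LB)⁻¹

/-- The rows of `B' = B T_M M_B`, as vectors of `V_p`. -/
def B' (r : Run Q M G) (i : Fin n) : ℚ_[p] ⊗[ℚ] V :=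
  ∑ j, (r.B * toQp r.TM.val) i j • toLocal p (r.MB j : V)

/-- `N`, the `ℤ_p`-lattice in `V_p` spanned by `B'`. -/
def N (r : Run Q M G) : Submodule ℤ_[p] (ℚ_[p] ⊗[ℚ] V) :=
  Submodule.span ℤ_[p] (Set.range r.B')

/-- The return value `(N ∩ M) + d M`. -/
def output (r : Run Q M G) : Submodule ℤ V :=
  ((r.N.restrictScalars ℤ).comap (toLocal p) ⊓ M) ⊔ (r.d : ℤ) • M

end Run

/-- Every call and every choice in the algorithm has a possible result, whatever the results of the
earlier ones: the algorithm never gets stuck. -/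
structure NeverStuck (Q : QuadraticForm ℚ V) (M : Submodule ℤ V)
    (G : Matrix (Fin n) (Fin n) ℤ_[p]) : Prop where
  opMaximal : ∃ Lmax, IsOPMaximalOutput G Lmax
  basisL : ∀ Lmax, IsOPMaximalOutput G Lmax → Nonempty (Module.Basis (Fin n) ℤ_[p] Lmax)
  normalFormL : ∀ Lmax, IsOPMaximalOutput G Lmax → ∀ LB : Module.Basis (Fin n) ℤ_[p] Lmax,
    ∃ TL, IsNormalFormOutput (gram (formOf G) fun i => (LB i : Fin n → ℚ_[p])) TL
  basisM : Nonempty (Module.Basis (Fin n) ℤ M)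
  normalFormM : ∀ MB : Module.Basis (Fin n) ℤ M,
    ∃ TM, IsNormalFormOutput (gramOfBasis p Q MB) TM

end Algorithm

end LocalMod

end

set_option linter.unusedSectionVars false

noncomputable section

namespace LocalMod

open QuadraticMap

/-! ### Quadratic lattices over `ℤ_p`: duals, maximal lattices and their discriminant values -/

section Lattices

variable {p : ℕ} [Fact p.Prime]

/-! The lattices L_max and M_p are maximal in isometric quadratic spaces, and the normal form of a
maximal lattice depends on the space alone (`IsNormalFormOutput.eq`). Hence the two normalized bases
have the same Gram matrix, and the linear map that sends one to the other is an isometry from ℚ_p^n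
onto V_p. It carries the standard basis to the vectors of B', so these have Gram matrix G and N is
an isometric copy of L (`gram_basis_eq`, `gram_B'`). From L ⊆ L_max it follows that B is integral
and N ⊆ M_p. The lattice L_max pairs integrally with L, so it lies in the dual of L, and d times
that dual lies in L by the choice of d; hence d M_p ⊆ N (`smul_mem_N`). A lattice N between d M_p
and M_p is the completion at p of (N ∩ M) + dM by approximation modulo d (`localAt_inf_sup`), and at
q ≠ p nothing changes because d is a unit there (`localAt_eq_of_smul_le`).

The weight of the proof lies in the normal forms. Everything about maximality is drawn from one
fact: a vector of the dual of L on which Q is integral already lies in L (`mem_of_mem_dual`). For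
existence, L is split into Jordan blocks of rank one (also two if p = 2). Maximality leaves only
scales 1 and p for odd p, only scales 1, 2, 4 for p = 2, and forbids most combinations of blocks;
the combinations that remain are brought to normal form by explicit integral changes of basis,
recorded as rewriting rules on lists of blocks.

Uniqueness uses three invariants: the rank, the determinant up to squares, and the set of values of
Q modulo ℤ_p on the dual lattice. The last one is the same for all maximal lattices of a space
(`exists_mem_dual_sub`). For odd p the component of scale p is anisotropic modulo p, hence one of a
few small forms; the values on the dual and the parity of the valuation of the determinant tell
these apart, and determinant and rank then fix the unimodular part. For p = 2 the unimodular part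
contributes no values, the components of scales 2 and 4 form one of finitely many tails, and a
finite computation shows that the invariants, together with the type a condition when the unimodular
part is nonzero, determine the normal form. -/

theorem mem_range_iff_norm_le_one {x : ℚ_[p]} :
    x ∈ Set.range (algebraMap ℤ_[p] ℚ_[p]) ↔ ‖x‖ ≤ 1 :=
  ⟨by rintro ⟨y, rfl⟩; exact y.2, fun h => ⟨⟨x, h⟩, rfl⟩⟩

theorem mem_one_iff_norm_le_one {x : ℚ_[p]} :
    x ∈ (1 : Submodule ℤ_[p] ℚ_[p]) ↔ ‖x‖ ≤ 1 := by
  rw [Submodule.mem_one, ← mem_range_iff_norm_le_one, Set.mem_range]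

theorem norm_add_le_one {x y : ℚ_[p]} (hx : ‖x‖ ≤ 1) (hy : ‖y‖ ≤ 1) : ‖x + y‖ ≤ 1 :=
  (Padic.nonarchimedean x y).trans (max_le hx hy)

theorem norm_sub_le_one {x y : ℚ_[p]} (hx : ‖x‖ ≤ 1) (hy : ‖y‖ ≤ 1) : ‖x - y‖ ≤ 1 := by
  rw [sub_eq_add_neg]; exact norm_add_le_one hx (by rwa [norm_neg])

theorem norm_mul_le_one {x y : ℚ_[p]} (hx : ‖x‖ ≤ 1) (hy : ‖y‖ ≤ 1) : ‖x * y‖ ≤ 1 := by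
  rw [norm_mul]; exact mul_le_one₀ hx (norm_nonneg _) hy

theorem norm_p_pow_mul_le_one (x : ℚ_[p]) : ∃ m : ℕ, ‖(p : ℚ_[p]) ^ m * x‖ ≤ 1 := by
  have hp : (1 : ℝ) < p := by exact_mod_cast (Fact.out : p.Prime).one_lt
  obtain ⟨m, hm⟩ := pow_unbounded_of_one_lt ‖x‖ hp
  refine ⟨m, ?_⟩
  rw [norm_mul, norm_pow, Padic.norm_p, inv_pow, inv_mul_le_iff₀ (by positivity)]
  simpa using hm.le

variable {W : Type*} [AddCommGroup W] [Module ℚ_[p] W] [Module ℤ_[p] W]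
  [IsScalarTower ℤ_[p] ℚ_[p] W]

theorem coe_smul_eq (a : ℤ_[p]) (x : W) : (a : ℚ_[p]) • x = a • x :=
  algebraMap_smul ℚ_[p] a x

theorem smul_mem_of_norm_le_one (L : Submodule ℤ_[p] W) {c : ℚ_[p]} (hc : ‖c‖ ≤ 1) {x : W}
    (hx : x ∈ L) : c • x ∈ L := by
  obtain ⟨a, rfl⟩ : ∃ a : ℤ_[p], (a : ℚ_[p]) = c := ⟨⟨c, hc⟩, rfl⟩
  rw [coe_smul_eq]
  exact L.smul_mem a hx

variable (Q : QuadraticForm ℚ_[p] W)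

/-- The dual lattice with respect to the polar form. -/
def dual (L : Submodule ℤ_[p] W) : Submodule ℤ_[p] W :=
  LinearMap.BilinForm.dualSubmodule (polarBilin Q) L

variable {Q}

theorem mem_dual {L : Submodule ℤ_[p] W} {x : W} :
    x ∈ dual Q L ↔ ∀ y ∈ L, ‖polar Q x y‖ ≤ 1 := by
  simp only [dual, LinearMap.BilinForm.mem_dualSubmodule, mem_one_iff_norm_le_one]
  rfl

theorem map_add_eq (x y : W) : Q (x + y) = Q x + Q y + polar Q x y := by
  simp [polar]

theorem IsEven.norm_le {L : Submodule ℤ_[p] W} (h : IsEven Q L) {x : W} (hx : x ∈ L) :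
    ‖Q x‖ ≤ 1 := mem_range_iff_norm_le_one.1 (h x hx)

theorem IsEven.norm_polar_le {L : Submodule ℤ_[p] W} (h : IsEven Q L) {x y : W} (hx : x ∈ L)
    (hy : y ∈ L) : ‖polar Q x y‖ ≤ 1 :=
  norm_sub_le_one (norm_sub_le_one (h.norm_le (L.add_mem hx hy)) (h.norm_le hx)) (h.norm_le hy)

theorem IsEven.le_dual {L : Submodule ℤ_[p] W} (h : IsEven Q L) : L ≤ dual Q L :=
  fun _ hx => mem_dual.2 fun _ hy => h.norm_polar_le hx hy

theorem IsEven.sup {L K : Submodule ℤ_[p] W} (hL : IsEven Q L) (hK : IsEven Q K)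
    (h : K ≤ dual Q L) : IsEven Q (L ⊔ K) := by
  intro x hx
  obtain ⟨a, ha, b, hb, rfl⟩ := Submodule.mem_sup.1 hx
  rw [mem_range_iff_norm_le_one, map_add_eq]
  refine norm_add_le_one (norm_add_le_one (hL.norm_le ha) (hK.norm_le hb)) ?_
  rw [polar_comm]
  exact mem_dual.1 (h hb) a ha

theorem isEven_span_singleton {x : W} (hx : ‖Q x‖ ≤ 1) :
    IsEven Q (Submodule.span ℤ_[p] {x}) := by
  intro y hy
  obtain ⟨a, rfl⟩ := Submodule.mem_span_singleton.1 hy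
  rw [mem_range_iff_norm_le_one, ← coe_smul_eq, QuadraticMap.map_smul, smul_eq_mul]
  exact norm_mul_le_one (norm_mul_le_one a.2 a.2) hx

namespace IsMaximalLattice

variable {L K : Submodule ℤ_[p] W}

/-- The sum L + K is again even, since the cross terms between L and K are integral; maximality then
absorbs K. -/
theorem le_of_le_dual (h : IsMaximalLattice Q L) (hK : IsEven Q K) (hfg : K.FG)
    (hd : K ≤ dual Q L) : K ≤ L := by
  have := h.isLattice
  have h1 : (L ⊔ K).IsLattice ℚ_[p] :=
    Submodule.IsLattice.of_le_of_isLattice_of_fg ℚ_[p] le_sup_left (h.isLattice.fg.sup hfg)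
  rw [← h.maximal _ h1 (h.even.sup hK hd) le_sup_left]
  exact le_sup_right

theorem mem_of_mem_dual (h : IsMaximalLattice Q L) {x : W} (hx : x ∈ dual Q L)
    (hQ : ‖Q x‖ ≤ 1) : x ∈ L := by
  refine h.le_of_le_dual (isEven_span_singleton hQ) (Submodule.fg_span_singleton x) ?_
    (Submodule.mem_span_singleton_self x)
  rw [Submodule.span_le]
  simpa using hx

theorem finite (h : IsMaximalLattice Q L) : Module.Finite ℚ_[p] W := by
  have := h.isLattice
  exact Module.Finite.of_basis ((Module.Free.chooseBasis ℤ_[p] L).extendOfIsLattice ℚ_[p])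

/-- Nondegeneracy comes for free: Q vanishes on a radical vector, so every multiple of it is even
and orthogonal to L and hence lies in L, which is impossible for a finitely generated L unless the
vector is zero. -/
theorem eq_zero_of_polar_eq_zero (h : IsMaximalLattice Q L) {x : W}
    (hx : ∀ y, polar Q x y = 0) : x = 0 := by
  have hL := h.isLattice
  have hmem : ∀ c : ℚ_[p], c • x ∈ L := fun c => by
    refine h.mem_of_mem_dual (mem_dual.2 fun y _ => by simp [hx]) ?_
    have : (2 : ℚ_[p]) * Q x = 0 := by
      have := hx x
      rw [polar_self] at this
      simpa using this
    have hQx : Q x = 0 := by simpa using this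
    simp [QuadraticMap.map_smul, hQx]
  let b := Module.Free.chooseBasis ℤ_[p] L
  have hb : ∀ y ∈ L, ∀ i, ‖(b.extendOfIsLattice ℚ_[p]).repr y i‖ ≤ 1 := by
    intro y hy i
    have h1 : y = ∑ j, ((b.repr ⟨y, hy⟩ j : ℤ_[p]) : ℚ_[p]) • b.extendOfIsLattice ℚ_[p] j := by
      have := congrArg Subtype.val (b.sum_repr ⟨y, hy⟩)
      simp only [Submodule.coe_sum, Submodule.coe_smul] at this
      refine this.symm.trans (Finset.sum_congr rfl fun j _ => ?_)
      rw [Module.Basis.extendOfIsLattice_apply]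
      exact (coe_smul_eq _ _).symm
    have h2 : (b.extendOfIsLattice ℚ_[p]).repr y i = ((b.repr ⟨y, hy⟩ i : ℤ_[p]) : ℚ_[p]) := by
      conv_lhs => rw [h1]
      rw [Module.Basis.repr_sum_self]
    rw [h2]
    exact (b.repr ⟨y, hy⟩ i).2
  apply (b.extendOfIsLattice ℚ_[p]).repr.map_eq_zero_iff.1
  ext i
  by_contra hne
  simp only [Finsupp.coe_zero, Pi.zero_apply] at hne
  -- The scalar is chosen so that the `i`-th coordinate becomes `p⁻¹`, which is not integral.
  have := hb _ (hmem ((p : ℚ_[p]) * (b.extendOfIsLattice ℚ_[p]).repr x i)⁻¹) i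
  have hp : ((p : ℕ) : ℚ_[p]) ≠ 0 := by exact_mod_cast (Fact.out : p.Prime).ne_zero
  rw [map_smul, Finsupp.smul_apply, smul_eq_mul, mul_inv, inv_mul_cancel_right₀ hne, norm_inv,
    Padic.norm_p, inv_inv] at this
  have hp1 : (1 : ℝ) < p := by exact_mod_cast (Fact.out : p.Prime).one_lt
  linarith

end IsMaximalLattice

theorem nondegenerate_of_forall (hQ : ∀ x, (∀ y, polar Q x y = 0) → x = 0) :
    LinearMap.BilinForm.Nondegenerate (polarBilin Q) := by
  constructor
  · intro x hx
    exact hQ x hx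
  · intro x hx
    exact hQ x fun y => by rw [polar_comm]; exact hx y

theorem exists_basis_of_isLattice [Module.Finite ℚ_[p] W] (L : Submodule ℤ_[p] W)
    [L.IsLattice ℚ_[p]] {n : ℕ} (hn : Module.finrank ℚ_[p] W = n) :
    Nonempty (Module.Basis (Fin n) ℤ_[p] L) := by
  have : Module.finrank ℤ_[p] L = n := by
    rw [← hn]
    simp only [Module.finrank, Submodule.IsLattice.rank' ℚ_[p] L]
  exact ⟨Module.finBasisOfFinrankEq ℤ_[p] L this⟩

theorem span_range_extendOfIsLattice {ι : Type*} (L : Submodule ℤ_[p] W) [L.IsLattice ℚ_[p]]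
    (b : Module.Basis ι ℤ_[p] L) :
    Submodule.span ℤ_[p] (Set.range (b.extendOfIsLattice ℚ_[p])) = L := by
  have h : Set.range (b.extendOfIsLattice ℚ_[p]) = L.subtype '' Set.range b := by
    rw [← Set.range_comp]
    congr 1
    ext i
    simp
  rw [h, ← Submodule.map_span, b.span_eq, Submodule.map_top, Submodule.range_subtype]

theorem isLattice_dual [Module.Finite ℚ_[p] W]
    (hB : LinearMap.BilinForm.Nondegenerate (polarBilin Q))
    (L : Submodule ℤ_[p] W) [L.IsLattice ℚ_[p]] :
    (dual Q L).IsLattice ℚ_[p] := by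
  classical
  let b := Module.Free.chooseBasis ℤ_[p] L
  have h : dual Q L = Submodule.span ℤ_[p] (Set.range
      (LinearMap.BilinForm.dualBasis (polarBilin Q) hB (b.extendOfIsLattice ℚ_[p]))) := by
    rw [← LinearMap.BilinForm.dualSubmodule_span_of_basis, span_range_extendOfIsLattice]
    rfl
  refine ⟨h ▸ Submodule.fg_span (Set.finite_range _), ?_⟩
  rw [h, Submodule.span_span_of_tower, Module.Basis.span_eq]

theorem dual_dual [Module.Finite ℚ_[p] W]
    (hB : LinearMap.BilinForm.Nondegenerate (polarBilin Q))
    (L : Submodule ℤ_[p] W) [L.IsLattice ℚ_[p]] : dual Q (dual Q L) = L := by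
  let b := Module.Free.chooseBasis ℤ_[p] L
  have := LinearMap.BilinForm.dualSubmodule_dualSubmodule_of_basis (R := ℤ_[p]) _ hB
    ⟨fun x y => polar_comm Q x y⟩ (b.extendOfIsLattice ℚ_[p])
  rwa [span_range_extendOfIsLattice] at this

theorem dual_sup (L K : Submodule ℤ_[p] W) : dual Q (L ⊔ K) = dual Q L ⊓ dual Q K := by
  ext x
  simp only [Submodule.mem_inf, mem_dual]
  constructor
  · exact fun h => ⟨fun y hy => h y (Submodule.mem_sup_left hy),
      fun y hy => h y (Submodule.mem_sup_right hy)⟩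
  · rintro ⟨h1, h2⟩ y hy
    obtain ⟨a, ha, b, hb, rfl⟩ := Submodule.mem_sup.1 hy
    rw [polar_add_right]
    exact norm_add_le_one (h1 a ha) (h2 b hb)

theorem dual_inf [Module.Finite ℚ_[p] W]
    (hB : LinearMap.BilinForm.Nondegenerate (polarBilin Q))
    (L K : Submodule ℤ_[p] W) [L.IsLattice ℚ_[p]] [K.IsLattice ℚ_[p]] :
    dual Q (L ⊓ K) = dual Q L ⊔ dual Q K := by
  have := isLattice_dual hB L
  have := isLattice_dual hB K
  rw [← dual_dual hB (dual Q L ⊔ dual Q K), dual_sup, dual_dual hB, dual_dual hB]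

/-- The values of `Q` modulo `ℤ_p` on the dual of a maximal lattice do not depend on the lattice. -/
theorem IsMaximalLattice.exists_mem_dual_sub {L K : Submodule ℤ_[p] W}
    (hL : IsMaximalLattice Q L) (hK : IsMaximalLattice Q K) {x : W} (hx : x ∈ dual Q L) :
    ∃ y ∈ dual Q K, ‖Q x - Q y‖ ≤ 1 := by
  have := hL.isLattice
  have := hK.isLattice
  have := hL.finite
  have hB := nondegenerate_of_forall fun _ => hL.eq_zero_of_polar_eq_zero
  -- The intersection of the dual of A with B is even because B is, so the maximal lattice A
  -- contains it.
  have key : ∀ {A B : Submodule ℤ_[p] W}, IsMaximalLattice Q A → IsMaximalLattice Q B →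
      dual Q A ⊓ B ≤ A := fun {A B} hA hB' => by
    have := hA.isLattice
    have := hB'.isLattice
    have := isLattice_dual hB A
    exact hA.le_of_le_dual (fun x hx => hB'.even x hx.2)
      (Submodule.IsLattice.fg (A := ℚ_[p])) inf_le_left
  have h1 : L ⊓ K = L ⊓ dual Q K :=
    le_antisymm (inf_le_inf_left _ hK.even.le_dual)
      (le_inf inf_le_left (by rw [inf_comm]; exact key hK hL))
  -- By `key`, L^# ∩ K = L ∩ K. Dualizing both sides gives L + K^# = L^# + K^#, which contains L^#.
  have h2 : dual Q L ≤ dual Q K ⊔ L := by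
    have := isLattice_dual hB K
    have h3 : dual Q (L ⊓ K) = dual Q (L ⊓ dual Q K) := by rw [← h1]
    have h4 : dual Q (dual Q L ⊓ K) = L ⊔ dual Q K := by
      have := isLattice_dual hB L
      rw [dual_inf hB, dual_dual hB]
    have h5 : dual Q L ⊓ K = L ⊓ K :=
      le_antisymm (le_inf (key hL hK) inf_le_right) (inf_le_inf_right _ hL.even.le_dual)
    rw [sup_comm, ← h4, h5, dual_inf hB]
    exact le_sup_left
  obtain ⟨y, hy, a, ha, rfl⟩ := Submodule.mem_sup.1 (h2 hx)
  refine ⟨y, hy, ?_⟩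
  -- With x = y + a, where a ∈ L, the difference Q(x) - Q(y) equals B(x, a) - Q(a), and x lies in
  -- the dual of L.
  have h6 : Q (y + a) - Q y = polar Q (y + a) a - Q a := by
    rw [polar_add_left, polar_self, map_add_eq]
    simp only [nsmul_eq_mul, Nat.cast_ofNat]
    ring
  rw [h6]
  exact norm_sub_le_one (mem_dual.1 hx a ha) (hL.even.norm_le ha)

/-- All even overlattices of L lie in the dual of L, which is a Noetherian module, so ascending
chains of them stop. -/
theorem exists_isMaximalLattice_ge [Module.Finite ℚ_[p] W]
    (hQ : ∀ x, (∀ y, polar Q x y = 0) → x = 0) (L : Submodule ℤ_[p] W) (hL : L.IsLattice ℚ_[p])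
    (he : IsEven Q L) : ∃ K, L ≤ K ∧ IsMaximalLattice Q K := by
  have hB := nondegenerate_of_forall hQ
  have hd := isLattice_dual hB L
  have hle : ∀ K : Submodule ℤ_[p] W, L ≤ K → IsEven Q K → K ≤ dual Q L := fun K h hK x hx =>
    mem_dual.2 fun y hy => hK.norm_polar_le hx (h hy)
  have hwf : WellFounded ((· > ·) : Submodule ℤ_[p] (dual Q L) → _ → Prop) :=
    wellFounded_gt
  let S : Set (Submodule ℤ_[p] (dual Q L)) :=
    {K | L ≤ K.map (dual Q L).subtype ∧ IsEven Q (K.map (dual Q L).subtype)}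
  have hS : ∀ K : Submodule ℤ_[p] W, L ≤ K → IsEven Q K →
      (K.comap (dual Q L).subtype).map (dual Q L).subtype = K := fun K h hK => by
    rw [Submodule.map_comap_subtype, inf_eq_right.2 (hle K h hK)]
  have hne : S.Nonempty := ⟨L.comap (dual Q L).subtype, by
    simp only [S, Set.mem_ofPred_eq, hS L le_rfl he]
    exact ⟨le_rfl, he⟩⟩
  obtain ⟨K, hK, hmax⟩ := hwf.has_min S hne
  refine ⟨K.map (dual Q L).subtype, hK.1, ?_, hK.2, ?_⟩
  · refine Submodule.IsLattice.of_le_of_isLattice_of_fg ℚ_[p] hK.1 ?_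
    exact (IsNoetherian.noetherian K).map _
  · intro K' _ hK' hKK'
    have h1 := hS K' (hK.1.trans hKK') hK'
    have h2 : K ≤ K'.comap (dual Q L).subtype := Submodule.map_le_iff_le_comap.1 hKK'
    have h3 : ¬ K < K'.comap (dual Q L).subtype :=
      hmax _ (by simp only [S, Set.mem_ofPred_eq, h1]; exact ⟨hK.1.trans hKK', hK'⟩)
    have h4 := eq_of_le_of_not_lt h2 h3
    rw [h4, h1]

variable {W' : Type*} [AddCommGroup W'] [Module ℚ_[p] W'] [Module ℤ_[p] W']
  [IsScalarTower ℤ_[p] ℚ_[p] W'] {Q' : QuadraticForm ℚ_[p] W'}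

theorem isLattice_map (φ : W ≃ₗ[ℚ_[p]] W') {L : Submodule ℤ_[p] W} (h : L.IsLattice ℚ_[p]) :
    (L.map (φ.toLinearMap.restrictScalars ℤ_[p])).IsLattice ℚ_[p] := by
  refine ⟨h.fg.map _, ?_⟩
  rw [Submodule.map_coe]
  change Submodule.span ℚ_[p] (φ.toLinearMap '' _) = ⊤
  rw [← Submodule.map_span, h.span_eq_top, Submodule.map_top, LinearMap.range_eq_top]
  exact φ.surjective

theorem IsMaximalLattice.map (φ : Q.IsometryEquiv Q') {L : Submodule ℤ_[p] W}
    (h : IsMaximalLattice Q L) :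
    IsMaximalLattice Q' (L.map (φ.toLinearEquiv.toLinearMap.restrictScalars ℤ_[p])) := by
  refine ⟨isLattice_map _ h.isLattice, ?_, ?_⟩
  · rintro _ ⟨x, hx, rfl⟩
    have : Q' (φ x) = Q x := φ.map_app x
    simpa [this] using h.even x hx
  · intro K hK hKe hle
    have h1 := h.maximal (K.map (φ.symm.toLinearEquiv.toLinearMap.restrictScalars ℤ_[p]))
      (isLattice_map _ hK) (by
        rintro _ ⟨x, hx, rfl⟩
        have : Q (φ.symm x) = Q' x := φ.symm.map_app x
        simpa [this] using hKe x hx) (by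
        intro x hx
        exact ⟨φ x, hle ⟨x, hx, rfl⟩, φ.toLinearEquiv.symm_apply_apply x⟩)
    rw [← h1]
    ext x
    constructor
    · intro hx
      exact ⟨φ.symm x, ⟨x, hx, rfl⟩, φ.toLinearEquiv.apply_symm_apply x⟩
    · rintro ⟨_, ⟨y, hy, rfl⟩, rfl⟩
      have : φ (φ.symm y) = y := φ.toLinearEquiv.apply_symm_apply y
      have h2 : (φ.toLinearEquiv.toLinearMap.restrictScalars ℤ_[p])
        ((φ.symm.toLinearEquiv.toLinearMap.restrictScalars ℤ_[p]) y) = y := this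
      rw [h2]; exact hy

end Lattices

/-! ### Orthogonal decompositions into blocks, and rewriting of block lists -/

section Realizes

variable {p : ℕ} [Fact p.Prime] {W : Type*} [AddCommGroup W] [Module ℚ_[p] W] [Module ℤ_[p] W]
  [IsScalarTower ℤ_[p] ℚ_[p] W]

/-- Orthogonality of two submodules. -/
def Orth (Q : QuadraticForm ℚ_[p] W) (K L : Submodule ℤ_[p] W) : Prop :=
  ∀ x ∈ K, ∀ y ∈ L, polar Q x y = 0

variable {Q : QuadraticForm ℚ_[p] W}

theorem Orth.symm {K L : Submodule ℤ_[p] W} (h : Orth Q K L) : Orth Q L K :=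
  fun x hx y hy => by rw [polar_comm]; exact h y hy x hx

theorem orth_sup_right {K L L' : Submodule ℤ_[p] W} :
    Orth Q K (L ⊔ L') ↔ Orth Q K L ∧ Orth Q K L' := by
  constructor
  · exact fun h => ⟨fun x hx y hy => h x hx y (Submodule.mem_sup_left hy),
      fun x hx y hy => h x hx y (Submodule.mem_sup_right hy)⟩
  · rintro ⟨h1, h2⟩ x hx y hy
    obtain ⟨a, ha, b, hb, rfl⟩ := Submodule.mem_sup.1 hy
    rw [polar_add_right, h1 x hx a ha, h2 x hx b hb, add_zero]

theorem orth_sup_left {K L L' : Submodule ℤ_[p] W} :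
    Orth Q (L ⊔ L') K ↔ Orth Q L K ∧ Orth Q L' K := by
  constructor
  · exact fun h => ⟨(orth_sup_right.1 h.symm).1.symm, (orth_sup_right.1 h.symm).2.symm⟩
  · exact fun h => (orth_sup_right.2 ⟨h.1.symm, h.2.symm⟩).symm

theorem orth_span_left {s : Set W} {L : Submodule ℤ_[p] W}
    (h : ∀ x ∈ s, ∀ y ∈ L, polar Q x y = 0) : Orth Q (Submodule.span ℤ_[p] s) L := by
  intro x hx y hy
  induction hx using Submodule.span_induction with
  | mem x hx => exact h x hx y hy
  | zero => simp
  | add a b _ _ ha hb => rw [polar_add_left, ha, hb, add_zero]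
  | smul c a _ ha => rw [← coe_smul_eq, polar_smul_left, ha, smul_zero]

theorem orth_span_right {s : Set W} {L : Submodule ℤ_[p] W}
    (h : ∀ x ∈ L, ∀ y ∈ s, polar Q x y = 0) : Orth Q L (Submodule.span ℤ_[p] s) :=
  (orth_span_left fun x hx y hy => by rw [polar_comm]; exact h y hy x hx).symm

/-- `K` is spanned by one or two vectors whose Gram matrix is the given block. -/
def IsBlock (Q : QuadraticForm ℚ_[p] W) : Block → Submodule ℤ_[p] W → Prop
  | .one c, K => ∃ x, polar Q x x = c ∧ K = Submodule.span ℤ_[p] {x}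
  | .two a b, K => ∃ x y, polar Q x x = a ∧ polar Q y y = a ∧ polar Q x y = b ∧
      K = Submodule.span ℤ_[p] {x, y}

/-- `L` is the orthogonal sum of submodules with the given blocks as Gram matrices. -/
def Realizes (Q : QuadraticForm ℚ_[p] W) : List Block → Submodule ℤ_[p] W → Prop
  | [], L => L = ⊥
  | b :: l, L => ∃ K K', IsBlock Q b K ∧ Realizes Q l K' ∧ Orth Q K K' ∧ L = K ⊔ K'

theorem realizes_append {l l' : List Block} {L : Submodule ℤ_[p] W} :
    Realizes Q (l ++ l') L ↔
      ∃ K K', Realizes Q l K ∧ Realizes Q l' K' ∧ Orth Q K K' ∧ L = K ⊔ K' := by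
  induction l generalizing L with
  | nil =>
    simp only [List.nil_append, Realizes]
    constructor
    · intro h
      exact ⟨⊥, L, rfl, h, fun x hx y _ => by simp [(Submodule.mem_bot _).1 hx], by simp⟩
    · rintro ⟨K, K', rfl, h, -, rfl⟩
      simpa using h
  | cons b l ih =>
    simp only [List.cons_append, Realizes]
    constructor
    · rintro ⟨K, K', hK, hK', ho, rfl⟩
      obtain ⟨K₁, K₂, h1, h2, h3, rfl⟩ := ih.1 hK'
      rw [orth_sup_right] at ho
      exact ⟨K ⊔ K₁, K₂, ⟨K, K₁, hK, h1, ho.1, rfl⟩, h2, orth_sup_left.2 ⟨ho.2, h3⟩,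
        (sup_assoc _ _ _).symm⟩
    · rintro ⟨_, K₂, ⟨K, K₁, hK, h1, ho, rfl⟩, h2, h3, rfl⟩
      rw [orth_sup_left] at h3
      exact ⟨K, K₁ ⊔ K₂, hK, ih.2 ⟨K₁, K₂, h1, h2, h3.2, rfl⟩, orth_sup_right.2 ⟨ho, h3.1⟩,
        sup_assoc _ _ _⟩

theorem Realizes.append_comm {l l' : List Block} {L : Submodule ℤ_[p] W}
    (h : Realizes Q (l ++ l') L) : Realizes Q (l' ++ l) L := by
  obtain ⟨K, K', h1, h2, h3, rfl⟩ := realizes_append.1 h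
  exact realizes_append.2 ⟨K', K, h2, h1, h3.symm, sup_comm _ _⟩

/-- Every lattice that realizes the first list of blocks realizes the second. -/
def Rewrites (Q : QuadraticForm ℚ_[p] W) (l l' : List Block) : Prop :=
  ∀ L, Realizes Q l L → Realizes Q l' L

theorem Rewrites.append {l₁ l₁' l₂ l₂' : List Block} (h₁ : Rewrites Q l₁ l₁')
    (h₂ : Rewrites Q l₂ l₂') : Rewrites Q (l₁ ++ l₂) (l₁' ++ l₂') := by
  intro L h
  obtain ⟨K, K', h1, h2, h3, rfl⟩ := realizes_append.1 h
  exact realizes_append.2 ⟨K, K', h₁ _ h1, h₂ _ h2, h3, rfl⟩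

theorem Rewrites.refl (l : List Block) : Rewrites Q l l := fun _ h => h

theorem Rewrites.trans {l₁ l₂ l₃ : List Block} (h₁ : Rewrites Q l₁ l₂) (h₂ : Rewrites Q l₂ l₃) :
    Rewrites Q l₁ l₃ := fun L h => h₂ L (h₁ L h)

/-- Orthogonal sums commute, so only the multiset of blocks matters. -/
theorem Rewrites.of_perm {l l' : List Block} (h : l.Perm l') : Rewrites Q l l' := by
  induction h with
  | nil => exact Rewrites.refl _
  | @cons b l₁ l₂ _ ih => exact (Rewrites.refl [b]).append ih
  | swap b b' l =>
    have : Rewrites Q ([b'] ++ [b]) ([b] ++ [b']) := fun _ h => h.append_comm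
    exact this.append (Rewrites.refl l)
  | trans _ _ h₁ h₂ => exact h₁.trans h₂

theorem span_image_Iio_one_add (f : ℕ → W) (m : ℕ) :
    Submodule.span ℤ_[p] (f '' Set.Iio (1 + m)) =
      Submodule.span ℤ_[p] {f 0} ⊔ Submodule.span ℤ_[p] ((fun i => f (i + 1)) '' Set.Iio m) := by
  rw [← Submodule.span_union]
  congr 1
  ext x
  simp only [Set.mem_image, Set.mem_Iio, Set.mem_union, Set.mem_singleton_iff]
  constructor
  · rintro ⟨i, hi, rfl⟩
    cases i with
    | zero => exact Or.inl rfl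
    | succ i => exact Or.inr ⟨i, by omega, rfl⟩
  · rintro (rfl | ⟨i, hi, rfl⟩)
    · exact ⟨0, by omega, rfl⟩
    · exact ⟨i + 1, by omega, rfl⟩

theorem span_image_Iio_two_add (f : ℕ → W) (m : ℕ) :
    Submodule.span ℤ_[p] (f '' Set.Iio (2 + m)) =
      Submodule.span ℤ_[p] {f 0, f 1} ⊔
        Submodule.span ℤ_[p] ((fun i => f (i + 2)) '' Set.Iio m) := by
  rw [show 2 + m = 1 + (1 + m) by ring, span_image_Iio_one_add, span_image_Iio_one_add,
    ← sup_assoc, ← Submodule.span_union]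
  rfl

/-- The lattice spanned by a family with block diagonal Gram matrix. -/
theorem realizes_of_family {l : List Block} {f : ℕ → W}
    (h : ∀ i < blockSize l, ∀ j < blockSize l, polar Q (f i) (f j) = blockEntry l i j) :
    Realizes Q l (Submodule.span ℤ_[p] (f '' Set.Iio (blockSize l))) := by
  induction l generalizing f with
  | nil => simp [Realizes, blockSize]
  | cons b l ih =>
    cases b with
    | one c =>
      simp only [blockSize] at h ⊢
      refine ⟨_, _, ⟨f 0, ?_, rfl⟩, ih (f := fun i => f (i + 1)) ?_, ?_,
        span_image_Iio_one_add _ _⟩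
      · rw [h 0 (by omega) 0 (by omega)]; simp [blockEntry]
      · intro i hi j hj
        rw [h (i + 1) (by omega) (j + 1) (by omega)]; simp [blockEntry]
      · refine orth_span_left fun x hx y hy => ?_
        refine orth_span_right (L := Submodule.span ℤ_[p] {x}) ?_ x
          (Submodule.mem_span_singleton_self x) y hy
        intro z hz
        obtain ⟨a, rfl⟩ := Submodule.mem_span_singleton.1 hz
        rintro _ ⟨i, hi, rfl⟩
        rw [← coe_smul_eq, polar_smul_left, hx, h 0 (by omega) (i + 1) (by simp at hi; omega)]
        simp [blockEntry]
    | two a b =>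
      simp only [blockSize] at h ⊢
      refine ⟨_, _, ⟨f 0, f 1, ?_, ?_, ?_, rfl⟩, ih (f := fun i => f (i + 2)) ?_, ?_,
        span_image_Iio_two_add _ _⟩
      · rw [h 0 (by omega) 0 (by omega)]; simp [blockEntry]
      · rw [h 1 (by omega) 1 (by omega)]; simp [blockEntry]
      · rw [h 0 (by omega) 1 (by omega)]; simp [blockEntry]
      · intro i hi j hj
        rw [h (i + 2) (by omega) (j + 2) (by omega)]; simp [blockEntry]
      · refine (orth_span_left fun y hy x hx => ?_ : Orth Q _ _).symm
        obtain ⟨i, hi, rfl⟩ := hy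
        simp only [Set.mem_Iio] at hi
        refine orth_span_right (L := Submodule.span ℤ_[p] {f (i + 2)}) ?_ _
          (Submodule.mem_span_singleton_self _) x hx
        intro z hz
        obtain ⟨c, rfl⟩ := Submodule.mem_span_singleton.1 hz
        rintro _ (rfl | rfl)
        · rw [← coe_smul_eq, polar_smul_left, h (i + 2) (by omega) 0 (by omega)]
          simp [blockEntry]
        · rw [← coe_smul_eq, polar_smul_left, h (i + 2) (by omega) 1 (by omega)]
          simp [blockEntry]

/-- This passes back to coordinates. Independence of the family is not claimed; it follows later by
comparing the number of vectors with the rank. -/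
theorem Realizes.exists_family {l : List Block} {L : Submodule ℤ_[p] W} (h : Realizes Q l L) :
    ∃ f : ℕ → W, L = Submodule.span ℤ_[p] (f '' Set.Iio (blockSize l)) ∧
      ∀ i < blockSize l, ∀ j < blockSize l, polar Q (f i) (f j) = blockEntry l i j := by
  induction l generalizing L with
  | nil => exact ⟨0, by simpa [blockSize, Realizes] using h, by simp [blockSize]⟩
  | cons b l ih =>
    obtain ⟨K, K', hb, hl, ho, rfl⟩ := h
    obtain ⟨f, rfl, hf⟩ := ih hl
    cases b with
    | one c =>
      obtain ⟨x, hx, rfl⟩ := hb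
      have hxf : ∀ i < blockSize l, polar Q x (f i) = 0 := fun i hi =>
        ho x (Submodule.mem_span_singleton_self x) _ (Submodule.subset_span ⟨i, hi, rfl⟩)
      refine ⟨fun i => i.casesOn x f, ?_, ?_⟩
      · simp only [blockSize]
        rw [span_image_Iio_one_add]
        rfl
      · simp only [blockSize]
        rintro (_ | i) hi (_ | j) hj
        · simp [blockEntry, hx]
        · simp [blockEntry, hxf j (by omega)]
        · simp [blockEntry, polar_comm Q (f i), hxf i (by omega)]
        · simp [blockEntry, hf i (by omega) j (by omega)]
    | two a b =>
      obtain ⟨x, y, hx, hy, hxy, rfl⟩ := hb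
      have hxf : ∀ i < blockSize l, polar Q x (f i) = 0 := fun i hi =>
        ho x (Submodule.subset_span (by simp)) _ (Submodule.subset_span ⟨i, hi, rfl⟩)
      have hyf : ∀ i < blockSize l, polar Q y (f i) = 0 := fun i hi =>
        ho y (Submodule.subset_span (by simp)) _ (Submodule.subset_span ⟨i, hi, rfl⟩)
      refine ⟨fun i => i.casesOn x fun i => i.casesOn y f, ?_, ?_⟩
      · simp only [blockSize]
        rw [span_image_Iio_two_add]
        rfl
      · simp only [blockSize]
        rintro (_ | _ | i) hi (_ | _ | j) hj
        · simp [blockEntry, hx]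
        · simp [blockEntry, hxy]
        · simp [blockEntry, hxf j (by omega)]
        · simp [blockEntry, polar_comm Q y x, hxy]
        · simp [blockEntry, hy]
        · simp [blockEntry, hyf j (by omega)]
        · simp [blockEntry, polar_comm Q (f i), hxf i (by omega)]
        · simp [blockEntry, polar_comm Q (f i), hyf i (by omega)]
        · simp [blockEntry, hf i (by omega) j (by omega)]

end Realizes

/-- The determinant of a block. -/
def Block.det : Block → ℤ
  | .one c => c
  | .two a b => a * a - b * b

theorem det_blockEntry {n : ℕ} {l : List Block} (h : blockSize l = n) :
    (Matrix.of fun i j : Fin n => blockEntry l i j).det = (l.map Block.det).prod := by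
  induction l generalizing n with
  | nil =>
    simp only [blockSize] at h
    subst h
    simp
  | cons b l ih =>
    rw [List.map_cons, List.prod_cons, ← ih rfl]
    cases b with
    | one c =>
      simp only [blockSize] at h
      subst h
      rw [← Matrix.det_submatrix_equiv_self (finSumFinEquiv (m := 1) (n := blockSize l))]
      have : ((Matrix.of fun i j : Fin (1 + blockSize l) =>
          blockEntry (Block.one c :: l) i j).submatrix
          (finSumFinEquiv (m := 1) (n := blockSize l)) finSumFinEquiv) =
          Matrix.fromBlocks (Matrix.of fun _ _ => c) 0 0
            (Matrix.of fun i j : Fin (blockSize l) => blockEntry l i j) := by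
        ext (i | i) (j | j)
        all_goals
          simp only [Matrix.submatrix_apply, Matrix.of_apply, finSumFinEquiv_apply_left,
            finSumFinEquiv_apply_right, Fin.val_castAdd, Fin.val_natAdd, Matrix.fromBlocks_apply₁₁,
            Matrix.fromBlocks_apply₁₂, Matrix.fromBlocks_apply₂₁, Matrix.fromBlocks_apply₂₂,
            blockEntry, Matrix.zero_apply]
        · exact if_pos ⟨by omega, by omega⟩
        · rw [if_neg (by omega), if_neg (by omega)]
        · rw [if_neg (by omega), if_neg (by omega)]
        · rw [if_neg (by omega), if_pos (by omega), Nat.add_sub_cancel_left,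
            Nat.add_sub_cancel_left]
      rw [this, Matrix.det_fromBlocks_zero₂₁, Matrix.det_fin_one]
      rfl
    | two a b =>
      simp only [blockSize] at h
      subst h
      rw [← Matrix.det_submatrix_equiv_self (finSumFinEquiv (m := 2) (n := blockSize l))]
      have : ((Matrix.of fun i j : Fin (2 + blockSize l) =>
          blockEntry (Block.two a b :: l) i j).submatrix
          (finSumFinEquiv (m := 2) (n := blockSize l)) finSumFinEquiv) =
          Matrix.fromBlocks (Matrix.of fun i j => if i = j then a else b) 0 0
            (Matrix.of fun i j : Fin (blockSize l) => blockEntry l i j) := by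
        ext (i | i) (j | j)
        all_goals
          simp only [Matrix.submatrix_apply, Matrix.of_apply, finSumFinEquiv_apply_left,
            finSumFinEquiv_apply_right, Fin.val_castAdd, Fin.val_natAdd, Matrix.fromBlocks_apply₁₁,
            Matrix.fromBlocks_apply₁₂, Matrix.fromBlocks_apply₂₁, Matrix.fromBlocks_apply₂₂,
            blockEntry, Matrix.zero_apply]
        · simp only [Fin.ext_iff]
          exact if_pos ⟨by omega, by omega⟩
        · rw [if_neg (by omega), if_neg (by omega)]
        · rw [if_neg (by omega), if_neg (by omega)]
        · rw [if_neg (by omega), if_pos (by omega), Nat.add_sub_cancel_left,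
            Nat.add_sub_cancel_left]
      rw [this, Matrix.det_fromBlocks_zero₂₁, Matrix.det_fin_two]
      simp [Block.det]

/-! ### Hensel's lemma for quadratic polynomials, and approximation by integers -/

section Hensel

variable {p : ℕ} [Fact p.Prime]

/-- Modulo p, zero is a root and the derivative there is the unit b, so Hensel's lemma applies.
Keeping the linear coefficient b, instead of extracting square roots, makes the lemma usable at p =
2 as well. -/
theorem exists_root_quadratic {a b c : ℚ_[p]} (ha : ‖a‖ ≤ 1) (hb : ‖b‖ = 1) (hc : ‖c‖ < 1) :
    ∃ t : ℚ_[p], ‖t‖ < 1 ∧ a * t * t + b * t + c = 0 := by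
  obtain ⟨a, rfl⟩ : ∃ a' : ℤ_[p], (a' : ℚ_[p]) = a := ⟨⟨a, ha⟩, rfl⟩
  obtain ⟨b, rfl⟩ : ∃ a' : ℤ_[p], (a' : ℚ_[p]) = b := ⟨⟨b, hb.le⟩, rfl⟩
  obtain ⟨c, rfl⟩ : ∃ a' : ℤ_[p], (a' : ℚ_[p]) = c := ⟨⟨c, hc.le⟩, rfl⟩
  rw [PadicInt.padic_norm_e_of_padicInt] at hb hc
  let F : Polynomial ℤ_[p] := .C a * .X ^ 2 + .C b * .X + .C c
  have h0 : F.aeval (0 : ℤ_[p]) = c := by simp [F]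
  have h1 : F.derivative.aeval (0 : ℤ_[p]) = b := by simp [F]
  obtain ⟨z, hz, hz', -⟩ := hensels_lemma (F := F) (a := (0 : ℤ_[p])) (by rw [h0, h1, hb]; simpa)
  refine ⟨z, ?_, ?_⟩
  · rw [h1, hb, sub_zero] at hz'
    exact hz'
  · have : a * z ^ 2 + b * z + c = 0 := by simpa [F] using hz
    have := congrArg (fun x : ℤ_[p] => (x : ℚ_[p])) this
    push_cast at this
    linear_combination this

theorem norm_eq_one_of_norm_sub_lt_one {a b : ℚ_[p]} (ha : ‖a‖ = 1) (h : ‖a - b‖ < 1) :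
    ‖b‖ = 1 := by
  have h1 : ‖a + -(a - b)‖ = max ‖a‖ ‖-(a - b)‖ :=
    Padic.add_eq_max_of_ne (by rw [norm_neg, ha]; exact h.ne')
  rw [norm_neg, ha, max_eq_left h.le] at h1
  simpa using h1

theorem norm_add_lt_one {x y : ℚ_[p]} (hx : ‖x‖ < 1) (hy : ‖y‖ < 1) : ‖x + y‖ < 1 :=
  (Padic.nonarchimedean x y).trans_lt (max_lt hx hy)

theorem norm_mul_lt_one {x y : ℚ_[p]} (hx : ‖x‖ ≤ 1) (hy : ‖y‖ < 1) : ‖x * y‖ < 1 := by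
  rw [norm_mul]; exact mul_lt_one_of_nonneg_of_lt_one_right hx (norm_nonneg _) hy

theorem norm_intCast_eq_one_iff_not_dvd {m : ℤ} : ‖(m : ℚ_[p])‖ = 1 ↔ ¬ (p : ℤ) ∣ m := by
  rw [← Padic.norm_intCast_lt_one_iff]
  have := Padic.norm_int_le_one (p := p) m
  constructor
  · intro h; rw [h]; exact lt_irrefl _
  · intro h; exact le_antisymm this (not_lt.1 h)

/-- Every `p`-adic integer is an integer modulo `p ^ k`. -/
theorem exists_nat_norm_sub_le {c : ℚ_[p]} (hc : ‖c‖ ≤ 1) (k : ℕ) :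
    ∃ m : ℕ, m < p ^ k ∧ ‖c - m‖ ≤ ((p : ℝ) ^ k)⁻¹ := by
  obtain ⟨c, rfl⟩ : ∃ a' : ℤ_[p], (a' : ℚ_[p]) = c := ⟨⟨c, hc⟩, rfl⟩
  refine ⟨c.appr k, c.appr_lt k, ?_⟩
  have := (PadicInt.norm_le_pow_iff_mem_span_pow _ k).2 (PadicInt.appr_spec k c)
  rw [zpow_neg, zpow_natCast] at this
  rw [← PadicInt.padic_norm_e_of_padicInt] at this
  simpa using this

theorem exists_eq_pow_mul {c : ℚ_[p]} (hc : ‖c‖ ≤ 1) (h0 : c ≠ 0) :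
    ∃ (k : ℕ) (u : ℚ_[p]), ‖u‖ = 1 ∧ c = (p : ℚ_[p]) ^ k * u := by
  obtain ⟨c, rfl⟩ : ∃ a' : ℤ_[p], (a' : ℚ_[p]) = c := ⟨⟨c, hc⟩, rfl⟩
  have hne : c ≠ 0 := by rintro rfl; simp at h0
  refine ⟨c.valuation, ((PadicInt.unitCoeff hne : ℤ_[p]) : ℚ_[p]), ?_, ?_⟩
  · rw [PadicInt.padic_norm_e_of_padicInt, PadicInt.norm_units]
  · conv_lhs => rw [PadicInt.unitCoeff_spec hne]
    push_cast
    ring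

end Hensel

/-! ### Changes of basis in rank two, and splitting off orthogonal summands -/

section Pairs

variable {p : ℕ} [Fact p.Prime] {W : Type*} [AddCommGroup W] [Module ℚ_[p] W] [Module ℤ_[p] W]
  [IsScalarTower ℤ_[p] ℚ_[p] W] {Q : QuadraticForm ℚ_[p] W}

theorem span_singleton_smul_eq {x : W} {s : ℚ_[p]} (hs : ‖s‖ = 1) :
    Submodule.span ℤ_[p] {s • x} = Submodule.span ℤ_[p] {x} := by
  apply le_antisymm
  · rw [Submodule.span_le, Set.singleton_subset_iff]
    exact smul_mem_of_norm_le_one _ hs.le (Submodule.mem_span_singleton_self x)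
  · rw [Submodule.span_le, Set.singleton_subset_iff]
    have h0 : s ≠ 0 := by rintro rfl; simp at hs
    have := smul_mem_of_norm_le_one (c := s⁻¹) (x := s • x) (Submodule.span ℤ_[p] {s • x})
      (by simp [hs]) (Submodule.mem_span_singleton_self _)
    rwa [smul_smul, inv_mul_cancel₀ h0, one_smul] at this

theorem span_pair_eq {x y : W} {a b c d : ℚ_[p]} (ha : ‖a‖ ≤ 1) (hb : ‖b‖ ≤ 1) (hc : ‖c‖ ≤ 1)
    (hd : ‖d‖ ≤ 1) (h : ‖a * d - b * c‖ = 1) :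
    Submodule.span ℤ_[p] {a • x + b • y, c • x + d • y} = Submodule.span ℤ_[p] {x, y} := by
  apply le_antisymm
  · have hx : x ∈ Submodule.span ℤ_[p] {x, y} := Submodule.subset_span (by simp)
    have hy : y ∈ Submodule.span ℤ_[p] {x, y} := Submodule.subset_span (by simp)
    rw [Submodule.span_le]
    rintro _ (rfl | rfl)
    · exact add_mem (smul_mem_of_norm_le_one _ ha hx) (smul_mem_of_norm_le_one _ hb hy)
    · exact add_mem (smul_mem_of_norm_le_one _ hc hx) (smul_mem_of_norm_le_one _ hd hy)
  · set x' := a • x + b • y with hx'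
    set y' := c • x + d • y with hy'
    have hxm : x' ∈ Submodule.span ℤ_[p] {x', y'} := Submodule.subset_span (by simp)
    have hym : y' ∈ Submodule.span ℤ_[p] {x', y'} := Submodule.subset_span (by simp)
    set D := a * d - b * c with hD
    have hD0 : D ≠ 0 := fun h0 => by rw [h0] at h; simp at h
    have hD1 : ‖D⁻¹‖ ≤ 1 := by simp [h]
    have e1 : x = D⁻¹ • (d • x' - b • y') := by
      rw [eq_inv_smul_iff₀ hD0, hx', hy', hD]
      module
    have e2 : y = D⁻¹ • (a • y' - c • x') := by
      rw [eq_inv_smul_iff₀ hD0, hx', hy', hD]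
      module
    rw [Submodule.span_le]
    rintro z (hz | hz)
    · rw [hz, e1]
      exact smul_mem_of_norm_le_one _ hD1 (sub_mem (smul_mem_of_norm_le_one _ hd hxm)
        (smul_mem_of_norm_le_one _ hb hym))
    · rw [Set.mem_singleton_iff.1 hz, e2]
      exact smul_mem_of_norm_le_one _ hD1 (sub_mem (smul_mem_of_norm_le_one _ ha hym)
        (smul_mem_of_norm_le_one _ hc hxm))

theorem polar_comb (x y : W) (a b c d : ℚ_[p]) :
    polar Q (a • x + b • y) (c • x + d • y) =
      a * c * polar Q x x + (a * d + b * c) * polar Q x y + b * d * polar Q y y := by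
  simp only [polar_add_left, polar_add_right, polar_smul_left, polar_smul_right, smul_eq_mul,
    polar_comm Q y x]
  ring

theorem norm_polar_le_of_span {s t : Set W} {M : ℝ} (hM : 0 ≤ M)
    (h : ∀ x ∈ s, ∀ y ∈ t, ‖polar Q x y‖ ≤ M) {x y : W} (hx : x ∈ Submodule.span ℤ_[p] s)
    (hy : y ∈ Submodule.span ℤ_[p] t) : ‖polar Q x y‖ ≤ M := by
  induction hx using Submodule.span_induction with
  | zero => simpa
  | add a b _ _ ha hb =>
    rw [polar_add_left]; exact (Padic.nonarchimedean _ _).trans (max_le ha hb)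
  | smul c a _ ha =>
    rw [← coe_smul_eq, polar_smul_left, smul_eq_mul, norm_mul]
    exact (mul_le_of_le_one_left (norm_nonneg _) c.2).trans ha
  | mem x hx =>
    induction hy using Submodule.span_induction with
    | zero => simpa
    | add a b _ _ ha hb =>
      rw [polar_add_right]; exact (Padic.nonarchimedean _ _).trans (max_le ha hb)
    | smul c a _ ha =>
      rw [← coe_smul_eq, polar_smul_right, smul_eq_mul, norm_mul]
      exact (mul_le_of_le_one_left (norm_nonneg _) c.2).trans ha
    | mem y hy => exact h x hx y hy

/-- Projecting a generating list along a submodule. -/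
theorem exists_orth_complement {K : Submodule ℤ_[p] W} {vs : List W}
    (h : ∀ v ∈ vs, ∃ w ∈ K, ∀ x ∈ K, polar Q x (v - w) = 0) :
    ∃ vs' : List W, vs'.length = vs.length ∧ Orth Q K (Submodule.span ℤ_[p] {v | v ∈ vs'}) ∧
      K ⊔ Submodule.span ℤ_[p] {v | v ∈ vs} = K ⊔ Submodule.span ℤ_[p] {v | v ∈ vs'} := by
  choose! w hw ho using h
  refine ⟨vs.map fun v => v - w v, by simp, ?_, ?_⟩
  · refine orth_span_right fun x hx y hy => ?_
    obtain ⟨v, hv, rfl⟩ := List.mem_map.1 hy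
    exact ho v hv x hx
  · apply le_antisymm
    · refine sup_le le_sup_left ?_
      rw [Submodule.span_le]
      intro v hv
      have h1 : v - w v ∈ K ⊔ Submodule.span ℤ_[p] {x | x ∈ vs.map fun v => v - w v} :=
        Submodule.mem_sup_right (Submodule.subset_span (List.mem_map.2 ⟨v, hv, rfl⟩))
      have h2 := add_mem h1 (Submodule.mem_sup_left (hw v hv))
      rwa [sub_add_cancel] at h2
    · refine sup_le le_sup_left ?_
      rw [Submodule.span_le]
      intro v hv
      obtain ⟨v, hv', rfl⟩ := List.mem_map.1 hv
      exact sub_mem (Submodule.mem_sup_right (Submodule.subset_span hv'))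
        (Submodule.mem_sup_left (hw v hv'))

theorem span_cons_list (x : W) (vs : List W) :
    Submodule.span ℤ_[p] {v | v ∈ x :: vs} =
      Submodule.span ℤ_[p] {x} ⊔ Submodule.span ℤ_[p] {v | v ∈ vs} := by
  rw [← Submodule.span_union]
  congr 1
  ext v
  simp

/-- The projection of v to the line of x has coefficient B(x, v) / B(x, x), which is integral by the
hypothesis on norms. -/
theorem exists_orth_complement_singleton {x : W} {vs : List W}
    (h : ∀ v ∈ vs, ‖polar Q x v‖ ≤ ‖polar Q x x‖) :
    ∃ vs' : List W, vs'.length = vs.length ∧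
      Orth Q (Submodule.span ℤ_[p] {x}) (Submodule.span ℤ_[p] {v | v ∈ vs'}) ∧
      Submodule.span ℤ_[p] {v | v ∈ x :: vs} =
        Submodule.span ℤ_[p] {x} ⊔ Submodule.span ℤ_[p] {v | v ∈ vs'} := by
  rw [span_cons_list]
  refine exists_orth_complement fun v hv => ?_
  refine ⟨(polar Q x v / polar Q x x) • x, smul_mem_of_norm_le_one _ ?_
    (Submodule.mem_span_singleton_self x), ?_⟩
  · rw [norm_div]
    exact div_le_one_of_le₀ (h v hv) (norm_nonneg _)
  · intro y hy
    obtain ⟨a, rfl⟩ := Submodule.mem_span_singleton.1 hy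
    rw [← coe_smul_eq, polar_smul_left, polar_sub_right, polar_smul_right, smul_eq_mul,
      smul_eq_mul, div_mul_cancel_of_imp, sub_self, mul_zero]
    intro h0
    have := h v hv
    rwa [h0, norm_zero, norm_le_zero_iff] at this

end Pairs

/-! ### Units, binary blocks and Jordan decomposition at 2 -/

section TwoAdic

theorem norm_two : ‖(2 : ℚ_[2])‖ = 2⁻¹ := by
  have := Padic.norm_p (p := 2)
  simpa using this

theorem norm_le_half_of_norm_lt_one {x : ℚ_[2]} (h : ‖x‖ < 1) : ‖x‖ ≤ 2⁻¹ := by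
  have := (Padic.norm_le_pow_iff_norm_lt_pow_add_one x (-1)).2 (by simpa using h)
  simpa using this

/-- A `2`-adic unit is `1` modulo `2`. -/
theorem norm_sub_one_lt_one {u : ℚ_[2]} (hu : ‖u‖ = 1) : ‖u - 1‖ < 1 := by
  obtain ⟨m, hm, h⟩ := exists_nat_norm_sub_le (p := 2) hu.le 1
  have h' : ‖u - m‖ < 1 := h.trans_lt (by norm_num)
  have h1 := norm_eq_one_of_norm_sub_lt_one hu h'
  have : m = 1 := by
    rcases (by omega : m = 0 ∨ m = 1) with rfl | rfl
    · simp at h1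
    · rfl
  simpa [this] using h'

/-- Substituting s = 1 + 2t turns s² = u into t² + t = (u - 1)/4, which has a unit linear
coefficient and an even constant term. -/
theorem exists_sq_eq {u : ℚ_[2]} (hu : ‖u - 1‖ ≤ 8⁻¹) : ∃ s : ℚ_[2], ‖s‖ = 1 ∧ s * s = u := by
  have h4 : ‖(4 : ℚ_[2])⁻¹‖ = 4 := by
    rw [norm_inv, show (4 : ℚ_[2]) = 2 * 2 by norm_num, norm_mul, norm_two]; norm_num
  obtain ⟨t, ht, h⟩ := exists_root_quadratic (p := 2) (a := 1) (b := 1) (c := -((u - 1) * 4⁻¹))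
    (by simp) (by simp) (by rw [norm_neg, norm_mul, h4]; linarith)
  refine ⟨1 + 2 * t, ?_, by linear_combination 4 * h⟩
  refine norm_eq_one_of_norm_sub_lt_one (a := 1) (by simp) ?_
  rw [show (1 : ℚ_[2]) - (1 + 2 * t) = -(2 * t) by ring, norm_neg, norm_mul, norm_two]
  linarith

theorem norm_odd {m : ℤ} (h : m % 2 = 1) : ‖(m : ℚ_[2])‖ = 1 := by
  rw [norm_intCast_eq_one_iff_not_dvd]
  push_cast
  omega

theorem norm_le_of_dvd {m : ℤ} (h : m % 8 = 0) : ‖(m : ℚ_[2])‖ ≤ 8⁻¹ := by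
  have := (Padic.norm_int_le_pow_iff_dvd (p := 2) m 3).2 (by push_cast; omega)
  norm_num at this ⊢
  exact this

theorem exists_sq_mul_eq {a b : ℤ} (ha : a % 2 = 1) (hab : a % 8 = b % 8) :
    ∃ s : ℚ_[2], ‖s‖ = 1 ∧ s * s * a = b := by
  have ha' := norm_odd ha
  have h0 : (a : ℚ_[2]) ≠ 0 := by intro h; simp [h] at ha'
  obtain ⟨s, hs, h⟩ := exists_sq_eq (u := b / a) (by
    rw [div_sub_one h0, norm_div, ha', div_one]
    exact_mod_cast norm_le_of_dvd (m := b - a) (by omega))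
  exact ⟨s, hs, by rw [h, div_mul_cancel₀ _ h0]⟩

theorem exists_unit_representative {c : ℚ_[2]} (hc : ‖c‖ ≤ 1) (h0 : c ≠ 0) :
    ∃ (k : ℕ) (ε : ℕ) (s : ℚ_[2]), (ε = 1 ∨ ε = 3 ∨ ε = 5 ∨ ε = 7) ∧ ‖s‖ = 1 ∧
      s * s * c = ((2 ^ k * ε : ℤ) : ℚ_[2]) := by
  obtain ⟨k, u, hu, rfl⟩ := exists_eq_pow_mul hc h0
  obtain ⟨m, hm, h⟩ := exists_nat_norm_sub_le (p := 2) hu.le 3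
  have h1 := norm_eq_one_of_norm_sub_lt_one hu (h.trans_lt (by norm_num))
  rw [Padic.norm_natCast_eq_one_iff, Nat.coprime_two_left, Nat.odd_iff] at h1
  have hu0 : u ≠ 0 := by rintro rfl; simp at hu
  obtain ⟨s, hs, h2⟩ := exists_sq_eq (u := m / u) (by
    rw [div_sub_one hu0, norm_div, hu, div_one, norm_sub_rev]
    norm_num at h ⊢
    exact h)
  refine ⟨k, m, s, by omega, hs, ?_⟩
  push_cast
  rw [h2]
  field_simp

variable {W : Type*} [AddCommGroup W] [Module ℚ_[2] W] [Module ℤ_[2] W]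
  [IsScalarTower ℤ_[2] ℚ_[2] W] {Q : QuadraticForm ℚ_[2] W}

/-- A root t of γt² + ut + α makes x' = x + ty isotropic. It pairs with y to qv, where v = u + 2tγ
is a unit, so y/v pairs with x' to q. Subtracting gx' with g = γ/v² from y/v makes the second vector
isotropic too. -/
theorem isBlock_hyperbolic {x y : W} {q : ℤ} {α u γ : ℚ_[2]} (hα : ‖α‖ < 1) (hu : ‖u‖ = 1)
    (hγ : ‖γ‖ ≤ 1) (hx : polar Q x x = 2 * q * α) (hxy : polar Q x y = q * u)
    (hy : polar Q y y = 2 * q * γ) : IsBlock Q (.two 0 q) (Submodule.span ℤ_[2] {x, y}) := by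
  obtain ⟨t, ht, h⟩ := exists_root_quadratic hγ hu hα
  have h2tγ : ‖2 * t * γ‖ < 1 := by
    rw [mul_comm]; exact norm_mul_lt_one hγ (norm_mul_lt_one (by rw [norm_two]; norm_num) ht)
  set v := u + 2 * t * γ with hv
  have hv1 : ‖v‖ = 1 := norm_eq_one_of_norm_sub_lt_one (a := u) hu (by
    rwa [hv, sub_add_cancel_left, norm_neg])
  have hv0 : v ≠ 0 := by intro h0; simp [h0] at hv1
  have hvi : ‖v⁻¹‖ = 1 := by simp [hv1]
  set g := γ * v⁻¹ * v⁻¹ with hg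
  have hg1 : ‖g‖ ≤ 1 := norm_mul_le_one (norm_mul_le_one hγ hvi.le) hvi.le
  refine ⟨(1 : ℚ_[2]) • x + t • y, (-g) • x + (v⁻¹ - g * t) • y, ?_, ?_, ?_,
    (span_pair_eq ?_ ?_ ?_ ?_ ?_).symm⟩
  · rw [polar_comb, hx, hy, hxy]
    push_cast
    linear_combination 2 * (q : ℚ_[2]) * h
  · rw [polar_comb, hx, hy, hxy]
    push_cast
    have e : v⁻¹ * v = 1 := inv_mul_cancel₀ hv0
    have e2 : g = γ * v⁻¹ * v⁻¹ := hg
    linear_combination 2 * (q : ℚ_[2]) * g ^ 2 * h - 2 * q * g * e + 2 * q * g * v⁻¹ * hv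
      - 2 * q * e2
  · rw [polar_comb, hx, hy, hxy]
    have e : v⁻¹ * v = 1 := inv_mul_cancel₀ hv0
    linear_combination (-2 * (q : ℚ_[2]) * g) * h + q * e - q * v⁻¹ * hv
  · simp
  · exact ht.le
  · rwa [norm_neg]
  · exact norm_sub_le_one hvi.le (norm_mul_le_one hg1 ht.le)
  · rw [show 1 * (v⁻¹ - g * t) - t * -g = v⁻¹ by ring, hvi]

theorem isBlock_anisotropic {x y : W} {q : ℤ} {α u γ : ℚ_[2]} (hα : ‖α‖ = 1) (hu : ‖u‖ = 1)
    (hγ : ‖γ‖ = 1) (hx : polar Q x x = 2 * q * α) (hxy : polar Q x y = q * u)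
    (hy : polar Q y y = 2 * q * γ) :
    IsBlock Q (.two (2 * q) q) (Submodule.span ℤ_[2] {x, y}) := by
  -- The constant term is α - 1, not α: the vector x' = x + ty now has B(x', x') = 2q. A unit is 1
  -- modulo 2, so the constant term is even.
  obtain ⟨t, ht, h⟩ := exists_root_quadratic hγ.le hu (norm_sub_one_lt_one hα)
  have h2tγ : ‖2 * t * γ‖ < 1 := by
    rw [mul_comm]; exact norm_mul_lt_one hγ.le (norm_mul_lt_one (by rw [norm_two]; norm_num) ht)
  set v := u + 2 * t * γ with hv
  have hv1 : ‖v‖ = 1 := norm_eq_one_of_norm_sub_lt_one (a := u) hu (by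
    rwa [hv, sub_add_cancel_left, norm_neg])
  have hv0 : v ≠ 0 := by intro h0; simp [h0] at hv1
  have hvi : ‖v⁻¹‖ = 1 := by simp [hv1]
  set g := γ * v⁻¹ * v⁻¹ with hg
  have hg1 : ‖g‖ = 1 := by rw [hg, norm_mul, norm_mul, hγ, hvi]; norm_num
  have h4 : ‖(4 : ℚ_[2])‖ < 1 := by
    rw [show (4 : ℚ_[2]) = 2 * 2 by norm_num, norm_mul, norm_two]; norm_num
  have h4g : ‖1 - 4 * g‖ = 1 := norm_eq_one_of_norm_sub_lt_one (a := 1) (by simp) (by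
    rw [show 1 - (1 - 4 * g) = g * 4 by ring]
    exact norm_mul_lt_one hg1.le h4)
  -- The vector y/v pairs with x' to q and has B-norm 2qg. Every rx' + (1 - 2r)y/v still pairs with
  -- x' to q, and its B-norm is 2q exactly when r is a root of this quadratic.
  obtain ⟨r, hr, h'⟩ := exists_root_quadratic (a := 4 * g - 1) (b := 1 - 4 * g) (c := g - 1)
    (by rw [← neg_sub, norm_neg, h4g]) h4g (norm_sub_one_lt_one hg1)
  have hs1 : ‖1 - 2 * r‖ = 1 := norm_eq_one_of_norm_sub_lt_one (a := 1) (by simp) (by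
    rw [show 1 - (1 - 2 * r) = 2 * r by ring]
    exact norm_mul_lt_one (by rw [norm_two]; norm_num) hr)
  refine ⟨(1 : ℚ_[2]) • x + t • y, r • x + (r * t + (1 - 2 * r) * v⁻¹) • y, ?_, ?_, ?_,
    (span_pair_eq ?_ ?_ ?_ ?_ ?_).symm⟩
  · rw [polar_comb, hx, hy, hxy]
    push_cast
    linear_combination 2 * (q : ℚ_[2]) * h
  · rw [polar_comb, hx, hy, hxy]
    push_cast
    have e : v⁻¹ * v = 1 := inv_mul_cancel₀ hv0
    have e2 : g = γ * v⁻¹ * v⁻¹ := hg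
    linear_combination 2 * (q : ℚ_[2]) * r ^ 2 * h + 2 * q * h'
      + 2 * q * r * (1 - 2 * r) * (e - v⁻¹ * hv) - 2 * q * (1 - 2 * r) ^ 2 * e2
  · rw [polar_comb, hx, hy, hxy]
    have e : v⁻¹ * v = 1 := inv_mul_cancel₀ hv0
    linear_combination (2 * (q : ℚ_[2]) * r) * h + q * (1 - 2 * r) * (e - v⁻¹ * hv)
  · simp
  · exact ht.le
  · exact hr.le
  · exact norm_add_le_one (norm_mul_le_one hr.le ht.le) (norm_mul_le_one hs1.le hvi.le)
  · rw [show 1 * (r * t + (1 - 2 * r) * v⁻¹) - t * r = (1 - 2 * r) * v⁻¹ by ring, norm_mul, hs1,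
      hvi, one_mul]

/-- The blocks of a `2`-adic Jordan decomposition. -/
inductive IsJordanTwo : Block → Prop
  | zero : IsJordanTwo (.one 0)
  | one (k ε : ℕ) (h : ε = 1 ∨ ε = 3 ∨ ε = 5 ∨ ε = 7) : IsJordanTwo (.one (2 ^ k * ε))
  | hyperbolic (k : ℕ) : IsJordanTwo (.two 0 (2 ^ k))
  | anisotropic (k : ℕ) : IsJordanTwo (.two (2 * 2 ^ k) (2 ^ k))

theorem exists_isBlock_one {x : W} (hx : ‖polar Q x x‖ ≤ 1) :
    ∃ c, IsJordanTwo (.one c) ∧ IsBlock Q (.one c) (Submodule.span ℤ_[2] {x}) := by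
  by_cases h0 : polar Q x x = 0
  · exact ⟨0, .zero, x, by simp [h0], rfl⟩
  · obtain ⟨k, ε, s, hε, hs, h⟩ := exists_unit_representative hx h0
    refine ⟨2 ^ k * ε, .one k ε hε, s • x, ?_, (span_singleton_smul_eq hs).symm⟩
    rw [polar_smul_left, polar_smul_right, smul_eq_mul, smul_eq_mul, ← mul_assoc, h]

theorem norm_div_two_mul_le_one {a q : ℚ_[2]} (hq : q ≠ 0) (h : ‖a‖ < ‖q‖) :
    ‖a / (2 * q)‖ ≤ 1 := by
  have h1 : ‖a / q‖ ≤ 2⁻¹ := norm_le_half_of_norm_lt_one (by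
    rw [norm_div, div_lt_one (norm_pos_iff.2 hq)]; exact h)
  rw [show a / (2 * q) = a / q * 2⁻¹ by field_simp, norm_mul, norm_inv, norm_two]
  linarith

/-- Up to the scale 2^k the plane has Gram matrix (2α, u; u, 2γ) with u a unit. If α or γ is even,
the plane is hyperbolic; if both are units, it is anisotropic. -/
theorem exists_isBlock_two {x y : W} (h1 : ‖polar Q x y‖ ≤ 1)
    (hx : ‖polar Q x x‖ < ‖polar Q x y‖) (hy : ‖polar Q y y‖ < ‖polar Q x y‖) :
    ∃ k : ℕ, ‖polar Q x y‖ = ‖(2 : ℚ_[2]) ^ k‖ ∧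
      (IsBlock Q (.two 0 (2 ^ k)) (Submodule.span ℤ_[2] {x, y}) ∨
        IsBlock Q (.two (2 * 2 ^ k) (2 ^ k)) (Submodule.span ℤ_[2] {x, y})) := by
  have h0 : polar Q x y ≠ 0 := fun h => by
    rw [h, norm_zero] at hx
    exact absurd hx (not_lt.2 (norm_nonneg _))
  obtain ⟨k, u, hu, h⟩ := exists_eq_pow_mul h1 h0
  have hn : ‖polar Q x y‖ = ‖(2 : ℚ_[2]) ^ k‖ := by
    rw [h, norm_mul, hu, mul_one]; rfl
  have hq : (2 : ℚ_[2]) ^ k ≠ 0 := pow_ne_zero k two_ne_zero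
  rw [hn] at hx hy
  have hα := norm_div_two_mul_le_one hq hx
  have hγ := norm_div_two_mul_le_one hq hy
  have e1 : polar Q x x = 2 * ((2 ^ k : ℤ) : ℚ_[2]) * (polar Q x x / (2 * 2 ^ k)) := by
    push_cast; field_simp
  have e2 : polar Q y y = 2 * ((2 ^ k : ℤ) : ℚ_[2]) * (polar Q y y / (2 * 2 ^ k)) := by
    push_cast; field_simp
  have e3 : polar Q x y = ((2 ^ k : ℤ) : ℚ_[2]) * u := by rw [h]; push_cast; rfl
  refine ⟨k, hn, ?_⟩
  rcases hα.lt_or_eq with hα | hα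
  · exact Or.inl (isBlock_hyperbolic hα hu hγ e1 e3 e2)
  rcases hγ.lt_or_eq with hγ | hγ
  · left
    rw [Set.pair_comm]
    exact isBlock_hyperbolic hγ hu hα.le e2 (by rw [polar_comm, e3]) e1
  · exact Or.inr (isBlock_anisotropic hα hu hγ e1 e3 e2)

/-- The block divided by b has determinant -1 or 3, a unit at 2, so the coefficients of the
projection are integral; in the second case Cramer's rule divides by 3. -/
theorem exists_projection_two {x y v : W} {a b : ℚ_[2]} (hb : b ≠ 0) (hx : polar Q x x = a)
    (hy : polar Q y y = a) (hxy : polar Q x y = b) (ha : a = 0 ∨ a = 2 * b)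
    (hvx : ‖polar Q x v‖ ≤ ‖b‖) (hvy : ‖polar Q y v‖ ≤ ‖b‖) :
    ∃ w ∈ Submodule.span ℤ_[2] {x, y}, ∀ z ∈ Submodule.span ℤ_[2] {x, y},
      polar Q z (v - w) = 0 := by
  have hxm : x ∈ Submodule.span ℤ_[2] {x, y} := Submodule.subset_span (by simp)
  have hym : y ∈ Submodule.span ℤ_[2] {x, y} := Submodule.subset_span (by simp)
  have hs : ‖polar Q x v / b‖ ≤ 1 := by
    rw [norm_div]; exact div_le_one_of_le₀ hvx (norm_nonneg _)
  have ht : ‖polar Q y v / b‖ ≤ 1 := by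
    rw [norm_div]; exact div_le_one_of_le₀ hvy (norm_nonneg _)
  set s := polar Q x v / b with hsd
  set t := polar Q y v / b with htd
  have es : polar Q x v = s * b := by rw [hsd, div_mul_cancel₀ _ hb]
  have et : polar Q y v = t * b := by rw [htd, div_mul_cancel₀ _ hb]
  have h3 : ‖(3 : ℚ_[2])⁻¹‖ ≤ 1 := by
    have := norm_odd (m := 3) (by norm_num)
    push_cast at this
    simp [this]
  have h2 : ‖(2 : ℚ_[2])‖ ≤ 1 := by rw [norm_two]; norm_num
  have key : ∀ c d : ℚ_[2], polar Q x (v - (c • x + d • y)) = s * b - c * a - d * b ∧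
      polar Q y (v - (c • x + d • y)) = t * b - c * b - d * a := fun c d => by
    simp only [polar_sub_right, polar_add_right, polar_smul_right, smul_eq_mul, hx, hy, hxy, es,
      et, polar_comm Q y x]
    constructor <;> ring
  have fin : ∀ c d : ℚ_[2], ‖c‖ ≤ 1 → ‖d‖ ≤ 1 → s * b - c * a - d * b = 0 →
      t * b - c * b - d * a = 0 → ∃ w ∈ Submodule.span ℤ_[2] {x, y},
      ∀ z ∈ Submodule.span ℤ_[2] {x, y}, polar Q z (v - w) = 0 := fun c d hc hd h1 h2 => by
    refine ⟨c • x + d • y, add_mem (smul_mem_of_norm_le_one _ hc hxm)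
      (smul_mem_of_norm_le_one _ hd hym), ?_⟩
    intro z hz
    refine orth_span_left (s := {x, y}) (L := Submodule.span ℤ_[2] {v - (c • x + d • y)}) ?_ z hz
      _ (Submodule.mem_span_singleton_self _)
    intro z hz z' hz'
    obtain ⟨r, rfl⟩ := Submodule.mem_span_singleton.1 hz'
    rw [← coe_smul_eq, polar_smul_right]
    rcases hz with rfl | rfl
    · rw [(key c d).1, h1, smul_zero]
    · rw [(key c d).2, h2, smul_zero]
  rcases ha with rfl | rfl
  · exact fin t s ht hs (by ring) (by ring)
  · exact fin ((2 * s - t) * 3⁻¹) ((2 * t - s) * 3⁻¹)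
      (norm_mul_le_one (norm_sub_le_one (norm_mul_le_one h2 hs) ht) h3)
      (norm_mul_le_one (norm_sub_le_one (norm_mul_le_one h2 ht) hs) h3) (by ring) (by ring)

/-- Among pairs of generators take one where B has the largest norm. If some diagonal value attains
this norm, a line splits off; otherwise the pair spans a plane that splits off. The generators need
not be independent, so zero blocks can occur. -/
theorem exists_realizes_two (n : ℕ) : ∀ vs : List W, vs.length = n →
    (∀ x ∈ Submodule.span ℤ_[2] {v | v ∈ vs}, ∀ y ∈ Submodule.span ℤ_[2] {v | v ∈ vs},
      ‖polar Q x y‖ ≤ 1) →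
    ∃ l, blockSize l = n ∧ (∀ b ∈ l, IsJordanTwo b) ∧
      Realizes Q l (Submodule.span ℤ_[2] {v | v ∈ vs}) := by
  classical
  induction n using Nat.strong_induction_on with
  | _ n ih =>
  intro vs hn hint
  rcases Nat.eq_zero_or_pos n with rfl | hpos
  · obtain rfl := List.eq_nil_of_length_eq_zero hn
    exact ⟨[], rfl, by simp, by simp [Realizes]⟩
  have hne : (vs.toFinset ×ˢ vs.toFinset).Nonempty := by
    obtain ⟨v, hv⟩ := List.exists_mem_of_length_pos (hn ▸ hpos)
    exact ⟨(v, v), by simp [hv]⟩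
  obtain ⟨⟨x, y⟩, hxy, hmax⟩ := Finset.exists_max_image _ (fun z : W × W => ‖polar Q z.1 z.2‖) hne
  simp only [Finset.mem_product, List.mem_toFinset] at hxy hmax
  have hmax' : ∀ a ∈ vs, ∀ b ∈ vs, ‖polar Q a b‖ ≤ ‖polar Q x y‖ := fun a ha b hb =>
    hmax (a, b) ⟨ha, hb⟩
  have hperm : ∀ {ws : List W}, vs.Perm ws →
      Submodule.span ℤ_[2] {v | v ∈ vs} = Submodule.span ℤ_[2] {v | v ∈ ws} := fun h => by
    congr 1; ext v; exact h.mem_iff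
  by_cases hd : ∃ z ∈ vs, ‖polar Q x y‖ ≤ ‖polar Q z z‖
  · obtain ⟨z, hz, hzm⟩ := hd
    have hp := List.perm_cons_erase hz
    obtain ⟨vs', hlen, ho, hs⟩ := exists_orth_complement_singleton (Q := Q) (x := z)
      (vs := vs.erase z) fun v hv => (hmax' z hz v (List.mem_of_mem_erase hv)).trans hzm
    rw [← hperm hp] at hs
    have hle : Submodule.span ℤ_[2] {v | v ∈ vs'} ≤ Submodule.span ℤ_[2] {v | v ∈ vs} := by
      rw [hs]; exact le_sup_right
    have hl := hp.length_eq
    simp only [List.length_cons] at hl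
    obtain ⟨l, h1, h2, h3⟩ := ih (n - 1) (by omega) vs' (by omega) fun a ha b hb =>
      hint a (hle ha) b (hle hb)
    obtain ⟨c, hc, hb⟩ := exists_isBlock_one (hint z (Submodule.subset_span hz) z
      (Submodule.subset_span hz))
    refine ⟨.one c :: l, by simp only [blockSize]; omega, ?_, _, _, hb, h3, ho, hs⟩
    intro b hb
    rcases List.mem_cons.1 hb with rfl | hb
    · exact hc
    · exact h2 b hb
  · push Not at hd
    have hne : y ≠ x := by
      rintro rfl
      exact lt_irrefl _ (hd y hxy.1)
    have hp := (List.perm_cons_erase hxy.1).trans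
      ((List.perm_cons_erase ((List.mem_erase_of_ne hne).2 hxy.2)).cons x)
    set ws := (vs.erase x).erase y with hws
    have hwsm : ∀ v ∈ ws, v ∈ vs := fun v hv => List.mem_of_mem_erase (List.mem_of_mem_erase hv)
    have hspan : Submodule.span ℤ_[2] {v | v ∈ vs} =
        Submodule.span ℤ_[2] {x, y} ⊔ Submodule.span ℤ_[2] {v | v ∈ ws} := by
      rw [hperm hp, span_cons_list, span_cons_list, ← sup_assoc, ← Submodule.span_union]
      rfl
    obtain ⟨k, hk, hb⟩ := exists_isBlock_two (hint x (Submodule.subset_span hxy.1) y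
      (Submodule.subset_span hxy.2)) (hd x hxy.1) (hd y hxy.2)
    obtain ⟨a, ha, hja, hb⟩ : ∃ a : ℤ, (a = 0 ∨ a = 2 * 2 ^ k) ∧ IsJordanTwo (.two a (2 ^ k)) ∧
        IsBlock Q (.two a (2 ^ k)) (Submodule.span ℤ_[2] {x, y}) := by
      rcases hb with hb | hb
      · exact ⟨0, Or.inl rfl, .hyperbolic k, hb⟩
      · exact ⟨_, Or.inr rfl, .anisotropic k, hb⟩
    have hproj : ∀ v ∈ ws, ∃ w ∈ Submodule.span ℤ_[2] {x, y},
        ∀ z ∈ Submodule.span ℤ_[2] {x, y}, polar Q z (v - w) = 0 := by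
      intro v hv
      have hvb : ∀ z ∈ Submodule.span ℤ_[2] {x, y},
          ‖polar Q z v‖ ≤ ‖(((2 ^ k : ℤ) : ℤ) : ℚ_[2])‖ := by
        intro z hz
        push_cast
        rw [← hk]
        refine norm_polar_le_of_span (s := {x, y}) (t := {v}) (norm_nonneg _) ?_ hz
          (Submodule.mem_span_singleton_self v)
        rintro a (rfl | rfl) b rfl
        · exact hmax' _ hxy.1 _ (hwsm _ hv)
        · exact hmax' _ hxy.2 _ (hwsm _ hv)
      obtain ⟨x', y', hx', hy', hxy', hs⟩ := hb
      rw [hs] at hvb ⊢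
      refine exists_projection_two (b := (((2 ^ k : ℤ) : ℤ) : ℚ_[2]))
        (by push_cast; exact pow_ne_zero k two_ne_zero) hx' hy' hxy' ?_ (hvb _ (Submodule.subset_span (by simp)))
        (hvb _ (Submodule.subset_span (by simp)))
      rcases ha with rfl | rfl
      · left; simp
      · right; push_cast; ring
    obtain ⟨vs', hlen, ho, hs⟩ := exists_orth_complement hproj
    rw [← hspan] at hs
    have hle : Submodule.span ℤ_[2] {v | v ∈ vs'} ≤ Submodule.span ℤ_[2] {v | v ∈ vs} := by
      rw [hs]; exact le_sup_right
    have hl := hp.length_eq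
    simp only [List.length_cons] at hl
    obtain ⟨l, h1, h2, h3⟩ := ih (n - 2) (by omega) vs' (by omega) fun a ha b hb =>
      hint a (hle ha) b (hle hb)
    refine ⟨.two a (2 ^ k) :: l, by simp only [blockSize]; omega, ?_, _, _, hb, h3, ho, hs⟩
    intro b hb
    rcases List.mem_cons.1 hb with rfl | hb
    · exact hja
    · exact h2 b hb

end TwoAdic

/-! ### Ranks, zero blocks and integral changes of basis -/

section General

variable {p : ℕ} [Fact p.Prime] {W : Type*} [AddCommGroup W] [Module ℚ_[p] W] [Module ℤ_[p] W]
  [IsScalarTower ℤ_[p] ℚ_[p] W] {Q : QuadraticForm ℚ_[p] W}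

theorem Realizes.finrank_le {l : List Block} {L : Submodule ℤ_[p] W} (h : Realizes Q l L)
    (hL : L.IsLattice ℚ_[p]) : Module.finrank ℚ_[p] W ≤ blockSize l := by
  classical
  obtain ⟨f, rfl, -⟩ := h.exists_family
  have h1 := hL.span_eq_top
  rw [Submodule.span_span_of_tower] at h1
  have h2 := finrank_span_finset_le_card (R := ℚ_[p]) ((Finset.range (blockSize l)).image f)
  have h3 : (((Finset.range (blockSize l)).image f : Finset W) : Set W) =
      f '' Set.Iio (blockSize l) := by
    ext; simp
  rw [h3, Set.finrank, h1, finrank_top] at h2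
  exact h2.trans (Finset.card_image_le.trans (by simp))

theorem IsMaximalLattice.eq_zero_of_orth {L : Submodule ℤ_[p] W} (hL : IsMaximalLattice Q L)
    {x : W} (h : ∀ y ∈ L, polar Q x y = 0) : x = 0 := by
  refine hL.eq_zero_of_polar_eq_zero fun y => ?_
  have hy : y ∈ Submodule.span ℚ_[p] (L : Set W) := by
    rw [hL.isLattice.span_eq_top]; trivial
  induction hy using Submodule.span_induction with
  | mem y hy => exact h y hy
  | zero => simp
  | add a b _ _ ha hb => rw [polar_add_right, ha, hb, add_zero]
  | smul c a _ ha => rw [polar_smul_right, ha, smul_zero]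

/-- A generator of ⟨0⟩ is orthogonal to the lattice, hence zero by nondegeneracy; the remaining
blocks are then too few to span the space. -/
theorem IsMaximalLattice.not_realizes_one_zero {L : Submodule ℤ_[p] W}
    (hL : IsMaximalLattice Q L) {l : List Block}
    (hl : blockSize (.one 0 :: l) = Module.finrank ℚ_[p] W)
    (h : Realizes Q (.one 0 :: l) L) : False := by
  obtain ⟨_, K, ⟨x, hx, rfl⟩, hK, ho, rfl⟩ := h
  have hx0 : x = 0 := hL.eq_zero_of_orth fun y hy => by
    obtain ⟨a, ha, b, hb, rfl⟩ := Submodule.mem_sup.1 hy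
    obtain ⟨c, rfl⟩ := Submodule.mem_span_singleton.1 ha
    rw [polar_add_right, ← coe_smul_eq, polar_smul_right, hx,
      ho x (Submodule.mem_span_singleton_self x) b hb]
    simp
  have h1 := hL.isLattice
  rw [hx0, Submodule.span_zero_singleton, bot_sup_eq] at h1
  have := hK.finrank_le h1
  simp only [blockSize] at hl
  omega

theorem Realizes.mem_block {l l' : List Block} {b : Block} {L : Submodule ℤ_[p] W}
    (hb : b ∈ l) (h : Realizes Q (l ++ l') L) : ∃ l'', (b :: l'').Perm (l ++ l') ∧
      Realizes Q (b :: l'') L := by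
  classical
  obtain ⟨s, t, rfl⟩ := List.append_of_mem hb
  have hp : (b :: (s ++ t ++ l')).Perm (s ++ b :: t ++ l') := by
    simpa using (List.perm_middle (a := b) (l₁ := s) (l₂ := t ++ l')).symm
  exact ⟨_, hp, Rewrites.of_perm hp.symm _ h⟩

theorem blockSize_append (l l' : List Block) :
    blockSize (l ++ l') = blockSize l + blockSize l' := by
  induction l with
  | nil => simp [blockSize]
  | cons b l ih => cases b <;> simp [blockSize, ih, add_assoc]

theorem blockSize_perm {l l' : List Block} (h : l.Perm l') : blockSize l = blockSize l' := by
  induction h with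
  | nil => rfl
  | cons b _ ih => cases b <;> simp [blockSize, ih]
  | swap b b' l => cases b <;> cases b' <;> simp only [blockSize] <;> omega
  | trans _ _ h₁ h₂ => exact h₁.trans h₂

/-- Base change by an integral matrix whose determinant is a `p`-adic unit. -/
theorem rewrites_of_matrix {l l' : List Block} {m : ℕ} (hl : blockSize l = m)
    (hl' : blockSize l' = m) (T : Matrix (Fin m) (Fin m) ℤ) (hT : ‖(T.det : ℚ_[p])‖ = 1)
    (hG : ∀ i j : Fin m, ∑ k, ∑ k', T i k * T j k' * blockEntry l k k' = blockEntry l' i j) :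
    Rewrites Q l l' := by
  intro L h
  obtain ⟨f, rfl, hf⟩ := h.exists_family
  rw [hl] at hf ⊢
  let g : ℕ → W := fun i => if h : i < m then ∑ k : Fin m, (T ⟨i, h⟩ k : ℚ_[p]) • f k else 0
  have hg : ∀ i : Fin m, g i = ∑ k : Fin m, (T i k : ℚ_[p]) • f k := fun i => by simp [g]
  have h1 : Realizes Q l' (Submodule.span ℤ_[p] (g '' Set.Iio (blockSize l'))) := by
    refine realizes_of_family fun i hi j hj => ?_
    rw [hl'] at hi hj
    have := hG ⟨i, hi⟩ ⟨j, hj⟩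
    simp only at this
    rw [← this, hg ⟨i, hi⟩, hg ⟨j, hj⟩]
    have hb : ∀ x y, polar Q x y = polarBilin Q x y := fun _ _ => rfl
    rw [hb]
    simp only [map_sum, LinearMap.sum_apply, map_smul, LinearMap.smul_apply, smul_eq_mul]
    simp only [Finset.mul_sum]
    rw [Finset.sum_comm]
    push_cast
    refine Finset.sum_congr rfl fun k _ => Finset.sum_congr rfl fun k' _ => ?_
    rw [← hb, hf k k.2 k' k'.2]
    ring
  rw [hl'] at h1
  convert h1 using 1
  have him : ∀ f : ℕ → W, f '' Set.Iio m = Set.range fun i : Fin m => f i := fun f => by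
    ext x
    simp only [Set.mem_image, Set.mem_Iio, Set.mem_range]
    exact ⟨fun ⟨i, hi, h⟩ => ⟨⟨i, hi⟩, h⟩, fun ⟨i, h⟩ => ⟨i, i.2, h⟩⟩
  rw [him, him]
  apply le_antisymm
  · rw [Submodule.span_le]
    rintro _ ⟨i, rfl⟩
    have hD : (T.det : ℚ_[p]) ≠ 0 := fun h0 => by simp [h0] at hT
    -- Cramer's rule expresses the old family through the new one, with the unit determinant as the
    -- only denominator.
    have hi : f i = (T.det : ℚ_[p])⁻¹ • ∑ j : Fin m, (T.adjugate i j : ℚ_[p]) • g j := by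
      rw [eq_inv_smul_iff₀ hD]
      simp only [hg, Finset.smul_sum, smul_smul]
      rw [Finset.sum_comm]
      have : ∀ k, ∑ j, (T.adjugate i j : ℚ_[p]) * T j k = if i = k then (T.det : ℚ_[p]) else 0 := by
        intro k
        have := congrFun (congrFun T.adjugate_mul i) k
        rw [Matrix.mul_apply] at this
        simp only [Matrix.smul_apply, Matrix.one_apply, smul_eq_mul, mul_ite, mul_one,
          mul_zero] at this
        exact_mod_cast congrArg (Int.cast : ℤ → ℚ_[p]) this
      simp only [← Finset.sum_smul, this]
      simp
    change f i ∈ _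
    rw [hi]
    refine smul_mem_of_norm_le_one _ (by simp [hT]) (Submodule.sum_mem _ fun j _ => ?_)
    exact smul_mem_of_norm_le_one _ (Padic.norm_int_le_one _) (Submodule.subset_span ⟨j, rfl⟩)
  · rw [Submodule.span_le]
    rintro _ ⟨i, rfl⟩
    change g i ∈ _
    rw [hg]
    refine Submodule.sum_mem _ fun j _ => ?_
    exact smul_mem_of_norm_le_one _ (Padic.norm_int_le_one _) (Submodule.subset_span ⟨j, rfl⟩)

theorem rewrites_one_one {A B x y z w : ℤ} (hu : ‖((x * w - y * z : ℤ) : ℚ_[p])‖ = 1)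
    (h : A * x * z + B * y * w = 0) :
    Rewrites Q [.one A, .one B]
      [.one (A * x ^ 2 + B * y ^ 2), .one (A * z ^ 2 + B * w ^ 2)] := by
  refine rewrites_of_matrix (m := 2) rfl rfl !![x, y; z, w] ?_ ?_
  · rw [Matrix.det_fin_two]
    simpa using hu
  · simp only [Fin.forall_fin_two, Fin.sum_univ_two]
    simp [blockEntry]
    refine ⟨⟨by ring, by linear_combination h⟩, by linear_combination h, by ring⟩

end General

/-! ### An obstruction to maximality at 2, and explicit rewriting rules -/

section TwoAdic

variable {W : Type*} [AddCommGroup W] [Module ℚ_[2] W] [Module ℤ_[2] W]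
  [IsScalarTower ℤ_[2] ℚ_[2] W] {Q : QuadraticForm ℚ_[2] W}

/-- Nondegenerate blocks whose entries are even. -/
inductive Block.IsEvenBlock : Block → Prop
  | one {c : ℤ} (h0 : c ≠ 0) (h : 2 ∣ c) : IsEvenBlock (.one c)
  | two {a b : ℤ} (h0 : b ≠ 0) (h : 2 ∣ b) (ha : b ∣ a) : IsEvenBlock (.two a b)

/-- The diagonal entry of a block. -/
def Block.diag : Block → ℤ
  | .one c => c
  | .two a _ => a

theorem norm_le_half_of_even {m : ℤ} (h : 2 ∣ m) : ‖(m : ℚ_[2])‖ ≤ 2⁻¹ := by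
  obtain ⟨k, rfl⟩ := h
  push_cast
  rw [norm_mul, norm_two]
  have := Padic.norm_int_le_one (p := 2) k
  linarith

theorem norm_intCast_le_of_dvd {a b : ℤ} (h : b ∣ a) : ‖(a : ℚ_[2])‖ ≤ ‖(b : ℚ_[2])‖ := by
  obtain ⟨k, rfl⟩ := h
  push_cast
  rw [norm_mul]
  exact mul_le_of_le_one_right (norm_nonneg _) (Padic.norm_int_le_one k)

/-- Here z is the vector to be halved later. The vector e certifies that z/2 is not in K: the norm
of B(e, ·) on K is already largest at z, and halving z would double it. -/
theorem IsBlock.exists_vector {b : Block} (hb : b.IsEvenBlock) {K : Submodule ℤ_[2] W}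
    (h : IsBlock Q b K) : ∃ z ∈ K, (∀ y ∈ K, ‖polar Q z y‖ ≤ 2⁻¹) ∧ polar Q z z = b.diag ∧
      ∃ e ∈ K, polar Q e z ≠ 0 ∧ ∀ y ∈ K, ‖polar Q e y‖ ≤ ‖polar Q e z‖ := by
  cases hb with
  | @one c h0 hc =>
    obtain ⟨x, hx, rfl⟩ := h
    have hm := Submodule.mem_span_singleton_self (R := ℤ_[2]) x
    have key : ∀ y ∈ Submodule.span ℤ_[2] {x}, ‖polar Q x y‖ ≤ ‖(c : ℚ_[2])‖ := fun y hy => by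
      refine norm_polar_le_of_span (norm_nonneg _) ?_ hm hy
      rintro _ rfl _ rfl
      rw [hx]
    refine ⟨x, hm, fun y hy => (key y hy).trans (norm_le_half_of_even hc), hx, x, hm, ?_, ?_⟩
    · rw [hx]; exact_mod_cast h0
    · rwa [hx]
  | @two a b h0 hb hab =>
    obtain ⟨x, y, hx, hy, hxy, rfl⟩ := h
    have hxm : x ∈ Submodule.span ℤ_[2] {x, y} := Submodule.subset_span (by simp)
    have hym : y ∈ Submodule.span ℤ_[2] {x, y} := Submodule.subset_span (by simp)
    have key : ∀ z ∈ Submodule.span ℤ_[2] {x, y}, ∀ z' ∈ Submodule.span ℤ_[2] {x, y},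
        ‖polar Q z z'‖ ≤ ‖(b : ℚ_[2])‖ := fun z hz z' hz' => by
      refine norm_polar_le_of_span (norm_nonneg _) ?_ hz hz'
      have ha := norm_intCast_le_of_dvd hab
      rintro _ (rfl | rfl) _ (rfl | rfl)
      · rwa [hx]
      · rw [hxy]
      · rw [polar_comm, hxy]
      · rwa [hy]
    refine ⟨x, hxm, fun z hz => (key x hxm z hz).trans (norm_le_half_of_even hb), hx, y, hym,
      ?_, ?_⟩
    · rw [polar_comm, hxy]; exact_mod_cast h0
    · rw [polar_comm, hxy]; exact key y hym

theorem Realizes.exists_vector {l : List Block} (hl : ∀ b ∈ l, b.IsEvenBlock) (hne : l ≠ [])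
    {K : Submodule ℤ_[2] W}
    (h : Realizes Q l K) : ∃ z ∈ K, (∀ y ∈ K, ‖polar Q z y‖ ≤ 2⁻¹) ∧
      polar Q z z = (l.map Block.diag).sum ∧
      ∃ e ∈ K, polar Q e z ≠ 0 ∧ ∀ y ∈ K, ‖polar Q e y‖ ≤ ‖polar Q e z‖ := by
  induction l generalizing K with
  | nil => exact absurd rfl hne
  | cons b l ih =>
    obtain ⟨K₁, K₂, hb, h2, ho, rfl⟩ := h
    obtain ⟨z, hz, hz1, hz2, e, he, he0, he1⟩ := hb.exists_vector (hl b (by simp))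
    obtain ⟨z', hz', hz1', hz2'⟩ : ∃ z' ∈ K₂, (∀ y ∈ K₂, ‖polar Q z' y‖ ≤ 2⁻¹) ∧
        polar Q z' z' = (l.map Block.diag).sum := by
      by_cases h0 : l = []
      · subst h0
        exact ⟨0, zero_mem _, by simp, by simp⟩
      · obtain ⟨z', h3, h4, h5, -⟩ := ih (fun b hb => hl b (by simp [hb])) h0 h2
        exact ⟨z', h3, h4, h5⟩
    have hez : polar Q e (z + z') = polar Q e z := by
      rw [polar_add_right, ho e he z' hz', add_zero]
    refine ⟨z + z', Submodule.add_mem_sup hz hz', ?_, ?_, e, Submodule.mem_sup_left he, ?_, ?_⟩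
    · intro y hy
      obtain ⟨a, ha, b, hb, rfl⟩ := Submodule.mem_sup.1 hy
      rw [polar_add_left, polar_add_right, polar_add_right, ho z hz b hb, ho.symm z' hz' a ha,
        add_zero, zero_add]
      exact (Padic.nonarchimedean _ _).trans (max_le (hz1 a ha) (hz1' b hb))
    · rw [polar_add_left, polar_add_right, polar_add_right, ho z hz z' hz',
        ho.symm z' hz' z hz, hz2, hz2']
      simp
    · rwa [hez]
    · intro y hy
      obtain ⟨a, ha, b, hb, rfl⟩ := Submodule.mem_sup.1 hy
      rw [hez, polar_add_right, ho e he b hb, add_zero]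
      exact he1 a ha

/-- Half the sum of one vector from each of several even blocks enlarges the lattice if it has
integral norm. -/
theorem IsMaximalLattice.not_realizes {L : Submodule ℤ_[2] W} (hL : IsMaximalLattice Q L)
    {l l' : List Block} (hsub : l.Sublist l') (h : Realizes Q l' L) (hne : l ≠ [])
    (hl : ∀ b ∈ l, b.IsEvenBlock) (h8 : (l.map Block.diag).sum % 8 = 0) : False := by
  obtain ⟨l'', hp⟩ := hsub.exists_perm_append
  obtain ⟨K, K', hK, -, ho, rfl⟩ := realizes_append.1 (Rewrites.of_perm hp _ h)
  obtain ⟨z, hz, hz1, hz2, e, he, he0, he1⟩ := hK.exists_vector hl hne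
  have h2i : ‖(2 : ℚ_[2])⁻¹‖ = 2 := by rw [norm_inv, norm_two, inv_inv]
  -- All pairings of z with the lattice are even, so z/2 is in the dual; and Q(z/2) = B(z, z)/8 is
  -- integral because the diagonal entries add up to a multiple of 8.
  have hmem : (2 : ℚ_[2])⁻¹ • z ∈ K ⊔ K' := by
    refine hL.mem_of_mem_dual (mem_dual.2 fun y hy => ?_) ?_
    · obtain ⟨a, ha, b, hb, rfl⟩ := Submodule.mem_sup.1 hy
      rw [polar_smul_left, polar_add_right, ho z hz b hb, add_zero, smul_eq_mul, norm_mul, h2i]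
      have := hz1 a ha
      linarith
    · have h1 : Q z = (l.map Block.diag).sum / 2 := by
        rw [← hz2, polar_self, nsmul_eq_mul]
        push_cast
        ring
      rw [QuadraticMap.map_smul, h1, smul_eq_mul]
      have h3 := norm_le_of_dvd h8
      rw [show (2 : ℚ_[2])⁻¹ * 2⁻¹ * (((l.map Block.diag).sum : ℤ) / 2) =
        2⁻¹ * 2⁻¹ * 2⁻¹ * ((l.map Block.diag).sum : ℤ) by ring]
      simp only [norm_mul, h2i]
      linarith
  obtain ⟨a, ha, b, hb, hab⟩ := Submodule.mem_sup.1 hmem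
  -- The part of z/2 in K pairs with e as z/2 does, with twice the norm of B(e, z), contrary to the
  -- choice of e.
  have h3 : polar Q e a = 2⁻¹ * polar Q e z := by
    rw [← smul_eq_mul, ← polar_smul_right, ← hab, polar_add_right, ho e he b hb, add_zero]
  have h4 := he1 a ha
  rw [h3, norm_mul, h2i] at h4
  have := norm_pos_iff.2 he0
  linarith

theorem rewrites_unit {m a b : ℤ} (ha : a % 2 = 1) (hab : a % 8 = b % 8) :
    Rewrites Q [.one (m * a)] [.one (m * b)] := by
  rintro L ⟨_, K', ⟨x, hx, rfl⟩, hK, ho, rfl⟩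
  obtain ⟨s, hs, h⟩ := exists_sq_mul_eq ha hab
  refine ⟨_, K', ⟨s • x, ?_, (span_singleton_smul_eq hs).symm⟩, hK, ho, rfl⟩
  rw [polar_smul_left, polar_smul_right, smul_eq_mul, smul_eq_mul, hx]
  push_cast
  rw [← h]
  ring

theorem rewrites_hyperbolic {q a b : ℤ} (ha : a % 2 = 0) (hb : b % 2 = 1) :
    Rewrites Q [.two (2 * q * a) (q * b)] [.two 0 q] := by
  rintro L ⟨_, K', ⟨x, y, hx, hy, hxy, rfl⟩, hK, ho, rfl⟩
  refine ⟨_, K', ?_, hK, ho, rfl⟩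
  have : ‖(a : ℚ_[2])‖ < 1 := (norm_le_half_of_even (by omega)).trans_lt (by norm_num)
  exact isBlock_hyperbolic (α := a) (u := b) (γ := a) this (norm_odd hb) this.le
    (by rw [hx]; push_cast; ring) (by rw [hxy]; push_cast; ring) (by rw [hy]; push_cast; ring)

theorem rewrites_anisotropic {q a b : ℤ} (ha : a % 2 = 1) (hb : b % 2 = 1) :
    Rewrites Q [.two (2 * q * a) (q * b)] [.two (2 * q) q] := by
  rintro L ⟨_, K', ⟨x, y, hx, hy, hxy, rfl⟩, hK, ho, rfl⟩
  refine ⟨_, K', ?_, hK, ho, rfl⟩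
  exact isBlock_anisotropic (α := a) (u := b) (γ := a) (norm_odd ha) (norm_odd hb) (norm_odd ha)
    (by rw [hx]; push_cast; ring) (by rw [hxy]; push_cast; ring) (by rw [hy]; push_cast; ring)

theorem rewrites_pair {A B x y z w : ℤ} (hu : (x * w - y * z) % 2 = 1)
    (h : A * x * z + B * y * w = 0) :
    Rewrites Q [.one A, .one B]
      [.one (A * x ^ 2 + B * y ^ 2), .one (A * z ^ 2 + B * w ^ 2)] :=
  rewrites_one_one (norm_odd hu) h

/-- The matrix has odd determinant and transforms E ⊥ E into two planes whose diagonal entries are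
divisible by 4 and whose off-diagonal entries are odd; such planes are hyperbolic. -/
theorem rewrites_anisotropic_anisotropic :
    Rewrites Q [.two 2 1, .two 2 1] [.two 0 1, .two 0 1] := by
  have h1 : Rewrites Q [.two 2 1, .two 2 1] [.two 4 3, .two 24 (-3)] := by
    refine rewrites_of_matrix (m := 4) rfl rfl
      !![1, 0, 1, 0; 0, 1, 1, 0; 1, 1, 0, -3; 1, 1, -3, 3] (norm_odd ?_) ?_
    · decide
    · decide
  refine h1.trans ((rewrites_hyperbolic (q := 1) (a := 2) (b := 3) (by norm_num)
    (by norm_num)).append (rewrites_hyperbolic (q := 1) (a := 12) (b := -3) (by norm_num)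
    (by norm_num)))

/-- Three orthogonal vectors x, y, z of equal norm contain a root lattice A₂, spanned by x - y and y
- z, with orthogonal vector x + y + z. The index of this sublattice is 3, a unit at 2. -/
theorem rewrites_triple {a : ℤ} (ha : a % 2 = 1) :
    Rewrites Q [.one (2 * a), .one (2 * a), .one (2 * a)] [.two 4 2, .one (2 * (3 * a))] := by
  have h1 : Rewrites Q [.one (2 * a), .one (2 * a), .one (2 * a)]
      [.two (2 * 2 * a) (2 * -a), .one (2 * (3 * a))] := by
    refine rewrites_of_matrix (m := 3) rfl rfl !![1, -1, 0; 0, 1, -1; 1, 1, 1] (norm_odd ?_) ?_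
    · decide
    · simp [Fin.forall_fin_succ, Fin.sum_univ_succ, blockEntry]
      ring_nf
      simp
  exact h1.trans ((rewrites_anisotropic (q := 2) (a := a) (b := -a) ha (by omega)).append
    (Rewrites.refl [_]))

/-- The vectors x + ay and x + z span a plane of type E, and 2x - 2ay + z is orthogonal to both. Its
unit is -3a, which is 5a modulo 8; the factor compensates the change of determinant from -1 to 3. -/
theorem rewrites_hyperbolic_one {a : ℤ} (ha : a % 2 = 1) :
    Rewrites Q [.two 0 1, .one (2 * a)] [.two 2 1, .one (2 * (5 * a))] := by
  have h1 : Rewrites Q [.two 0 1, .one (2 * a)]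
      [.two (2 * 1 * a) (1 * a), .one (2 * (-3 * a))] := by
    refine rewrites_of_matrix (m := 3) rfl rfl !![1, a, 0; 1, 0, 1; 2, -2 * a, 1] (norm_odd ?_) ?_
    · rw [Matrix.det_fin_three]
      simp
      omega
    · simp [Fin.forall_fin_succ, Fin.sum_univ_succ, blockEntry]
      ring_nf
      simp
  exact h1.trans ((rewrites_anisotropic (q := 1) ha ha).append
    (rewrites_unit (by omega) (by omega)))

theorem rewrites_anisotropic_one {a : ℤ} (ha : a % 2 = 1) :
    Rewrites Q [.two 2 1, .one (2 * a)] [.two 0 1, .one (2 * (5 * a))] := by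
  have h1 : Rewrites Q [.two 2 1, .one (2 * a)]
      [.two (2 * 1 * (1 + a)) (1 * (1 + 2 * a)), .one (2 * (a * (12 * a + 9)))] := by
    refine rewrites_of_matrix (m := 3) rfl rfl
      !![1, 0, 1; 0, 1, 1; -2 * a, -2 * a, 3] (norm_odd ?_) ?_
    · rw [Matrix.det_fin_three]
      simp
    · simp [Fin.forall_fin_succ, Fin.sum_univ_succ, blockEntry]
      ring_nf
      simp
  have h2 : a * (12 * a + 9) % 8 = 5 * a % 8 := by
    obtain ⟨k, rfl⟩ : ∃ k, a = 2 * k + 1 := ⟨a / 2, by omega⟩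
    have : (2 * k + 1) * (12 * (2 * k + 1) + 9) =
        5 * (2 * k + 1) + 8 * (6 * k ^ 2 + 7 * k + 2) := by
      ring
    rw [this, Int.add_mul_emod_self_left]
  exact h1.trans ((rewrites_hyperbolic (q := 1) (by omega) (by omega)).append
    (rewrites_unit (by omega) h2))

end TwoAdic

/-! ### Sorting the Jordan blocks of a maximal 2-adic lattice -/

section TwoAdic

variable {W : Type*} [AddCommGroup W] [Module ℚ_[2] W] [Module ℤ_[2] W]
  [IsScalarTower ℤ_[2] ℚ_[2] W] {Q : QuadraticForm ℚ_[2] W}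

/-- A decidable form of `Block.IsEvenBlock`. -/
def Block.evenCheck : Block → Bool
  | .one c => c != 0 && c % 2 == 0
  | .two a b => b != 0 && b % 2 == 0 && a % b == 0

theorem Block.isEvenBlock_of_check {b : Block} (h : b.evenCheck = true) : b.IsEvenBlock := by
  cases b with
  | one c =>
    simp only [evenCheck, Bool.and_eq_true, bne_iff_ne, ne_eq, beq_iff_eq] at h
    exact .one h.1 (Int.dvd_of_emod_eq_zero h.2)
  | two a b =>
    simp only [evenCheck, Bool.and_eq_true, bne_iff_ne, ne_eq, beq_iff_eq] at h
    exact .two h.1.1 (Int.dvd_of_emod_eq_zero h.1.2) (Int.dvd_of_emod_eq_zero h.2)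

/-- In this form the obstruction is a Boolean condition on explicit blocks, so that `decide` can
settle the case distinctions below. -/
theorem IsMaximalLattice.not_realizes_of_check {L : Submodule ℤ_[2] W}
    (hL : IsMaximalLattice Q L) {l l₁ l₂ : List Block} (h : Realizes Q (l₁ ++ l₂) L)
    (hsub : l.Sublist l₁)
    (hc : (!l.isEmpty && l.all Block.evenCheck && (l.map Block.diag).sum % 8 == 0) = true) :
    False := by
  simp only [Bool.and_eq_true, Bool.not_eq_true', List.isEmpty_eq_false_iff, List.all_eq_true,
    beq_iff_eq] at hc
  exact hL.not_realizes (hsub.trans (List.sublist_append_left _ _)) h hc.1.1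
    (fun b hb => Block.isEvenBlock_of_check (hc.1.2 b hb)) hc.2

/-- The blocks of the component of scale `1`. -/
def headBlocks (u : ℕ) (v : Bool) : List Block :=
  List.replicate u (.two 0 1) ++ if v then [.two 2 1] else []

/-- The blocks of the components of scales `2` and `4`. -/
def tailBlocks (v : Bool) (w w' : List ℕ) : List Block :=
  (if v then [.two 4 2] else []) ++ (w.map fun ε : ℕ => .one (2 * (ε : ℤ))) ++
    w'.map fun ε : ℕ => .one (4 * (ε : ℤ))

/-- The components of scales `2` and `4` of maximal lattices. -/
inductive IsTail : Bool → List ℕ → List ℕ → Prop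
  | nil : IsTail false [] []
  | aniso : IsTail true [] []
  | one (a : ℕ) (ha : a = 1 ∨ a = 3 ∨ a = 5 ∨ a = 7) : IsTail false [a] []
  | anisoOne (a : ℕ) (ha : a = 1 ∨ a = 3 ∨ a = 5 ∨ a = 7) : IsTail true [a] []
  | pair (a b : ℕ) (h : a = 1 ∧ b = 1 ∨ a = 1 ∧ b = 5 ∨ a = 3 ∧ b = 7 ∨ a = 7 ∧ b = 7) :
      IsTail false [a, b] []
  | oneFour (a b : ℕ) (ha : a = 1 ∨ a = 3 ∨ a = 5 ∨ a = 7) (hb : b = 1 ∨ b = 5) :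
      IsTail false [a] [b]
  | four (a : ℕ) (ha : a = 1 ∨ a = 3 ∨ a = 5 ∨ a = 7) : IsTail false [] [a]

/-- The Jordan blocks of maximal lattices. -/
inductive IsMaximalBlock : Block → Prop
  | hyperbolic : IsMaximalBlock (.two 0 1)
  | anisotropic : IsMaximalBlock (.two 2 1)
  | anisotropicTwo : IsMaximalBlock (.two 4 2)
  | oneTwo (a : ℕ) (ha : a = 1 ∨ a = 3 ∨ a = 5 ∨ a = 7) : IsMaximalBlock (.one (2 * a))
  | oneFour (a : ℕ) (ha : a = 1 ∨ a = 3 ∨ a = 5 ∨ a = 7) : IsMaximalBlock (.one (4 * a))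

theorem rewrites_pair_unit {m m' a b a' b' c d x y z w : ℤ} (hu : (x * w - y * z) % 2 = 1)
    (h : m * a * x * z + m' * b * y * w = 0) (hA : m * a * x ^ 2 + m' * b * y ^ 2 = m * c)
    (hB : m * a * z ^ 2 + m' * b * w ^ 2 = m' * d) (hc : c % 2 = 1) (hd : d % 2 = 1)
    (hca : c % 8 = a' % 8) (hdb : d % 8 = b' % 8) :
    Rewrites Q [.one (m * a), .one (m' * b)] [.one (m * a'), .one (m' * b')] := by
  have := rewrites_pair (Q := Q) hu h
  rw [hA, hB] at this
  exact this.trans ((rewrites_unit hc hca).append (rewrites_unit hd hdb))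

theorem rewrites_swap (a b : Block) : Rewrites Q [a, b] [b, a] :=
  Rewrites.of_perm (List.Perm.swap b a [])

/-- The vectors x + 2y and 2x - y are orthogonal, both have five times the original norm, and the
base change has determinant -5. Multiplication by 5 exchanges 1 with 5 and 3 with 7 modulo 8. -/
theorem rewrites_same_sign {a b : ℤ}
    (h : a = 1 ∧ b = 5 ∨ a = 5 ∧ b = 1 ∨ a = 3 ∧ b = 7 ∨ a = 7 ∧ b = 3) :
    Rewrites Q [.one (2 * a), .one (2 * a)] [.one (2 * b), .one (2 * b)] := by
  rcases h with ⟨rfl, rfl⟩ | ⟨rfl, rfl⟩ | ⟨rfl, rfl⟩ | ⟨rfl, rfl⟩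
  · exact rewrites_pair_unit (c := 5) (d := 5) (x := 1) (y := 2) (z := 2) (w := -1)
      (by norm_num) (by norm_num) (by norm_num) (by norm_num) (by norm_num) (by norm_num)
      (by norm_num) (by norm_num)
  · exact rewrites_pair_unit (c := 25) (d := 25) (x := 1) (y := 2) (z := 2) (w := -1)
      (by norm_num) (by norm_num) (by norm_num) (by norm_num) (by norm_num) (by norm_num)
      (by norm_num) (by norm_num)
  · exact rewrites_pair_unit (c := 15) (d := 15) (x := 1) (y := 2) (z := 2) (w := -1)
      (by norm_num) (by norm_num) (by norm_num) (by norm_num) (by norm_num) (by norm_num)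
      (by norm_num) (by norm_num)
  · exact rewrites_pair_unit (c := 35) (d := 35) (x := 1) (y := 2) (z := 2) (w := -1)
      (by norm_num) (by norm_num) (by norm_num) (by norm_num) (by norm_num) (by norm_num)
      (by norm_num) (by norm_num)

/-- If a + b were divisible by 4, then 2a + 2b would be divisible by 8 and maximality would exclude
the pair. In the remaining cases a and b agree modulo 4, and swapping or multiplying both by 5
suffices. -/
theorem exists_rewrites_pair {a b : ℕ} (ha : a = 1 ∨ a = 3 ∨ a = 5 ∨ a = 7)
    (hb : b = 1 ∨ b = 3 ∨ b = 5 ∨ b = 7) (h : (a + b) % 4 ≠ 0) :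
    ∃ c d : ℕ, (c = 1 ∧ d = 1 ∨ c = 1 ∧ d = 5 ∨ c = 3 ∧ d = 7 ∨ c = 7 ∧ d = 7) ∧
      Rewrites Q [.one (2 * a), .one (2 * b)] [.one (2 * c), .one (2 * d)] := by
  rcases ha with rfl | rfl | rfl | rfl <;> rcases hb with rfl | rfl | rfl | rfl <;>
    simp only [Nat.reduceAdd, Nat.reduceMod, ne_eq, not_true_eq_false, OfNat.ofNat_ne_zero,
      not_false_eq_true] at h
  · exact ⟨1, 1, by simp, Rewrites.refl _⟩
  · exact ⟨1, 5, by simp, Rewrites.refl _⟩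
  · exact ⟨7, 7, by simp, rewrites_same_sign (by simp)⟩
  · exact ⟨3, 7, by simp, Rewrites.refl _⟩
  · exact ⟨1, 5, by simp, rewrites_swap _ _⟩
  · exact ⟨1, 1, by simp, rewrites_same_sign (by simp)⟩
  · exact ⟨3, 7, by simp, rewrites_swap _ _⟩
  · exact ⟨7, 7, by simp, Rewrites.refl _⟩

/-- For b equal to 3 or 7, the orthogonal vectors x + y and -2bx + ay have units a + 2b and ab(a +
2b), and the latter is 1 modulo 4. The base change has the odd determinant a + 2b. -/
theorem exists_rewrites_oneFour {a b : ℕ} (ha : a = 1 ∨ a = 3 ∨ a = 5 ∨ a = 7)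
    (hb : b = 1 ∨ b = 3 ∨ b = 5 ∨ b = 7) :
    ∃ c d : ℕ, (c = 1 ∨ c = 3 ∨ c = 5 ∨ c = 7) ∧ (d = 1 ∨ d = 5) ∧
      Rewrites Q [.one (2 * a), .one (4 * b)] [.one (2 * c), .one (4 * d)] := by
  by_cases hb' : b = 1 ∨ b = 5
  · exact ⟨a, b, ha, hb', Rewrites.refl _⟩
  have key : ∀ c d : ℕ, (c = 1 ∨ c = 3 ∨ c = 5 ∨ c = 7) → (d = 1 ∨ d = 5) →
      ((a + 2 * b : ℤ) % 8 = c % 8) → ((a * b * (a + 2 * b) : ℤ) % 8 = d % 8) →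
      ∃ c d : ℕ, (c = 1 ∨ c = 3 ∨ c = 5 ∨ c = 7) ∧ (d = 1 ∨ d = 5) ∧
      Rewrites Q [.one (2 * a), .one (4 * b)] [.one (2 * c), .one (4 * d)] := by
    intro c d hc hd h1 h2
    refine ⟨c, d, hc, hd, rewrites_pair_unit (c := a + 2 * b) (d := a * b * (a + 2 * b)) (x := 1)
      (y := 1) (z := -2 * b) (w := a) (by omega) (by ring) (by ring) (by ring) (by omega) ?_ h1 h2⟩
    omega
  rcases ha with rfl | rfl | rfl | rfl <;> rcases hb with rfl | rfl | rfl | rfl <;>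
    simp only [true_or, or_true, not_true_eq_false, Nat.reduceEqDiff, or_self,
      not_false_eq_true] at hb'
  · exact key 7 5 (by simp) (by simp) (by norm_num) (by norm_num)
  · exact key 7 1 (by simp) (by simp) (by norm_num) (by norm_num)
  · exact key 1 1 (by simp) (by simp) (by norm_num) (by norm_num)
  · exact key 1 5 (by simp) (by simp) (by norm_num) (by norm_num)
  · exact key 3 5 (by simp) (by simp) (by norm_num) (by norm_num)
  · exact key 3 1 (by simp) (by simp) (by norm_num) (by norm_num)
  · exact key 5 1 (by simp) (by simp) (by norm_num) (by norm_num)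
  · exact key 5 5 (by simp) (by simp) (by norm_num) (by norm_num)

theorem rewrites_triple_unit {a b : ℤ} (ha : a % 2 = 1) (h : 3 * a % 8 = b % 8) :
    Rewrites Q [.one (2 * a), .one (2 * a), .one (2 * a)] [.two 4 2, .one (2 * b)] :=
  (rewrites_triple ha).trans ((Rewrites.refl [_]).append (rewrites_unit (by omega) h))

/-- All three units agree modulo 4, so changing two of them by 5 where necessary makes all three
equal; then an A₂ plane splits off. -/
theorem exists_rewrites_triple {a b c : ℕ}
    (h : a = 1 ∧ b = 1 ∨ a = 1 ∧ b = 5 ∨ a = 3 ∧ b = 7 ∨ a = 7 ∧ b = 7)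
    (hc : c = 1 ∨ c = 3 ∨ c = 5 ∨ c = 7) (h4 : (c + a) % 4 ≠ 0) :
    ∃ d : ℕ, (d = 1 ∨ d = 3 ∨ d = 5 ∨ d = 7) ∧
      Rewrites Q [.one (2 * c), .one (2 * a), .one (2 * b)] [.two 4 2, .one (2 * d)] := by
  rcases h with ⟨rfl, rfl⟩ | ⟨rfl, rfl⟩ | ⟨rfl, rfl⟩ | ⟨rfl, rfl⟩ <;>
    rcases hc with rfl | rfl | rfl | rfl <;>
    simp only [Nat.reduceAdd, Nat.reduceMod, ne_eq, not_true_eq_false, OfNat.ofNat_ne_zero,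
      not_false_eq_true] at h4
  · exact ⟨3, by simp, rewrites_triple_unit (by norm_num) (by norm_num)⟩
  · exact ⟨7, by simp, ((Rewrites.refl [.one (2 * 5)]).append
      (rewrites_same_sign (a := 1) (b := 5) (by simp))).trans
      (rewrites_triple_unit (by norm_num) (by norm_num))⟩
  · exact ⟨7, by simp, ((rewrites_same_sign (a := 1) (b := 5) (by simp)).append
      (Rewrites.refl [.one (2 * 5)])).trans
      (rewrites_triple_unit (by norm_num) (by norm_num))⟩
  · exact ⟨3, by simp, (((rewrites_swap (.one (2 * 5)) (.one (2 * 1))).append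
      (Rewrites.refl [.one (2 * 5)])).trans ((Rewrites.refl [.one (2 * 1)]).append
      (rewrites_same_sign (a := 5) (b := 1) (by simp)))).trans
      (rewrites_triple_unit (by norm_num) (by norm_num))⟩
  · exact ⟨5, by simp, ((rewrites_same_sign (a := 3) (b := 7) (by simp)).append
      (Rewrites.refl [.one (2 * 7)])).trans
      (rewrites_triple_unit (by norm_num) (by norm_num))⟩
  · exact ⟨1, by simp, (((rewrites_swap (.one (2 * 7)) (.one (2 * 3))).append
      (Rewrites.refl [.one (2 * 7)])).trans ((Rewrites.refl [.one (2 * 3)]).append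
      (rewrites_same_sign (a := 7) (b := 3) (by simp)))).trans
      (rewrites_triple_unit (by norm_num) (by norm_num))⟩
  · exact ⟨1, by simp, ((Rewrites.refl [.one (2 * 3)]).append
      (rewrites_same_sign (a := 7) (b := 3) (by simp))).trans
      (rewrites_triple_unit (by norm_num) (by norm_num))⟩
  · exact ⟨5, by simp, rewrites_triple_unit (by norm_num) (by norm_num)⟩

/-- This and the next two lemmas insert one more block of scale 2 or 4 into a tail. Either the
enlarged list rewrites to a tail again, or a sublist of it has diagonal sum divisible by 8 and
contradicts maximality. -/
theorem exists_tail_two {L : Submodule ℤ_[2] W} (hL : IsMaximalLattice Q L) {v : Bool}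
    {w w' : List ℕ} (ht : IsTail v w w') {r : List Block}
    (h : Realizes Q (.two 4 2 :: tailBlocks v w w' ++ r) L) :
    ∃ v w w', IsTail v w w' ∧ Realizes Q (tailBlocks v w w' ++ r) L := by
  cases ht with
  | nil => exact ⟨_, _, _, .aniso, h⟩
  | aniso =>
    exact (hL.not_realizes_of_check (l := [.two 4 2, .two 4 2]) h (.refl _) (by decide)).elim
  | one a ha => exact ⟨_, _, _, .anisoOne a ha, h⟩
  | anisoOne a ha =>
    exact (hL.not_realizes_of_check (l := [.two 4 2, .two 4 2]) h
      (.cons_cons _ (.cons_cons _ (List.nil_sublist _))) (by decide)).elim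
  | pair a b hab =>
    refine (hL.not_realizes_of_check (l := [.two 4 2, .one (2 * a), .one (2 * b)]) h (.refl _)
      ?_).elim
    rcases hab with ⟨rfl, rfl⟩ | ⟨rfl, rfl⟩ | ⟨rfl, rfl⟩ | ⟨rfl, rfl⟩ <;> decide
  | oneFour a b ha hb =>
    refine (hL.not_realizes_of_check (l := [.two 4 2, .one (4 * b)]) h
      (.cons_cons _ (.cons _ (.refl _))) ?_).elim
    rcases hb with rfl | rfl <;> decide
  | four a ha =>
    refine (hL.not_realizes_of_check (l := [.two 4 2, .one (4 * a)]) h (.refl _) ?_).elim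
    rcases ha with rfl | rfl | rfl | rfl <;> decide

theorem exists_tail_oneTwo {L : Submodule ℤ_[2] W} (hL : IsMaximalLattice Q L) {v : Bool}
    {w w' : List ℕ} (ht : IsTail v w w') {r : List Block} {c : ℕ}
    (hc : c = 1 ∨ c = 3 ∨ c = 5 ∨ c = 7)
    (h : Realizes Q (.one (2 * c) :: tailBlocks v w w' ++ r) L) :
    ∃ v w w', IsTail v w w' ∧ Realizes Q (tailBlocks v w w' ++ r) L := by
  cases ht with
  | nil => exact ⟨_, _, _, .one c hc, h⟩
  | aniso =>
    exact ⟨_, _, _, .anisoOne c hc, (rewrites_swap _ _).append (Rewrites.refl r) L h⟩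
  | one a ha =>
    by_cases h4 : (c + a) % 4 = 0
    · refine (hL.not_realizes_of_check (l := [.one (2 * c), .one (2 * a)]) h (.refl _) ?_).elim
      rcases hc with rfl | rfl | rfl | rfl <;> rcases ha with rfl | rfl | rfl | rfl <;>
        first | decide | simp at h4
    · obtain ⟨a', b', hab, hr⟩ := exists_rewrites_pair (Q := Q) hc ha h4
      exact ⟨_, _, _, .pair a' b' hab, hr.append (Rewrites.refl r) L h⟩
  | anisoOne a ha =>
    by_cases h4 : (c + a) % 4 = 0
    · refine (hL.not_realizes_of_check (l := [.one (2 * c), .one (2 * a)]) h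
        (.cons_cons _ (.cons _ (.refl _))) ?_).elim
      rcases hc with rfl | rfl | rfl | rfl <;> rcases ha with rfl | rfl | rfl | rfl <;>
        first | decide | simp at h4
    · refine (hL.not_realizes_of_check (l := [.one (2 * c), .two 4 2, .one (2 * a)]) h
        (.refl _) ?_).elim
      rcases hc with rfl | rfl | rfl | rfl <;> rcases ha with rfl | rfl | rfl | rfl <;>
        first | decide | simp at h4
  | pair a b hab =>
    by_cases h4 : (c + a) % 4 = 0
    · refine (hL.not_realizes_of_check (l := [.one (2 * c), .one (2 * a)]) h
        (.cons_cons _ (.cons_cons _ (List.nil_sublist _))) ?_).elim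
      rcases hc with rfl | rfl | rfl | rfl <;>
        rcases hab with ⟨rfl, rfl⟩ | ⟨rfl, rfl⟩ | ⟨rfl, rfl⟩ | ⟨rfl, rfl⟩ <;>
        first | decide | simp at h4
    · obtain ⟨d, hd, hr⟩ := exists_rewrites_triple (Q := Q) hab hc h4
      exact ⟨_, _, _, .anisoOne d hd, hr.append (Rewrites.refl r) L h⟩
  | oneFour a b ha hb =>
    by_cases h4 : (c + a) % 4 = 0
    · refine (hL.not_realizes_of_check (l := [.one (2 * c), .one (2 * a)]) h
        (.cons_cons _ (.cons_cons _ (List.nil_sublist _))) ?_).elim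
      rcases hc with rfl | rfl | rfl | rfl <;> rcases ha with rfl | rfl | rfl | rfl <;>
        first | decide | simp at h4
    · refine (hL.not_realizes_of_check (l := [.one (2 * c), .one (2 * a), .one (4 * b)]) h
        (.refl _) ?_).elim
      rcases hc with rfl | rfl | rfl | rfl <;> rcases ha with rfl | rfl | rfl | rfl <;>
        rcases hb with rfl | rfl <;> first | decide | simp at h4
  | four a ha =>
    obtain ⟨a', b', ha', hb', hr⟩ := exists_rewrites_oneFour (Q := Q) hc ha
    exact ⟨_, _, _, .oneFour a' b' ha' hb', hr.append (Rewrites.refl r) L h⟩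

theorem exists_tail_oneFour {L : Submodule ℤ_[2] W} (hL : IsMaximalLattice Q L) {v : Bool}
    {w w' : List ℕ} (ht : IsTail v w w') {r : List Block} {c : ℕ}
    (hc : c = 1 ∨ c = 3 ∨ c = 5 ∨ c = 7)
    (h : Realizes Q (.one (4 * c) :: tailBlocks v w w' ++ r) L) :
    ∃ v w w', IsTail v w w' ∧ Realizes Q (tailBlocks v w w' ++ r) L := by
  cases ht with
  | nil => exact ⟨_, _, _, .four c hc, h⟩
  | aniso =>
    refine (hL.not_realizes_of_check (l := [.one (4 * c), .two 4 2]) h (.refl _) ?_).elim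
    rcases hc with rfl | rfl | rfl | rfl <;> decide
  | one a ha =>
    obtain ⟨a', b', ha', hb', hr⟩ := exists_rewrites_oneFour (Q := Q) ha hc
    exact ⟨_, _, _, .oneFour a' b' ha' hb',
      ((rewrites_swap _ _).trans hr).append (Rewrites.refl r) L h⟩
  | anisoOne a ha =>
    refine (hL.not_realizes_of_check (l := [.one (4 * c), .two 4 2]) h
      (.cons_cons _ (.cons_cons _ (List.nil_sublist _))) ?_).elim
    rcases hc with rfl | rfl | rfl | rfl <;> decide
  | pair a b hab =>
    refine (hL.not_realizes_of_check (l := [.one (4 * c), .one (2 * a), .one (2 * b)]) h (.refl _)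
      ?_).elim
    rcases hc with rfl | rfl | rfl | rfl <;>
      rcases hab with ⟨rfl, rfl⟩ | ⟨rfl, rfl⟩ | ⟨rfl, rfl⟩ | ⟨rfl, rfl⟩ <;> decide
  | oneFour a b ha hb =>
    refine (hL.not_realizes_of_check (l := [.one (4 * c), .one (4 * b)]) h
      (.cons_cons _ (.cons _ (.refl _))) ?_).elim
    rcases hc with rfl | rfl | rfl | rfl <;> rcases hb with rfl | rfl <;> decide
  | four a ha =>
    refine (hL.not_realizes_of_check (l := [.one (4 * c), .one (4 * a)]) h (.refl _) ?_).elim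
    rcases hc with rfl | rfl | rfl | rfl <;> rcases ha with rfl | rfl | rfl | rfl <;> decide

/-- Two copies of E become two copies of U, so at most one E needs to be kept. -/
theorem exists_head {L : Submodule ℤ_[2] W} {u : ℕ} {v : Bool} {b : Block}
    (hb : b = .two 0 1 ∨ b = .two 2 1) {r : List Block}
    (h : Realizes Q (b :: headBlocks u v ++ r) L) :
    ∃ u v, Realizes Q (headBlocks u v ++ r) L := by
  rcases hb with rfl | rfl
  · exact ⟨u + 1, v, h⟩
  · cases v with
    | false =>
      refine ⟨u, true, ((Rewrites.of_perm ?_).append (Rewrites.refl r)) L h⟩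
      simp only [headBlocks, Bool.false_eq_true, if_false, List.append_nil, if_true]
      exact (List.perm_append_singleton _ _).symm
    | true =>
      have e : headBlocks (u + 2) false =
          [.two 0 1, .two 0 1] ++ List.replicate u (.two 0 1) := by
        simp [headBlocks, List.replicate_succ]
      refine ⟨u + 2, false, ?_⟩
      rw [e]
      have hp : (.two 2 1 :: headBlocks u true).Perm
          ([.two 2 1, .two 2 1] ++ List.replicate u (.two 0 1)) :=
        (List.perm_append_singleton _ _).cons _
      exact ((Rewrites.of_perm hp).trans (rewrites_anisotropic_anisotropic.append
        (Rewrites.refl _))).append (Rewrites.refl r) L h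

theorem exists_head_tail {L : Submodule ℤ_[2] W} (hL : IsMaximalLattice Q L) (l : List Block)
    (hl : ∀ b ∈ l, IsMaximalBlock b) {u : ℕ} {v v' : Bool} {w w' : List ℕ} (ht : IsTail v' w w')
    (h : Realizes Q (l ++ (headBlocks u v ++ tailBlocks v' w w')) L) :
    ∃ u v v' w w', IsTail v' w w' ∧ Realizes Q (headBlocks u v ++ tailBlocks v' w w') L := by
  induction l generalizing u v v' w w' with
  | nil => exact ⟨u, v, v', w, w', ht, h⟩
  | cons b l ih =>
    have hl' : ∀ b ∈ l, IsMaximalBlock b := fun b hb => hl b (by simp [hb])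
    have hhead : b = .two 0 1 ∨ b = .two 2 1 → ∃ u v v' w w', IsTail v' w w' ∧
        Realizes Q (headBlocks u v ++ tailBlocks v' w w') L := fun hb => by
      have h1 : Realizes Q (b :: headBlocks u v ++ (tailBlocks v' w w' ++ l)) L := by
        refine Rewrites.of_perm ?_ L h
        -- Reordering the blocks is an identity in the additive monoid of multisets.
        rw [← Multiset.coe_eq_coe]
        simp only [← Multiset.coe_add, ← Multiset.cons_coe, ← Multiset.singleton_add]
        abel
      obtain ⟨u', v'', h2⟩ := exists_head hb h1
      refine ih hl' (u := u') (v := v'') ht (Rewrites.of_perm ?_ L h2)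
      rw [← Multiset.coe_eq_coe]
      simp only [← Multiset.coe_add]
      abel
    have h1 : Realizes Q (b :: tailBlocks v' w w' ++ (headBlocks u v ++ l)) L := by
      refine Rewrites.of_perm ?_ L h
      rw [← Multiset.coe_eq_coe]
      simp only [← Multiset.coe_add, ← Multiset.cons_coe, ← Multiset.singleton_add]
      abel
    have fin : ∀ v'' w w', IsTail v'' w w' →
        Realizes Q (tailBlocks v'' w w' ++ (headBlocks u v ++ l)) L →
        ∃ u v v' w w', IsTail v' w w' ∧
          Realizes Q (headBlocks u v ++ tailBlocks v' w w') L := fun v'' w w' ht h2 => by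
      refine ih hl' (u := u) (v := v) ht (Rewrites.of_perm ?_ L h2)
      rw [← Multiset.coe_eq_coe]
      simp only [← Multiset.coe_add]
      abel
    cases hl b (by simp) with
    | hyperbolic => exact hhead (Or.inl rfl)
    | anisotropic => exact hhead (Or.inr rfl)
    | anisotropicTwo =>
      obtain ⟨_, _, _, h2, h3⟩ := exists_tail_two hL ht h1
      exact fin _ _ _ h2 h3
    | oneTwo a ha =>
      obtain ⟨_, _, _, h2, h3⟩ := exists_tail_oneTwo hL ht ha h1
      exact fin _ _ _ h2 h3
    | oneFour a ha =>
      obtain ⟨_, _, _, h2, h3⟩ := exists_tail_oneFour hL ht ha h1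
      exact fin _ _ _ h2 h3

/-- A block ⟨ε⟩ of scale 1 is not even, as Q takes the value ε/2. Blocks ⟨ε⟩ of scale at least 8, U
of scale at least 2 and E of scale at least 4 have diagonal entries divisible by 8 and could be
enlarged. -/
theorem IsMaximalLattice.isMaximalBlock {L : Submodule ℤ_[2] W} (hL : IsMaximalLattice Q L)
    {b : Block} {l : List Block} (hl : blockSize (b :: l) = Module.finrank ℚ_[2] W)
    (hb : IsJordanTwo b) (h : Realizes Q (b :: l) L) : IsMaximalBlock b := by
  have hbad : b.IsEvenBlock → b.diag % 8 = 0 → False := fun h1 h2 =>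
    hL.not_realizes (l := [b]) (by simp) h (by simp) (by simpa using h1) (by simpa using h2)
  have h8 : ∀ k : ℕ, (2 : ℤ) ^ (k + 3) = 8 * 2 ^ k := fun k => by ring
  cases hb with
  | zero => exact (hL.not_realizes_one_zero hl h).elim
  | one k ε hε =>
    match k with
    | 0 =>
      obtain ⟨_, K, ⟨x, hx, rfl⟩, -, -, rfl⟩ := h
      have h1 := hL.even.norm_le (Submodule.mem_sup_left
        (Submodule.mem_span_singleton_self x))
      rw [polar_self, nsmul_eq_mul] at hx
      have h2 := congrArg norm hx
      rw [norm_mul, Nat.cast_ofNat, norm_two,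
        norm_odd (by rcases hε with rfl | rfl | rfl | rfl <;> norm_num)] at h2
      linarith
    | 1 => exact .oneTwo ε hε
    | 2 => exact .oneFour ε hε
    | k + 3 =>
      exfalso
      refine hbad (.one ?_ ?_) ?_
      · rcases hε with rfl | rfl | rfl | rfl <;> positivity
      · rw [h8, mul_assoc]; exact Dvd.dvd.mul_right (by norm_num) _
      · simp only [Block.diag]
        rw [h8, mul_assoc, Int.mul_emod_right]
  | hyperbolic k =>
    match k with
    | 0 => exact .hyperbolic
    | k + 1 =>
      exact (hbad (.two (by positivity) (Dvd.intro_left _ (pow_succ _ _).symm)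
        (dvd_zero _)) rfl).elim
  | anisotropic k =>
    match k with
    | 0 => exact .anisotropic
    | 1 => exact .anisotropicTwo
    | k + 2 =>
      refine (hbad (.two (by positivity) (Dvd.intro_left _ (pow_succ _ _).symm)
        (Dvd.intro_left _ rfl)) ?_).elim
      simp only [Block.diag]
      rw [← pow_succ', h8, Int.mul_emod_right]

theorem IsMaximalLattice.exists_head_tail {L : Submodule ℤ_[2] W} (hL : IsMaximalLattice Q L) :
    ∃ u v v' w w', IsTail v' w w' ∧ Realizes Q (headBlocks u v ++ tailBlocks v' w w') L := by
  have := hL.isLattice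
  have := hL.finite
  obtain ⟨b⟩ := exists_basis_of_isLattice L rfl
  let vs := List.ofFn (b.extendOfIsLattice ℚ_[2])
  have hvs : Submodule.span ℤ_[2] {v | v ∈ vs} = L := by
    rw [← span_range_extendOfIsLattice L b]
    congr 1
    ext v
    simp [vs, List.mem_ofFn]
  obtain ⟨l, h1, h2, h3⟩ := exists_realizes_two (Q := Q) (Module.finrank ℚ_[2] W) vs
    (by simp [vs]) (by
    rw [hvs]; exact fun x hx y hy => hL.even.norm_polar_le hx hy)
  rw [hvs] at h3
  refine LocalMod.exists_head_tail hL l ?_ (u := 0) (v := false) .nil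
    (by simpa [headBlocks, tailBlocks])
  intro b hb
  obtain ⟨l', hp, h4⟩ := Realizes.mem_block (l' := []) hb (by simpa using h3)
  rw [List.append_nil] at hp
  exact hL.isMaximalBlock ((blockSize_perm hp).trans h1) (h2 b hb) h4

end TwoAdic

/-! ### Existence of the 2-adic normal form -/

section TwoAdic

variable {W : Type*} [AddCommGroup W] [Module ℚ_[2] W] [Module ℤ_[2] W]
  [IsScalarTower ℤ_[2] ℚ_[2] W] {Q : QuadraticForm ℚ_[2] W}

/-- The conditions on the components of a `2`-adic normal form. -/
def IsTwoNormalFamily (c : ℕ → TwoComponent) : Prop :=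
  (∀ k, (c k).IsHomogeneousNormal) ∧
    (∀ k, (c k).w ≠ [] → (c (k + 1)).v = false ∧ ∀ ε ∈ (c (k + 1)).w, ε = 1 ∨ ε = 5) ∧
    (∀ k, (c k).u ≠ 0 ∨ (c k).v = true → (c (k + 1)).IsTypeA) ∧
    (∀ k, (c k).w ∈ [[1, 1], [1, 5], [3, 7], [7, 7]] → (c (k + 1)).IsTypeA) ∧
    (∀ k, (c k).w ≠ [] → (c (k + 2)).IsTypeA)

/-- The family of components with at most three nonempty members. -/
def components (u : ℕ) (v v' : Bool) (w w' : List ℕ) : ℕ → TwoComponent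
  | 0 => ⟨u, v, []⟩
  | 1 => ⟨0, v', w⟩
  | 2 => ⟨0, false, w'⟩
  | _ => ⟨0, false, []⟩

theorem flatMap_components (u : ℕ) (v v' : Bool) (w w' : List ℕ) :
    ((List.range 3).flatMap fun k => (components u v v' w w' k).blocks k) =
      headBlocks u v ++ tailBlocks v' w w' := by
  simp [List.range_succ, components, TwoComponent.blocks, headBlocks, tailBlocks]

instance (c : TwoComponent) : Decidable c.IsTypeA := by
  unfold TwoComponent.IsTypeA; infer_instance

instance (c : TwoComponent) : Decidable c.IsHomogeneousNormal := by
  unfold TwoComponent.IsHomogeneousNormal; infer_instance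

/-- The shape of the tail gives all the conditions except one, the type a condition on scale 2 when
scale 1 is nonempty, which is therefore a hypothesis. -/
theorem isTwoNormalFamily_components {u : ℕ} {v v' : Bool} {w w' : List ℕ} (ht : IsTail v' w w')
    (hA : u ≠ 0 ∨ v = true → TwoComponent.IsTypeA ⟨0, v', w⟩) :
    IsTwoNormalFamily (components u v v' w w') := by
  refine ⟨?_, ?_, ?_, ?_, ?_⟩
  · rintro (_ | _ | _ | k)
    · cases v <;> simp [components, TwoComponent.IsHomogeneousNormal]
    · change TwoComponent.IsHomogeneousNormal ⟨0, v', w⟩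
      cases ht with
      | nil | aniso => decide
      | one a ha | anisoOne a ha | four a ha => rcases ha with rfl | rfl | rfl | rfl <;> decide
      | oneFour a b ha hb => rcases ha with rfl | rfl | rfl | rfl <;> decide
      | pair a b h => rcases h with ⟨rfl, rfl⟩ | ⟨rfl, rfl⟩ | ⟨rfl, rfl⟩ | ⟨rfl, rfl⟩ <;> decide
    · change TwoComponent.IsHomogeneousNormal ⟨0, false, w'⟩
      cases ht with
      | nil | aniso => decide
      | one a ha | anisoOne a ha | four a ha => rcases ha with rfl | rfl | rfl | rfl <;> decide
      | oneFour a b ha hb => rcases hb with rfl | rfl <;> decide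
      | pair a b h => decide
    · simp [components, TwoComponent.IsHomogeneousNormal]
  · rintro (_ | _ | _ | k)
    · simp [components]
    · cases ht with
      | nil | aniso | one a ha | anisoOne a ha | four a ha | pair a b h => simp [components]
      | oneFour a b ha hb => simpa [components] using hb
    · simp [components]
    · simp [components]
  · rintro (_ | _ | _ | k)
    · exact hA
    · cases ht with
      | nil | aniso | one a ha | anisoOne a ha | four a ha | pair a b h | oneFour a b ha hb =>
        simp [components, TwoComponent.IsTypeA]
    · simp [components]
    · simp [components]
  · rintro (_ | _ | _ | k)
    · simp [components]
    · cases ht with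
      | nil | aniso | one a ha | anisoOne a ha | four a ha | pair a b h | oneFour a b ha hb =>
        simp [components, TwoComponent.IsTypeA]
    · simp [components, TwoComponent.IsTypeA]
    · simp [components]
  · rintro (_ | _ | _ | k)
    · simp [components]
    · simp [components, TwoComponent.IsTypeA]
    · simp [components, TwoComponent.IsTypeA]
    · simp [components]

/-- Exchanging a U and an E in the head multiplies a unit of scale 2 by 5, which turns ±3 into ±1
modulo 8. This is what makes the type a condition attainable. -/
theorem exists_toggle {L : Submodule ℤ_[2] W} {u : ℕ} {v : Bool} (huv : u ≠ 0 ∨ v = true)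
    {a b : ℤ} (ha : a % 2 = 1) (hb : 5 * a % 8 = b % 8) {r : List Block}
    (h : Realizes Q (headBlocks u v ++ .one (2 * a) :: r) L) :
    ∃ u v, (u ≠ 0 ∨ v = true) ∧ Realizes Q (headBlocks u v ++ .one (2 * b) :: r) L := by
  have hu : Rewrites Q [.one (2 * (5 * a))] [.one (2 * b)] := rewrites_unit (by omega) hb
  cases v with
  | true =>
    refine ⟨u + 1, false, by simp, ?_⟩
    have h1 : Realizes Q ([.two 2 1, .one (2 * a)] ++ (List.replicate u (.two 0 1) ++ r)) L := by
      refine Rewrites.of_perm ?_ L h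
      rw [← Multiset.coe_eq_coe]
      simp only [headBlocks, if_true, ← Multiset.coe_add, ← Multiset.cons_coe,
        ← Multiset.singleton_add, Multiset.coe_nil]
      abel
    have h2 := (rewrites_anisotropic_one ha).trans ((Rewrites.refl [.two 0 1]).append hu)
    refine Rewrites.of_perm ?_ L (h2.append (Rewrites.refl _) L h1)
    rw [← Multiset.coe_eq_coe]
    simp only [headBlocks, Bool.false_eq_true, if_false, ← Multiset.coe_add,
      ← Multiset.cons_coe, ← Multiset.singleton_add, Multiset.coe_nil, List.replicate_succ,
      List.append_nil]
    abel
  | false =>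
    obtain ⟨u, rfl⟩ : ∃ m, u = m + 1 := ⟨u - 1, by simp at huv; omega⟩
    refine ⟨u, true, by simp, ?_⟩
    have h1 : Realizes Q ([.two 0 1, .one (2 * a)] ++ (List.replicate u (.two 0 1) ++ r)) L := by
      refine Rewrites.of_perm ?_ L h
      rw [← Multiset.coe_eq_coe]
      simp only [headBlocks, Bool.false_eq_true, if_false, ← Multiset.coe_add,
        ← Multiset.cons_coe, ← Multiset.singleton_add, Multiset.coe_nil, List.replicate_succ,
        List.append_nil]
      abel
    have h2 := (rewrites_hyperbolic_one ha).trans ((Rewrites.refl [.two 2 1]).append hu)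
    refine Rewrites.of_perm ?_ L (h2.append (Rewrites.refl _) L h1)
    rw [← Multiset.coe_eq_coe]
    simp only [headBlocks, if_true, ← Multiset.coe_add, ← Multiset.cons_coe,
      ← Multiset.singleton_add, Multiset.coe_nil]
    abel

theorem IsMaximalLattice.exists_head_tail_typeA {L : Submodule ℤ_[2] W}
    (hL : IsMaximalLattice Q L) :
    ∃ u v v' w w', IsTail v' w w' ∧ (u ≠ 0 ∨ v = true → TwoComponent.IsTypeA ⟨0, v', w⟩) ∧
      Realizes Q (headBlocks u v ++ tailBlocks v' w w') L := by
  obtain ⟨u, v, v', w, w', ht, h⟩ := hL.exists_head_tail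
  by_cases huv : u ≠ 0 ∨ v = true
  swap
  · exact ⟨u, v, v', w, w', ht, fun h' => absurd h' huv, h⟩
  by_cases hA : TwoComponent.IsTypeA ⟨0, v', w⟩
  · exact ⟨u, v, v', w, w', ht, fun _ => hA, h⟩
  cases ht with
  | nil | aniso | four a ha => simp [TwoComponent.IsTypeA] at hA
  | one a ha =>
    rcases ha with rfl | rfl | rfl | rfl
    · exact absurd (by decide) hA
    · obtain ⟨u, v, -, h⟩ := exists_toggle (b := (7 : ℕ)) huv (by norm_num) (by norm_num) h
      exact ⟨u, v, _, _, _, .one 7 (by simp), fun _ => by decide, h⟩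
    · obtain ⟨u, v, -, h⟩ := exists_toggle (b := (1 : ℕ)) huv (by norm_num) (by norm_num) h
      exact ⟨u, v, _, _, _, .one 1 (by simp), fun _ => by decide, h⟩
    · exact absurd (by decide) hA
  | oneFour a b ha hb =>
    rcases ha with rfl | rfl | rfl | rfl
    · exact absurd (by decide) hA
    · obtain ⟨u, v, -, h⟩ := exists_toggle (b := (7 : ℕ)) huv (by norm_num) (by norm_num) h
      exact ⟨u, v, _, _, _, .oneFour 7 b (by simp) hb, fun _ => by decide, h⟩
    · obtain ⟨u, v, -, h⟩ := exists_toggle (b := (1 : ℕ)) huv (by norm_num) (by norm_num) h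
      exact ⟨u, v, _, _, _, .oneFour 1 b (by simp) hb, fun _ => by decide, h⟩
    · exact absurd (by decide) hA
  | anisoOne a ha =>
    have h1 : Realizes Q (headBlocks u v ++ [.one (2 * (a : ℤ)), .two 4 2]) L :=
      (Rewrites.refl _).append (rewrites_swap _ _) L h
    rcases ha with rfl | rfl | rfl | rfl
    · obtain ⟨u, v, -, h⟩ := exists_toggle (b := (5 : ℕ)) huv (by norm_num) (by norm_num) h1
      exact ⟨u, v, _, _, _, .anisoOne 5 (by simp), fun _ => by decide,
        (Rewrites.refl _).append (rewrites_swap _ _) L h⟩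
    · exact absurd (by decide) hA
    · exact absurd (by decide) hA
    · obtain ⟨u, v, -, h⟩ := exists_toggle (b := (3 : ℕ)) huv (by norm_num) (by norm_num) h1
      exact ⟨u, v, _, _, _, .anisoOne 3 (by simp), fun _ => by decide,
        (Rewrites.refl _).append (rewrites_swap _ _) L h⟩
  | pair a b hab =>
    rcases hab with ⟨rfl, rfl⟩ | ⟨rfl, rfl⟩ | ⟨rfl, rfl⟩ | ⟨rfl, rfl⟩
    · exact absurd (by decide) hA
    -- The unit 5 is moved next to the head so that it can be replaced by 25, which is 1 modulo 8.
    · have h1 : Realizes Q (headBlocks u v ++ [.one (2 * (5 : ℕ)), .one (2 * (1 : ℕ))]) L :=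
        (Rewrites.refl _).append (rewrites_swap _ _) L h
      obtain ⟨u, v, -, h⟩ := exists_toggle (b := (1 : ℕ)) huv (by norm_num) (by norm_num) h1
      exact ⟨u, v, _, _, _, .pair 1 1 (by simp), fun _ => by decide, h⟩
    · obtain ⟨u, v, -, h⟩ := exists_toggle (b := (7 : ℕ)) huv (by norm_num) (by norm_num) h
      exact ⟨u, v, _, _, _, .pair 7 7 (by simp), fun _ => by decide, h⟩
    · exact absurd (by decide) hA

theorem IsMaximalLattice.exists_isTwoNormalFamily {L : Submodule ℤ_[2] W}
    (hL : IsMaximalLattice Q L) : ∃ (K : ℕ) (c : ℕ → TwoComponent), IsTwoNormalFamily c ∧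
      Realizes Q ((List.range K).flatMap fun k => (c k).blocks k) L := by
  obtain ⟨u, v, v', w, w', ht, hA, h⟩ := hL.exists_head_tail_typeA
  exact ⟨3, components u v v' w w', isTwoNormalFamily_components ht hA, by
    rwa [flatMap_components]⟩

end TwoAdic

/-! ### Values of Q modulo `ℤ_p` on dual lattices, and the determinant -/

section General

variable {p : ℕ} [Fact p.Prime] {W : Type*} [AddCommGroup W] [Module ℚ_[p] W] [Module ℤ_[p] W]
  [IsScalarTower ℤ_[p] ℚ_[p] W] {Q : QuadraticForm ℚ_[p] W}

theorem Orth.span {K K' : Submodule ℤ_[p] W} (h : Orth Q K K') {x y : W}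
    (hx : x ∈ Submodule.span ℚ_[p] (K : Set W)) (hy : y ∈ Submodule.span ℚ_[p] (K' : Set W)) :
    polar Q x y = 0 := by
  induction hx using Submodule.span_induction with
  | zero => simp
  | add a b _ _ ha hb => rw [polar_add_left, ha, hb, add_zero]
  | smul c a _ ha => rw [polar_smul_left, ha, smul_zero]
  | mem x hx =>
    induction hy using Submodule.span_induction with
    | zero => simp
    | add a b _ _ ha hb => rw [polar_add_right, ha, hb, add_zero]
    | smul c a _ ha => rw [polar_smul_right, ha, smul_zero]
    | mem y hy => exact h x hx y hy

/-- The set of values modulo `ℤ_p` of `Q` on the dual of `K` within its own span. -/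
def HasValues (Q : QuadraticForm ℚ_[p] W) (K : Submodule ℤ_[p] W) (S : Set ℚ_[p]) : Prop :=
  (∀ k ∈ S, ∃ x ∈ Submodule.span ℚ_[p] (K : Set W), x ∈ dual Q K ∧ ‖Q x - k‖ ≤ 1) ∧
    ∀ x ∈ Submodule.span ℚ_[p] (K : Set W), x ∈ dual Q K → ∃ k ∈ S, ‖Q x - k‖ ≤ 1

theorem hasValues_bot : HasValues Q (⊥ : Submodule ℤ_[p] W) {0} := by
  constructor
  · rintro _ rfl
    exact ⟨0, zero_mem _, zero_mem _, by simp⟩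
  · intro x hx _
    refine ⟨0, rfl, ?_⟩
    have : x = 0 := by simpa using hx
    simp [this]

/-- The dual of an orthogonal sum, taken in the span, is the sum of the duals, and Q is additive on
it. -/
theorem HasValues.sup {K K' : Submodule ℤ_[p] W} {S S' : Set ℚ_[p]} (h : HasValues Q K S)
    (h' : HasValues Q K' S') (ho : Orth Q K K') : HasValues Q (K ⊔ K') (S + S') := by
  have hspan : Submodule.span ℚ_[p] ((K ⊔ K' : Submodule ℤ_[p] W) : Set W) =
      Submodule.span ℚ_[p] (K : Set W) ⊔ Submodule.span ℚ_[p] (K' : Set W) := by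
    rw [← Submodule.span_union]
    have : K ⊔ K' = Submodule.span ℤ_[p] ((K : Set W) ∪ K') := by
      rw [Submodule.span_union, Submodule.span_eq, Submodule.span_eq]
    rw [this, Submodule.span_span_of_tower]
  have hQ : ∀ a ∈ Submodule.span ℚ_[p] (K : Set W), ∀ b ∈ Submodule.span ℚ_[p] (K' : Set W),
      ∀ k k', ‖Q a - k‖ ≤ 1 → ‖Q b - k'‖ ≤ 1 → ‖Q (a + b) - (k + k')‖ ≤ 1 := by
    intro a ha b hb k k' h1 h2
    rw [map_add_eq, ho.span ha hb, add_zero, add_sub_add_comm]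
    exact norm_add_le_one h1 h2
  constructor
  · rintro _ ⟨k, hk, k', hk', rfl⟩
    obtain ⟨x, hx, hxd, hxk⟩ := h.1 k hk
    obtain ⟨y, hy, hyd, hyk⟩ := h'.1 k' hk'
    refine ⟨x + y, ?_, ?_, hQ x hx y hy _ _ hxk hyk⟩
    · rw [hspan]; exact Submodule.add_mem_sup hx hy
    · rw [mem_dual]
      intro z hz
      obtain ⟨a, ha, b, hb, rfl⟩ := Submodule.mem_sup.1 hz
      rw [polar_add_left, polar_add_right, polar_add_right,
        ho.span hx (Submodule.subset_span hb), ho.symm.span hy (Submodule.subset_span ha),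
        add_zero, zero_add]
      exact norm_add_le_one (mem_dual.1 hxd a ha) (mem_dual.1 hyd b hb)
  · intro x hx hxd
    rw [hspan] at hx
    obtain ⟨a, ha, b, hb, rfl⟩ := Submodule.mem_sup.1 hx
    rw [mem_dual] at hxd
    obtain ⟨k, hk, hak⟩ := h.2 a ha (mem_dual.2 fun y hy => by
      have := hxd y (Submodule.mem_sup_left hy)
      rwa [polar_add_left, ho.symm.span hb (Submodule.subset_span hy), add_zero] at this)
    obtain ⟨k', hk', hbk⟩ := h'.2 b hb (mem_dual.2 fun y hy => by
      have := hxd y (Submodule.mem_sup_right hy)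
      rwa [polar_add_left, ho.span ha (Submodule.subset_span hy), zero_add] at this)
    exact ⟨k + k', ⟨k, hk, k', hk', rfl⟩, hQ a ha b hb _ _ hak hbk⟩

theorem IsMaximalLattice.exists_value_sub {L L' : Submodule ℤ_[p] W}
    (hL : IsMaximalLattice Q L) (hL' : IsMaximalLattice Q L') {S S' : Set ℚ_[p]}
    (hS : HasValues Q L S) (hS' : HasValues Q L' S') {k : ℚ_[p]} (hk : k ∈ S) :
    ∃ k' ∈ S', ‖k - k'‖ ≤ 1 := by
  obtain ⟨x, -, hxd, hxk⟩ := hS.1 k hk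
  obtain ⟨y, hyd, hxy⟩ := hL.exists_mem_dual_sub hL' hxd
  obtain ⟨k', hk', hyk⟩ := hS'.2 y (by rw [hL'.isLattice.span_eq_top]; trivial) hyd
  refine ⟨k', hk', ?_⟩
  rw [show k - k' = (Q y - k') + (Q x - Q y) - (Q x - k) by ring]
  exact norm_sub_le_one (norm_add_le_one hyk hxy) hxk

theorem gram_det_eq {n : ℕ} (e e' : Module.Basis (Fin n) ℚ_[p] W) :
    ∃ s : ℚ_[p], (gram Q e).det = s * s * (gram Q e').det := by
  have h : ∀ b : Module.Basis (Fin n) ℚ_[p] W,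
      gram Q b = LinearMap.BilinForm.toMatrix b (polarBilin Q) := fun b => by
    ext i j
    simp [gram, LinearMap.BilinForm.toMatrix_apply]
  rw [h, h, ← LinearMap.BilinForm.toMatrix_mul_basis_toMatrix e' e (polarBilin Q)]
  simp only [Matrix.det_mul, Matrix.det_transpose]
  exact ⟨(e'.toMatrix e).det, by ring⟩

end General

/-! ### Dual values of the 2-adic blocks -/

section TwoAdic

variable {W : Type*} [AddCommGroup W] [Module ℚ_[2] W] [Module ℤ_[2] W]
  [IsScalarTower ℤ_[2] ℚ_[2] W] {Q : QuadraticForm ℚ_[2] W}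

/-- For s = 1 + 2r one has s² - 1 = 4r(r + 1), and one of r, r + 1 is even. -/
theorem norm_sq_sub_one_le {s : ℚ_[2]} (hs : ‖s‖ = 1) : ‖s * s - 1‖ ≤ 8⁻¹ := by
  have h1 := norm_le_half_of_norm_lt_one (norm_sub_one_lt_one hs)
  obtain ⟨r, rfl⟩ : ∃ r, s = 1 + 2 * r := ⟨(s - 1) / 2, by ring⟩
  rw [add_sub_cancel_left, norm_mul, norm_two] at h1
  have hr : ‖r‖ ≤ 1 := by linarith
  have h2 : ‖r * (r + 1)‖ ≤ 2⁻¹ := by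
    rcases hr.lt_or_eq with hr' | hr'
    · rw [mul_comm]
      refine norm_le_half_of_norm_lt_one (norm_mul_lt_one (norm_add_le_one hr (by simp)) hr')
    · refine norm_le_half_of_norm_lt_one (norm_mul_lt_one hr ?_)
      rw [show r + 1 = (r - 1) + 2 by ring]
      exact norm_add_lt_one (norm_sub_one_lt_one hr') (by rw [norm_two]; norm_num)
  rw [show (1 + 2 * r) * (1 + 2 * r) - 1 = 2 * 2 * (r * (r + 1)) by ring, norm_mul, norm_mul,
    norm_two]
  linarith

theorem mem_span_singleton_block {x z : W}
    (hz : z ∈ Submodule.span ℚ_[2] ((Submodule.span ℤ_[2] {x} : Submodule ℤ_[2] W) : Set W)) :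
    ∃ s : ℚ_[2], z = s • x := by
  rw [Submodule.span_span_of_tower] at hz
  obtain ⟨s, rfl⟩ := Submodule.mem_span_singleton.1 hz
  exact ⟨s, rfl⟩

theorem mem_span_pair_block {x y z : W}
    (hz : z ∈ Submodule.span ℚ_[2] ((Submodule.span ℤ_[2] {x, y} : Submodule ℤ_[2] W) : Set W)) :
    ∃ s t : ℚ_[2], z = s • x + t • y := by
  rw [Submodule.span_span_of_tower] at hz
  obtain ⟨s, t, rfl⟩ := Submodule.mem_span_pair.1 hz
  exact ⟨s, t, rfl⟩

theorem map_eq_half_polar (x : W) : Q x = polar Q x x / 2 := by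
  rw [polar_self, nsmul_eq_mul]
  push_cast
  ring

/-- `8` times the values modulo `ℤ_2` of the block on its dual. -/
def Block.values : Block → List ℤ
  | .one c => if c % 4 = 2 then [0, c] else [0, c / 4, c]
  | .two _ b => if b = 2 then [0, 4] else [0]

theorem norm_half_le {x : ℚ_[2]} (h : ‖x‖ < 1) : ‖x / 2‖ ≤ 1 := by
  have := norm_le_half_of_norm_lt_one h
  rw [norm_div, norm_two, div_inv_eq_mul]
  linarith

theorem norm_three_mul_le {x : ℚ_[2]} (h : ‖3 * x‖ ≤ 1) : ‖x‖ ≤ 1 := by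
  have h3 := norm_odd (m := 3) (by norm_num)
  push_cast at h3
  rwa [norm_mul, h3, one_mul] at h

/-- Unimodular blocks are their own duals and give only 0. On the dual of 2E, Q is half of the
integral form σ² + στ + τ². On the duals of ⟨2a⟩ and ⟨4a⟩, Q is aσ²/4 and aσ²/8 with σ integral;
since odd squares are 1 modulo 8, only the power of 2 in σ matters. -/
theorem IsMaximalBlock.hasValues {b : Block} (hb : IsMaximalBlock b) {K : Submodule ℤ_[2] W}
    (h : IsBlock Q b K) : HasValues Q K {k | ∃ m ∈ b.values, k = (m : ℚ_[2]) / 8} := by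
  have h2 : ‖(2 : ℚ_[2])‖ ≤ 1 := by rw [norm_two]; norm_num
  have zero_case : ∃ x ∈ Submodule.span ℚ_[2] (K : Set W), x ∈ dual Q K ∧
      ‖Q x - ((0 : ℤ) : ℚ_[2]) / 8‖ ≤ 1 := ⟨0, zero_mem _, zero_mem _, by simp⟩
  cases hb with
  | hyperbolic =>
    obtain ⟨x, y, hx, hy, hxy, rfl⟩ := h
    constructor
    · rintro _ ⟨m, hm, rfl⟩
      obtain rfl : m = 0 := by simpa [Block.values] using hm
      exact zero_case
    · intro z hz hd
      refine ⟨_, ⟨0, by simp [Block.values], rfl⟩, ?_⟩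
      obtain ⟨s, t, rfl⟩ := mem_span_pair_block hz
      rw [mem_dual] at hd
      have h1 := hd x (Submodule.subset_span (by simp))
      have h2 := hd y (Submodule.subset_span (by simp))
      simp only [polar_add_left, polar_smul_left, polar_comm Q y x, hx, hy, hxy, Int.cast_zero,
        Int.cast_one, smul_eq_mul, mul_zero, mul_one, zero_add, add_zero] at h1 h2
      rw [map_eq_half_polar, polar_comb, hx, hy, hxy]
      push_cast
      rw [show (s * s * 0 + (s * t + t * s) * 1 + t * t * 0) / 2 - (0 : ℚ_[2]) / 8 = s * t by ring]
      exact norm_mul_le_one h2 h1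
  | anisotropic =>
    obtain ⟨x, y, hx, hy, hxy, rfl⟩ := h
    constructor
    · rintro _ ⟨m, hm, rfl⟩
      obtain rfl : m = 0 := by simpa [Block.values] using hm
      exact zero_case
    · intro z hz hd
      refine ⟨_, ⟨0, by simp [Block.values], rfl⟩, ?_⟩
      obtain ⟨s, t, rfl⟩ := mem_span_pair_block hz
      rw [mem_dual] at hd
      have h1 := hd x (Submodule.subset_span (by simp))
      have h3 := hd y (Submodule.subset_span (by simp))
      simp only [polar_add_left, polar_smul_left, polar_comm Q y x, hx, hy, hxy, Int.cast_ofNat,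
        Int.cast_one, smul_eq_mul, mul_one] at h1 h3
      have hs : ‖s‖ ≤ 1 := norm_three_mul_le (by
        rw [show 3 * s = 2 * (s * 2 + t) - (s + t * 2) by ring]
        exact norm_sub_le_one (norm_mul_le_one h2 h1) h3)
      have ht : ‖t‖ ≤ 1 := norm_three_mul_le (by
        rw [show 3 * t = 2 * (s + t * 2) - (s * 2 + t) by ring]
        exact norm_sub_le_one (norm_mul_le_one h2 h3) h1)
      rw [map_eq_half_polar, polar_comb, hx, hy, hxy]
      push_cast
      rw [show (s * s * 2 + (s * t + t * s) * 1 + t * t * 2) / 2 - (0 : ℚ_[2]) / 8 =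
        s * s + s * t + t * t by ring]
      exact norm_add_le_one (norm_add_le_one (norm_mul_le_one hs hs) (norm_mul_le_one hs ht))
        (norm_mul_le_one ht ht)
  | anisotropicTwo =>
    obtain ⟨x, y, hx, hy, hxy, rfl⟩ := h
    constructor
    · rintro _ ⟨m, hm, rfl⟩
      obtain rfl | rfl : m = 0 ∨ m = 4 := by simpa [Block.values] using hm
      · exact zero_case
      · refine ⟨(2 : ℚ_[2])⁻¹ • x, Submodule.smul_mem _ _ (Submodule.subset_span
          (Submodule.subset_span (by simp))), mem_dual.2 fun z hz => ?_, ?_⟩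
        · obtain ⟨s, t, rfl⟩ := Submodule.mem_span_pair.1 hz
          simp only [← coe_smul_eq, polar_smul_left, polar_add_right, polar_smul_right, hx, hxy,
            smul_eq_mul, Int.cast_ofNat]
          rw [show (s : ℚ_[2]) * (2⁻¹ * 4) + t * (2⁻¹ * 2) = 2 * s + t by ring]
          exact norm_add_le_one (norm_mul_le_one h2 s.2) t.2
        · rw [QuadraticMap.map_smul, map_eq_half_polar x, hx, smul_eq_mul]
          norm_num
    · intro z hz hd
      obtain ⟨s, t, rfl⟩ := mem_span_pair_block hz
      rw [mem_dual] at hd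
      have h1 := hd x (Submodule.subset_span (by simp))
      have h3 := hd y (Submodule.subset_span (by simp))
      simp only [polar_add_left, polar_smul_left, polar_comm Q y x, hx, hy, hxy, Int.cast_ofNat,
        smul_eq_mul] at h1 h3
      have hs : ‖2 * s‖ ≤ 1 := norm_three_mul_le (by
        rw [show 3 * (2 * s) = 2 * (s * 4 + t * 2) - (s * 2 + t * 4) by ring]
        exact norm_sub_le_one (norm_mul_le_one h2 h1) h3)
      have ht : ‖2 * t‖ ≤ 1 := norm_three_mul_le (by
        rw [show 3 * (2 * t) = 2 * (s * 2 + t * 4) - (s * 4 + t * 2) by ring]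
        exact norm_sub_le_one (norm_mul_le_one h2 h3) h1)
      set N := (2 * s) * (2 * s) + (2 * s) * (2 * t) + (2 * t) * (2 * t) with hN
      have hN1 : ‖N‖ ≤ 1 := norm_add_le_one (norm_add_le_one (norm_mul_le_one hs hs)
        (norm_mul_le_one hs ht)) (norm_mul_le_one ht ht)
      rw [map_eq_half_polar, polar_comb, hx, hy, hxy]
      push_cast
      have e : (s * s * 4 + (s * t + t * s) * 2 + t * t * 4) / 2 = N / 2 := by rw [hN]; ring
      rw [e]
      rcases hN1.lt_or_eq with h' | h'
      · exact ⟨_, ⟨0, by simp [Block.values], rfl⟩, by simpa using norm_half_le h'⟩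
      · refine ⟨_, ⟨4, by simp [Block.values], rfl⟩, ?_⟩
        rw [show N / 2 - ((4 : ℤ) : ℚ_[2]) / 8 = (N - 1) / 2 by push_cast; ring]
        exact norm_half_le (norm_sub_one_lt_one h')
  | oneTwo a ha =>
    obtain ⟨x, hx, rfl⟩ := h
    have hv : Block.values (.one (2 * a)) = [0, 2 * (a : ℤ)] := by
      simp only [Block.values]
      rw [if_pos (by omega)]
    have ha1 : ‖((a : ℤ) : ℚ_[2])‖ = 1 := norm_odd (by omega)
    rw [hv]
    constructor
    · rintro _ ⟨m, hm, rfl⟩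
      obtain rfl | rfl : m = 0 ∨ m = 2 * (a : ℤ) := by simpa using hm
      · exact zero_case
      · refine ⟨(2 : ℚ_[2])⁻¹ • x, Submodule.smul_mem _ _ (Submodule.subset_span
          (Submodule.subset_span (by simp))), mem_dual.2 fun z hz => ?_, ?_⟩
        · obtain ⟨s, rfl⟩ := Submodule.mem_span_singleton.1 hz
          simp only [← coe_smul_eq, polar_smul_left, polar_smul_right, hx, smul_eq_mul]
          push_cast
          rw [show (s : ℚ_[2]) * (2⁻¹ * (2 * a)) = s * a by ring]
          exact norm_mul_le_one s.2 (by exact_mod_cast ha1.le)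
        · rw [QuadraticMap.map_smul, map_eq_half_polar x, hx, smul_eq_mul]
          push_cast
          rw [show (2 : ℚ_[2])⁻¹ * 2⁻¹ * (2 * a / 2) - 2 * a / 8 = 0 by ring]
          simp
    · intro z hz hd
      obtain ⟨s, rfl⟩ := mem_span_singleton_block hz
      rw [mem_dual] at hd
      have h1 := hd x (Submodule.subset_span (by simp))
      rw [polar_smul_left, hx, smul_eq_mul] at h1
      push_cast at h1 ha1
      rw [show s * (2 * a) = a * (2 * s) by ring, norm_mul, ha1, one_mul] at h1
      rw [QuadraticMap.map_smul, map_eq_half_polar x, hx, smul_eq_mul]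
      push_cast
      rcases h1.lt_or_eq with h' | h'
      · refine ⟨_, ⟨0, by simp, rfl⟩, ?_⟩
        have hs : ‖s‖ ≤ 1 := by
          have := norm_half_le h'
          rwa [mul_div_cancel_left₀ _ two_ne_zero] at this
        rw [show s * s * (2 * a / 2) - ((0 : ℤ) : ℚ_[2]) / 8 = s * s * a by push_cast; ring]
        exact norm_mul_le_one (norm_mul_le_one hs hs) ha1.le
      · refine ⟨_, ⟨2 * a, by simp, rfl⟩, ?_⟩
        have := norm_sq_sub_one_le h'
        push_cast
        rw [show s * s * (2 * a / 2) - 2 * a / 8 = a * 2⁻¹ * 2⁻¹ * (2 * s * (2 * s) - 1) by ring]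
        rw [norm_mul, norm_mul, norm_mul, ha1, norm_inv, norm_two, inv_inv]
        linarith
  | oneFour a ha =>
    obtain ⟨x, hx, rfl⟩ := h
    have hv : Block.values (.one (4 * a)) = [0, (a : ℤ), 4 * (a : ℤ)] := by
      simp only [Block.values]
      rw [if_neg (by omega)]
      simp
    have ha1 : ‖((a : ℤ) : ℚ_[2])‖ = 1 := norm_odd (by omega)
    have hn : ‖(a : ℚ_[2])‖ = 1 := by exact_mod_cast ha1
    rw [hv]
    constructor
    · rintro _ ⟨m, hm, rfl⟩
      have key : ∀ c : ℚ_[2], ‖4 * c‖ ≤ 1 → ∃ z ∈ Submodule.span ℚ_[2]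
          ((Submodule.span ℤ_[2] {x} : Submodule ℤ_[2] W) : Set W),
          z ∈ dual Q (Submodule.span ℤ_[2] {x}) ∧ Q z = 2 * a * c * c := by
        intro c hc
        refine ⟨c • x, Submodule.smul_mem _ _ (Submodule.subset_span
          (Submodule.subset_span (by simp))), mem_dual.2 fun z hz => ?_, ?_⟩
        · obtain ⟨s, rfl⟩ := Submodule.mem_span_singleton.1 hz
          simp only [← coe_smul_eq, polar_smul_left, polar_smul_right, hx, smul_eq_mul]
          push_cast
          rw [show (s : ℚ_[2]) * (c * (4 * a)) = (4 * c) * (s * a) by ring]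
          exact norm_mul_le_one hc (norm_mul_le_one s.2 hn.le)
        · rw [QuadraticMap.map_smul, map_eq_half_polar x, hx, smul_eq_mul]
          push_cast
          ring
      obtain rfl | rfl | rfl : m = 0 ∨ m = (a : ℤ) ∨ m = 4 * (a : ℤ) := by simpa using hm
      · exact zero_case
      · obtain ⟨z, hz, hzd, e⟩ := key 4⁻¹ (by simp)
        refine ⟨z, hz, hzd, ?_⟩
        rw [e]
        push_cast
        rw [show 2 * (a : ℚ_[2]) * 4⁻¹ * 4⁻¹ - a / 8 = 0 by ring]
        simp
      · obtain ⟨z, hz, hzd, e⟩ := key 2⁻¹ (by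
          rw [show (4 : ℚ_[2]) * 2⁻¹ = 2 by norm_num]; exact h2)
        refine ⟨z, hz, hzd, ?_⟩
        rw [e]
        push_cast
        rw [show 2 * (a : ℚ_[2]) * 2⁻¹ * 2⁻¹ - 4 * a / 8 = 0 by ring]
        simp
    · intro z hz hd
      obtain ⟨s, rfl⟩ := mem_span_singleton_block hz
      rw [mem_dual] at hd
      have h1 := hd x (Submodule.subset_span (by simp))
      rw [polar_smul_left, hx, smul_eq_mul] at h1
      push_cast at h1
      rw [show s * (4 * a) = a * (2 * (2 * s)) by ring, norm_mul, hn, one_mul] at h1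
      rw [QuadraticMap.map_smul, map_eq_half_polar x, hx, smul_eq_mul]
      push_cast
      rcases h1.lt_or_eq with h' | h'
      · have h3 : ‖2 * s‖ ≤ 1 := by
          have := norm_half_le h'
          rwa [mul_div_cancel_left₀ _ two_ne_zero] at this
        rcases h3.lt_or_eq with h'' | h''
        -- No value was lost so far: multiples of `x` with integral coefficient `s` all have
        -- integral norm.
        · refine ⟨_, ⟨0, by simp, rfl⟩, ?_⟩
          have hs : ‖s‖ ≤ 1 := by
            have := norm_half_le h''
            rwa [mul_div_cancel_left₀ _ two_ne_zero] at this
          rw [show s * s * (4 * a / 2) - ((0 : ℤ) : ℚ_[2]) / 8 = 2 * (s * s * a) by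
            push_cast; ring]
          exact norm_mul_le_one h2 (norm_mul_le_one (norm_mul_le_one hs hs) hn.le)
        · refine ⟨_, ⟨4 * a, by simp, rfl⟩, ?_⟩
          have := norm_sq_sub_one_le h''
          push_cast
          rw [show s * s * (4 * a / 2) - 4 * a / 8 = a * 2⁻¹ * (2 * s * (2 * s) - 1) by ring]
          rw [norm_mul, norm_mul, hn, norm_inv, norm_two, inv_inv]
          linarith
      · refine ⟨_, ⟨a, by simp, rfl⟩, ?_⟩
        have := norm_sq_sub_one_le h'
        push_cast
        rw [show s * s * (4 * a / 2) - a / 8 =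
          a * 2⁻¹ * 2⁻¹ * 2⁻¹ * (2 * (2 * s) * (2 * (2 * s)) - 1) by ring]
        rw [norm_mul, norm_mul, norm_mul, norm_mul, hn, norm_inv, norm_two, inv_inv]
        linarith

/-- The sums of values of the blocks of a list. -/
def listValues : List Block → List ℤ
  | [] => [0]
  | b :: l => b.values.flatMap fun m => (listValues l).map fun m' => m + m'

theorem Realizes.hasValues {l : List Block} (hl : ∀ b ∈ l, IsMaximalBlock b)
    {K : Submodule ℤ_[2] W} (h : Realizes Q l K) :
    HasValues Q K {k | ∃ m ∈ listValues l, k = (m : ℚ_[2]) / 8} := by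
  induction l generalizing K with
  | nil =>
    obtain rfl := h
    convert hasValues_bot (Q := Q) using 1
    ext k
    simp [listValues]
  | cons b l ih =>
    obtain ⟨K₁, K₂, hb, h2, ho, rfl⟩ := h
    convert ((hl b (by simp)).hasValues hb).sup (ih (fun b hb => hl b (by simp [hb])) h2) ho
      using 1
    ext k
    simp only [listValues, Set.mem_add, List.mem_flatMap, List.mem_map]
    constructor
    · rintro ⟨_, ⟨m, hm, m', hm', rfl⟩, rfl⟩
      exact ⟨_, ⟨m, hm, rfl⟩, _, ⟨m', hm', rfl⟩, by push_cast; ring⟩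
    · rintro ⟨_, ⟨m, hm, rfl⟩, _, ⟨m', hm', rfl⟩, rfl⟩
      exact ⟨_, ⟨m, hm, m', hm', rfl⟩, by push_cast; ring⟩

/-- Equality of lists of integers as sets modulo `8`, one inclusion. -/
def subsetMod (S S' : List ℤ) : Bool := S.all fun m => S'.any fun m' => (m - m') % 8 == 0

/-- Multiplied by 8, the invariant becomes a finite set of integers modulo 8 that can be computed
from the blocks. -/
theorem IsMaximalLattice.subsetMod_listValues {L L' : Submodule ℤ_[2] W}
    (hL : IsMaximalLattice Q L) (hL' : IsMaximalLattice Q L') {l l' : List Block}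
    (hl : ∀ b ∈ l, IsMaximalBlock b) (hl' : ∀ b ∈ l', IsMaximalBlock b)
    (h : Realizes Q l L) (h' : Realizes Q l' L') :
    subsetMod (listValues l) (listValues l') = true := by
  simp only [subsetMod, List.all_eq_true, List.any_eq_true, beq_iff_eq]
  intro m hm
  obtain ⟨_, ⟨m', hm', rfl⟩, hk⟩ := hL.exists_value_sub hL' (h.hasValues hl) (h'.hasValues hl')
    ⟨m, hm, rfl⟩
  refine ⟨m', hm', Int.emod_eq_zero_of_dvd ?_⟩
  have := (Padic.norm_int_le_pow_iff_dvd (p := 2) (m - m') 3).1 (by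
    have h8 : ‖(8 : ℚ_[2])‖ = 8⁻¹ := by
      rw [show (8 : ℚ_[2]) = 2 * 2 * 2 by norm_num, norm_mul, norm_mul, norm_two]; norm_num
    rw [← sub_div, norm_div, h8, div_inv_eq_mul] at hk
    have h3 : ‖(m : ℚ_[2]) - m'‖ ≤ 8⁻¹ := by linarith
    push_cast
    norm_num at h3 ⊢
    exact h3)
  simpa using this

end TwoAdic

/-! ### The shape of an arbitrary 2-adic normal form of a maximal lattice -/

section TwoAdic

theorem IsMaximalBlock.eq_one {c : ℤ} (h : IsMaximalBlock (.one c)) :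
    ∃ a : ℕ, (a = 1 ∨ a = 3 ∨ a = 5 ∨ a = 7) ∧ (c = 2 * a ∨ c = 4 * a) := by
  generalize hb : Block.one c = b at h
  cases h with
  | hyperbolic | anisotropic | anisotropicTwo => cases hb
  | oneTwo a ha => exact ⟨a, ha, Or.inl (by injection hb)⟩
  | oneFour a ha => exact ⟨a, ha, Or.inr (by injection hb)⟩

theorem IsMaximalBlock.eq_two {a b : ℤ} (h : IsMaximalBlock (.two a b)) :
    a = 0 ∧ b = 1 ∨ a = 2 ∧ b = 1 ∨ a = 4 ∧ b = 2 := by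
  generalize hb : Block.two a b = c at h
  cases h with
  | hyperbolic | anisotropic | anisotropicTwo => injection hb with h1 h2; simp [h1, h2]
  | oneTwo a ha | oneFour a ha => cases hb

theorem TwoComponent.IsHomogeneousNormal.mem_w {c : TwoComponent} (h : c.IsHomogeneousNormal)
    {ε : ℕ} (hε : ε ∈ c.w) : ε = 1 ∨ ε = 3 ∨ ε = 5 ∨ ε = 7 := by
  obtain ⟨u, v, w⟩ := c
  have key : ∀ w' ∈ (if v then [[], [1], [3], [5], [7], [1, 3], [1, 7]]
      else [[], [1], [3], [5], [7], [1, 1], [1, 3], [1, 5], [1, 7], [3, 7], [7, 7]] :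
        List (List ℕ)), ∀ ε ∈ w', ε = 1 ∨ ε = 3 ∨ ε = 5 ∨ ε = 7 := by
    cases v <;> decide
  exact key w h ε hε

theorem TwoComponent.IsHomogeneousNormal.shape {c : TwoComponent} (h : c.IsHomogeneousNormal) :
    c.w = [] ∨ (∃ a, c.w = [a]) ∨ ∃ a b, c.w = [a, b] := by
  obtain ⟨u, v, w⟩ := c
  match w with
  | [] => simp
  | [a] => simp
  | [a, b] => simp
  | a :: b :: d :: w => cases v <;> simp [TwoComponent.IsHomogeneousNormal] at h

theorem TwoComponent.isJordanTwo {c : TwoComponent} (h : c.IsHomogeneousNormal) {k : ℕ}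
    {b : Block} (hb : b ∈ c.blocks k) : IsJordanTwo b := by
  simp only [TwoComponent.blocks, List.mem_append, List.mem_replicate, List.mem_map] at hb
  rcases hb with (⟨-, rfl⟩ | hb) | ⟨ε, hε, rfl⟩
  · exact .hyperbolic k
  · split at hb
    · obtain rfl := List.mem_singleton.1 hb
      exact .anisotropic k
    · simp at hb
  · exact .one k ε (h.mem_w hε)

variable {W : Type*} [AddCommGroup W] [Module ℚ_[2] W] [Module ℤ_[2] W]
  [IsScalarTower ℤ_[2] ℚ_[2] W] {Q : QuadraticForm ℚ_[2] W}

/-- Components from index K on do not contribute blocks. Replacing them by empty ones preserves the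
conditions, and the list may then be padded to K + 3 components, so that scales 1, 2 and 4 are
always present. -/
theorem IsTwoNormalFamily.truncate {c : ℕ → TwoComponent} (hc : IsTwoNormalFamily c) (K : ℕ) :
    IsTwoNormalFamily fun k => if k < K then c k else ⟨0, false, []⟩ := by
  obtain ⟨h1, h2, h3, h4, h5⟩ := hc
  refine ⟨fun k => ?_, fun k hk => ?_, fun k hk => ?_, fun k hk => ?_, fun k hk => ?_⟩ <;>
    dsimp only at *
  · split_ifs
    · exact h1 k
    · simp [TwoComponent.IsHomogeneousNormal]
  · split_ifs with h'
    · rw [if_pos (by omega)] at hk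
      exact h2 k hk
    · simp
  · split_ifs with h'
    · rw [if_pos (by omega)] at hk
      exact h3 k hk
    · simp [TwoComponent.IsTypeA]
  · split_ifs with h'
    · rw [if_pos (by omega)] at hk
      exact h4 k hk
    · simp [TwoComponent.IsTypeA]
  · split_ifs with h'
    · rw [if_pos (by omega)] at hk
      exact h5 k hk
    · simp [TwoComponent.IsTypeA]

theorem flatMap_truncate (c : ℕ → TwoComponent) (K : ℕ) :
    ((List.range (K + 3)).flatMap fun k =>
      (if k < K then c k else ⟨0, false, []⟩ : TwoComponent).blocks k) =
      (List.range K).flatMap fun k => (c k).blocks k := by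
  rw [List.range_add, List.flatMap_append]
  have h1 : ((List.range K).flatMap fun k =>
      (if k < K then c k else ⟨0, false, []⟩ : TwoComponent).blocks k) =
      (List.range K).flatMap fun k => (c k).blocks k := by
    refine List.flatMap_congr fun k hk => ?_
    rw [if_pos (List.mem_range.1 hk)]
  rw [h1]
  have h2 : (((List.range 3).map fun x => K + x).flatMap fun k =>
      (if k < K then c k else ⟨0, false, []⟩ : TwoComponent).blocks k) = [] := by
    rw [List.flatMap_eq_nil_iff]
    intro k hk
    obtain ⟨x, -, rfl⟩ := List.mem_map.1 hk
    rw [if_neg (by omega)]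
    simp [TwoComponent.blocks]
  rw [h2, List.append_nil]

/-- Unlike in the existence proof no rewriting is allowed: the components are given. Every
admissible choice that is not a tail contains blocks that contradict maximality. -/
theorem IsMaximalLattice.isTail {L : Submodule ℤ_[2] W} (hL : IsMaximalLattice Q L)
    {v : Bool} {w w' : List ℕ} {r : List Block}
    (hw : TwoComponent.IsHomogeneousNormal ⟨0, v, w⟩)
    (hw' : TwoComponent.IsHomogeneousNormal ⟨0, false, w'⟩)
    (h15 : w ≠ [] → ∀ ε ∈ w', ε = 1 ∨ ε = 5)
    (h : Realizes Q (tailBlocks v w w' ++ r) L) : IsTail v w w' := by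
  have hu' : ∀ ε ∈ w', ε = 1 ∨ ε = 3 ∨ ε = 5 ∨ ε = 7 := fun ε hε => hw'.mem_w hε
  have hu : ∀ ε ∈ w, ε = 1 ∨ ε = 3 ∨ ε = 5 ∨ ε = 7 := fun ε hε => hw.mem_w hε
  have hpair : ∀ a b, w' ≠ [a, b] := by
    rintro a b rfl
    refine (hL.not_realizes_of_check (l := [.one (4 * a), .one (4 * b)]) h
      (List.sublist_append_right _ _) ?_).elim
    rcases hu' a (by simp) with rfl | rfl | rfl | rfl <;>
      rcases hu' b (by simp) with rfl | rfl | rfl | rfl <;> decide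
  have hshape : w' = [] ∨ ∃ a, w' = [a] := by
    rcases hw'.shape with h1 | h1 | ⟨a, b, h1⟩
    · exact Or.inl h1
    · exact Or.inr h1
    · exact absurd h1 (hpair a b)
  cases v with
  | true =>
    have hnil : w' = [] := by
      rcases hshape with h1 | ⟨a, rfl⟩
      · exact h1
      · refine (hL.not_realizes_of_check (l := [.two 4 2, .one (4 * a)]) h ?_ ?_).elim
        · exact (List.sublist_append_left [Block.two 4 2] _).append (List.Sublist.refl _)
        · rcases hu' a (by simp) with rfl | rfl | rfl | rfl <;> decide
    subst hnil
    rcases hw.shape with h1 | ⟨a, h1⟩ | ⟨a, b, h1⟩ <;> dsimp only at h1 <;> subst h1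
    · exact .aniso
    · exact .anisoOne a (hu a (by simp))
    · exfalso
      refine hL.not_realizes_of_check (l := [.one (2 * a), .one (2 * b)]) h
        (.cons _ (.refl _)) ?_
      have : [a, b] = [1, 3] ∨ [a, b] = [1, 7] := by
        simpa [TwoComponent.IsHomogeneousNormal] using hw
      rcases this with h1 | h1 <;> simp only [List.cons.injEq, and_true] at h1 <;>
        obtain ⟨rfl, rfl⟩ := h1 <;> decide
  | false =>
    rcases hw.shape with h1 | ⟨a, h1⟩ | ⟨a, b, h1⟩ <;> dsimp only at h1 <;> subst h1
    · rcases hshape with rfl | ⟨a, rfl⟩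
      · exact .nil
      · exact .four a (hu' a (by simp))
    · rcases hshape with rfl | ⟨b, rfl⟩
      · exact .one a (hu a (by simp))
      · exact .oneFour a b (hu a (by simp)) (h15 (by simp) b (by simp))
    · have hab : ([a, b] = [1, 1] ∨ [a, b] = [1, 5] ∨ [a, b] = [3, 7] ∨ [a, b] = [7, 7]) ∨
          ([a, b] = [1, 3] ∨ [a, b] = [1, 7]) := by
        have key : ∀ w ∈ ([[], [1], [3], [5], [7], [1, 1], [1, 3], [1, 5], [1, 7], [3, 7],
            [7, 7]] : List (List ℕ)), w.length = 2 →
            (w = [1, 1] ∨ w = [1, 5] ∨ w = [3, 7] ∨ w = [7, 7]) ∨ (w = [1, 3] ∨ w = [1, 7]) := by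
          decide
        exact key _ hw rfl
      rcases hab with hab | hab
      · simp only [List.cons.injEq, and_true] at hab
        rcases hshape with rfl | ⟨d, rfl⟩
        · exact .pair a b hab
        · exfalso
          refine hL.not_realizes_of_check (l := [.one (2 * a), .one (2 * b), .one (4 * d)]) h
            (.refl _) ?_
          rcases hab with ⟨rfl, rfl⟩ | ⟨rfl, rfl⟩ | ⟨rfl, rfl⟩ | ⟨rfl, rfl⟩ <;>
            rcases hu' d (by simp) with rfl | rfl | rfl | rfl <;> decide
      · exfalso
        refine hL.not_realizes_of_check (l := [.one (2 * a), .one (2 * b)]) h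
          (List.sublist_append_left _ _) ?_
        simp only [List.cons.injEq, and_true] at hab
        rcases hab with ⟨rfl, rfl⟩ | ⟨rfl, rfl⟩ <;> decide

/-- Each block of the list can be moved to the front, so it is one of the blocks allowed in a
maximal lattice. This empties all components beyond scale 4 and restricts the first three to a head
and a tail. -/
theorem IsTwoNormalFamily.exists_head_tail {L : Submodule ℤ_[2] W} (hL : IsMaximalLattice Q L)
    {c : ℕ → TwoComponent} (hc : IsTwoNormalFamily c) {K : ℕ}
    (hsize : blockSize ((List.range K).flatMap fun k => (c k).blocks k) =
      Module.finrank ℚ_[2] W)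
    (h : Realizes Q ((List.range K).flatMap fun k => (c k).blocks k) L) :
    ∃ u v v' w w', IsTail v' w w' ∧ (u ≠ 0 ∨ v = true → TwoComponent.IsTypeA ⟨0, v', w⟩) ∧
      ((List.range K).flatMap fun k => (c k).blocks k) =
        headBlocks u v ++ tailBlocks v' w w' := by
  rw [← flatMap_truncate] at h hsize ⊢
  have hc' := hc.truncate K
  generalize hcc : (fun k => if k < K then c k else (⟨0, false, []⟩ : TwoComponent)) = c' at hc'
  have hk' : ∀ k, (if k < K then c k else (⟨0, false, []⟩ : TwoComponent)) = c' k := fun k =>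
    congrFun hcc k
  simp only [hk'] at h hsize ⊢
  obtain ⟨h1, h2, h3, -, -⟩ := hc'
  have hmax : ∀ k < K + 3, ∀ b ∈ (c' k).blocks k, IsMaximalBlock b := by
    intro k hk b hb
    have hmem : b ∈ (List.range (K + 3)).flatMap fun k => (c' k).blocks k :=
      List.mem_flatMap.2 ⟨k, List.mem_range.2 hk, hb⟩
    obtain ⟨l', hp, h4⟩ := Realizes.mem_block (l' := []) hmem (by simpa using h)
    rw [List.append_nil] at hp
    exact hL.isMaximalBlock ((blockSize_perm hp).trans hsize) (TwoComponent.isJordanTwo (h1 k) hb)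
      h4
  have hpow : ∀ k : ℕ, (1 : ℤ) ≤ 2 ^ k := fun k => one_le_pow₀ (by norm_num)
  have hU : ∀ k, k + 1 < K + 3 → (c' (k + 1)).u = 0 := by
    intro k hk
    by_contra h0
    have := (hmax (k + 1) hk (.two 0 (2 ^ (k + 1))) (by
      simp [TwoComponent.blocks, h0])).eq_two
    rw [pow_succ] at this
    omega
  have hV : ∀ k, k + 2 < K + 3 → (c' (k + 2)).v = false := by
    intro k hk
    by_contra h0
    have := (hmax (k + 2) hk (.two (2 * 2 ^ (k + 2)) (2 ^ (k + 2))) (by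
      simp [TwoComponent.blocks, h0])).eq_two
    rw [show (2 : ℤ) ^ (k + 2) = 4 * 2 ^ k by ring] at this
    have := hpow k
    omega
  have hone : ∀ k < K + 3, ∀ ε ∈ (c' k).w, ∃ a : ℕ, (a = 1 ∨ a = 3 ∨ a = 5 ∨ a = 7) ∧
      ((2 : ℤ) ^ k * ε = 2 * a ∨ (2 : ℤ) ^ k * ε = 4 * a) := fun k hk ε hε =>
    (hmax k hk (.one (2 ^ k * ε)) (by
      simp only [TwoComponent.blocks, List.mem_append, List.mem_map]
      exact Or.inr ⟨ε, hε, rfl⟩)).eq_one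
  have hW0 : (c' 0).w = [] := by
    rw [List.eq_nil_iff_forall_not_mem]
    intro ε hε
    obtain ⟨a, -, h5⟩ := hone 0 (by omega) ε hε
    have := (h1 0).mem_w hε
    omega
  have hW : ∀ k, k + 3 < K + 3 → (c' (k + 3)).w = [] := by
    intro k hk
    rw [List.eq_nil_iff_forall_not_mem]
    intro ε hε
    obtain ⟨a, ha, h5⟩ := hone (k + 3) hk ε hε
    rw [show (2 : ℤ) ^ (k + 3) * ε = 8 * (2 ^ k * ε) by ring] at h5
    omega
  have hlist : ((List.range (K + 3)).flatMap fun k => (c' k).blocks k) =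
      headBlocks (c' 0).u (c' 0).v ++ tailBlocks (c' 1).v (c' 1).w (c' 2).w := by
    rw [add_comm K 3, List.range_add, List.flatMap_append]
    have h6 : (((List.range K).map fun x => 3 + x).flatMap fun k => (c' k).blocks k) = [] := by
      rw [List.flatMap_eq_nil_iff]
      intro k hk
      obtain ⟨x, hx, rfl⟩ := List.mem_map.1 hk
      rw [List.mem_range] at hx
      rw [add_comm 3 x]
      simp [TwoComponent.blocks, hU (x + 2) (by omega), hV (x + 1) (by omega), hW x (by omega)]
    rw [h6]
    have hu1 := hU 0 (by omega)
    have hu2 := hU 1 (by omega)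
    have hv2 := hV 0 (by omega)
    simp only [zero_add, one_add_one_eq_two] at hu1 hu2 hv2
    simp [List.range_succ, TwoComponent.blocks, headBlocks, tailBlocks, hu1, hu2, hv2, hW0]
  rw [hlist] at h ⊢
  have heta : ∀ k, k + 1 < K + 3 → c' (k + 1) = ⟨0, (c' (k + 1)).v, (c' (k + 1)).w⟩ := by
    intro k hk
    have := hU k hk
    cases hk : c' (k + 1)
    rw [hk] at this
    simpa using this
  have e1 := heta 0 (by omega)
  have e2 := heta 1 (by omega)
  rw [hV 0 (by omega)] at e2
  refine ⟨_, _, _, _, _, hL.isTail (e1 ▸ h1 1) (e2 ▸ h1 2) (fun h7 => (h2 1 h7).2)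
    h.append_comm, fun h7 => ?_, rfl⟩
  have := h3 0 h7
  rwa [e1] at this

end TwoAdic

/-! ### Bases of realized lattices, and the determinant as an invariant -/

section General

variable {p : ℕ} [Fact p.Prime] {W : Type*} [AddCommGroup W] [Module ℚ_[p] W] [Module ℤ_[p] W]
  [IsScalarTower ℤ_[p] ℚ_[p] W] {Q : QuadraticForm ℚ_[p] W}

theorem Realizes.exists_basis {l : List Block} {L : Submodule ℤ_[p] W} (hL : L.IsLattice ℚ_[p])
    {n : ℕ} (hsize : blockSize l = n) (hn : Module.finrank ℚ_[p] W = n) (h : Realizes Q l L) :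
    ∃ e : Module.Basis (Fin n) ℚ_[p] W, (∀ i j, polar Q (e i) (e j) = blockEntry l i j) ∧
      Submodule.span ℤ_[p] (Set.range e) = L := by
  obtain ⟨f, rfl, hf⟩ := h.exists_family
  subst hsize
  have hrange : Set.range (fun i : Fin (blockSize l) => f i) = f '' Set.Iio (blockSize l) := by
    ext x
    constructor
    · rintro ⟨i, rfl⟩
      exact ⟨i, i.2, rfl⟩
    · rintro ⟨i, hi, rfl⟩
      exact ⟨⟨i, hi⟩, rfl⟩
  have htop : ⊤ ≤ Submodule.span ℚ_[p] (Set.range fun i : Fin (blockSize l) => f i) := by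
    rw [← hL.span_eq_top, hrange]
    exact Submodule.span_le.2 fun x hx => Submodule.span_le_restrictScalars ℤ_[p] ℚ_[p] _ hx
  have hli := linearIndependent_of_top_le_span_of_card_eq_finrank htop (by simp [hn])
  refine ⟨Module.Basis.mk hli htop, fun i j => ?_, ?_⟩
  · simpa using hf i i.2 j j.2
  · rw [Module.Basis.coe_mk, hrange]

theorem Realizes.exists_det_eq {l l' : List Block} {L L' : Submodule ℤ_[p] W}
    (hL : L.IsLattice ℚ_[p]) (hL' : L'.IsLattice ℚ_[p])
    (hl : blockSize l = Module.finrank ℚ_[p] W) (hl' : blockSize l' = Module.finrank ℚ_[p] W)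
    (h : Realizes Q l L) (h' : Realizes Q l' L') :
    ∃ s : ℚ_[p], (((l.map Block.det).prod : ℤ) : ℚ_[p]) =
      s * s * (((l'.map Block.det).prod : ℤ) : ℚ_[p]) := by
  have key : ∀ {l : List Block} {L : Submodule ℤ_[p] W}, L.IsLattice ℚ_[p] →
      blockSize l = Module.finrank ℚ_[p] W → Realizes Q l L →
      ∃ e : Module.Basis (Fin (Module.finrank ℚ_[p] W)) ℚ_[p] W,
        (gram Q e).det = (((l.map Block.det).prod : ℤ) : ℚ_[p]) := by
    intro l L hL hl h
    obtain ⟨e, he, -⟩ := h.exists_basis hL hl rfl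
    refine ⟨e, ?_⟩
    rw [← det_blockEntry hl, ← eq_intCast (Int.castRingHom ℚ_[p]), RingHom.map_det]
    congr 1
    ext i j
    simp [gram, he]
  obtain ⟨e, he⟩ := key hL hl h
  obtain ⟨e', he'⟩ := key hL' hl' h'
  obtain ⟨s, hs⟩ := gram_det_eq (Q := Q) e e'
  exact ⟨s, by rw [← he, ← he', hs]⟩

end General

/-! ### Uniqueness of the 2-adic normal form of maximal lattices -/

section TwoAdic

/-- All triples of arguments for which `IsTail` holds. -/
def tailList : List (Bool × List ℕ × List ℕ) :=
  [(false, [], []), (true, [], [])] ++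
    [1, 3, 5, 7].flatMap (fun a => [(false, [a], []), (true, [a], []), (false, [a], [1]),
      (false, [a], [5]), (false, [], [a])]) ++
    [(false, [1, 1], []), (false, [1, 5], []), (false, [3, 7], []), (false, [7, 7], [])]

theorem IsTail.mem_tailList {v : Bool} {w w' : List ℕ} (h : IsTail v w w') :
    (v, w, w') ∈ tailList := by
  cases h with
  | nil | aniso => decide
  | one a ha | anisoOne a ha | four a ha => rcases ha with rfl | rfl | rfl | rfl <;> decide
  | pair a b h => rcases h with ⟨rfl, rfl⟩ | ⟨rfl, rfl⟩ | ⟨rfl, rfl⟩ | ⟨rfl, rfl⟩ <;> decide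
  | oneFour a b ha hb =>
    rcases ha with rfl | rfl | rfl | rfl <;> rcases hb with rfl | rfl <;> decide

/-- The odd part of the determinant of `tailBlocks`. -/
def tailOdd (t : Bool × List ℕ × List ℕ) : ℤ :=
  (if t.1 then 3 else 1) * t.2.1.prod * t.2.2.prod

/-- The exponent of `2` in the determinant of `tailBlocks`. -/
def tailExp (t : Bool × List ℕ × List ℕ) : ℕ :=
  (if t.1 then 2 else 0) + t.2.1.length + 2 * t.2.2.length

theorem prod_det_tailBlocks (t : Bool × List ℕ × List ℕ) :
    ((tailBlocks t.1 t.2.1 t.2.2).map Block.det).prod = 2 ^ tailExp t * tailOdd t := by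
  have h : ∀ (m : ℤ) (w : List ℕ),
      ((w.map fun ε : ℕ => Block.one (m * (ε : ℤ))).map Block.det).prod =
        m ^ w.length * (w.prod : ℤ) := by
    intro m w
    induction w with
    | nil => simp
    | cons a w ih =>
      rw [List.map_cons, List.map_cons, List.prod_cons, ih, List.length_cons, List.prod_cons]
      simp only [Block.det]
      push_cast
      ring
  obtain ⟨v, w, w'⟩ := t
  simp only [tailBlocks, List.map_append, List.prod_append, h, tailExp, tailOdd, pow_add, pow_mul]
  cases v <;> simp [Block.det] <;> ring

/-- The determinants of U and E are written as -1 times 1 or -3, so that the sign depends only on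
the number of planes and cancels when two heads of equal rank are compared. -/
theorem prod_det_headBlocks (u : ℕ) (v : Bool) :
    ((headBlocks u v).map Block.det).prod =
      (-1) ^ (u + v.toNat) * (if v then -3 else 1) := by
  cases v <;> simp [headBlocks, Block.det, pow_succ]

theorem blockSize_headBlocks (u : ℕ) (v : Bool) :
    blockSize (headBlocks u v) = 2 * (u + v.toNat) := by
  have : blockSize (List.replicate u (.two 0 1)) = 2 * u := by
    induction u with
    | zero => rfl
    | succ u ih => rw [List.replicate_succ, blockSize, ih]; ring
  rw [headBlocks, blockSize_append, this]
  cases v <;> simp [blockSize]; ring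

theorem listValues_headBlocks_append (u : ℕ) (v : Bool) (l : List Block) :
    listValues (headBlocks u v ++ l) = listValues l := by
  have h1 : ∀ l, listValues (.two 0 1 :: l) = listValues l := fun l => by
    simp [listValues, Block.values]
  have h2 : ∀ l, listValues (.two 2 1 :: l) = listValues l := fun l => by
    simp [listValues, Block.values]
  rw [headBlocks, List.append_assoc]
  induction u with
  | zero => cases v <;> simp [h2]
  | succ u ih => rw [List.replicate_succ, List.cons_append, h1, ih]

theorem isMaximalBlock_of_mem_headBlocks {u : ℕ} {v : Bool} {b : Block}
    (hb : b ∈ headBlocks u v) : IsMaximalBlock b := by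
  rw [headBlocks, List.mem_append, List.mem_replicate] at hb
  rcases hb with ⟨-, rfl⟩ | hb
  · exact .hyperbolic
  · split at hb
    · obtain rfl := List.mem_singleton.1 hb
      exact .anisotropic
    · simp at hb

theorem IsTail.isMaximalBlock {v : Bool} {w w' : List ℕ} (h : IsTail v w w') {b : Block}
    (hb : b ∈ tailBlocks v w w') : IsMaximalBlock b := by
  have key : (∀ ε ∈ w, ε = 1 ∨ ε = 3 ∨ ε = 5 ∨ ε = 7) ∧
      ∀ ε ∈ w', ε = 1 ∨ ε = 3 ∨ ε = 5 ∨ ε = 7 := by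
    cases h <;> simp <;> omega
  simp only [tailBlocks, List.mem_append, List.mem_map] at hb
  rcases hb with (hb | ⟨ε, hε, rfl⟩) | ⟨ε, hε, rfl⟩
  · split at hb
    · obtain rfl := List.mem_singleton.1 hb
      exact .anisotropicTwo
    · simp at hb
  · exact .oneTwo ε (key.1 ε hε)
  · exact .oneFour ε (key.2 ε hε)

/-- The values of `Q` modulo `1` on the duals of lattices with the given tails agree. -/
def SameValues (t t' : Bool × List ℕ × List ℕ) : Prop :=
  subsetMod (listValues (tailBlocks t.1 t.2.1 t.2.2))
    (listValues (tailBlocks t'.1 t'.2.1 t'.2.2)) = true ∧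
  subsetMod (listValues (tailBlocks t'.1 t'.2.1 t'.2.2))
    (listValues (tailBlocks t.1 t.2.1 t.2.2)) = true

instance : DecidableRel SameValues := fun _ _ => inferInstanceAs (Decidable (_ ∧ _))

set_option maxRecDepth 100000 in
-- A finite check over all pairs of tails: the dual values alone fix the rank and the exponent of 2
-- in the determinant; its odd part modulo 8 then fixes the tail.
theorem SameValues.size_exp_eq : ∀ t ∈ tailList, ∀ t' ∈ tailList, SameValues t t' →
    blockSize (tailBlocks t.1 t.2.1 t.2.2) = blockSize (tailBlocks t'.1 t'.2.1 t'.2.2) ∧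
      tailExp t = tailExp t' ∧ (tailOdd t % 8 = tailOdd t' % 8 → t = t') := by
  decide +kernel

set_option maxRecDepth 100000 in
-- When there is a head, the determinant mixes the unit of the tail with the choice between U and E.
-- The type a condition removes this ambiguity, again by a finite check.
theorem SameValues.eq_of_isTypeA : ∀ t ∈ tailList, ∀ t' ∈ tailList, SameValues t t' →
    TwoComponent.IsTypeA ⟨0, t.1, t.2.1⟩ → TwoComponent.IsTypeA ⟨0, t'.1, t'.2.1⟩ →
    ∀ v v' : Bool, ((if v then -3 else 1) * tailOdd t) % 8 =
      ((if v' then -3 else 1) * tailOdd t') % 8 → t = t' ∧ v = v' := by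
  decide +kernel

theorem tailOdd_odd : ∀ t ∈ tailList, tailOdd t % 2 = 1 := by decide

theorem emod_eight_eq_of_sq_mul {k : ℕ} {m m' : ℤ} {s : ℚ_[2]} (hm : m % 2 = 1)
    (hm' : m' % 2 = 1) (h : ((2 ^ k * m : ℤ) : ℚ_[2]) = s * s * ((2 ^ k * m' : ℤ) : ℚ_[2])) :
    m % 8 = m' % 8 := by
  have h1 : (m : ℚ_[2]) = s * s * m' := by
    push_cast at h
    refine mul_left_cancel₀ (pow_ne_zero k (two_ne_zero (α := ℚ_[2]))) ?_
    rw [h]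
    ring
  have hs : ‖s‖ = 1 := by
    have h2 := congrArg norm h1
    rw [norm_mul, norm_mul, norm_odd hm, norm_odd hm', mul_one] at h2
    nlinarith [norm_nonneg s]
  have h3 := norm_sq_sub_one_le hs
  refine Int.emod_eq_emod_iff_emod_sub_eq_zero.2 (Int.emod_eq_zero_of_dvd ?_)
  have := (Padic.norm_int_le_pow_iff_dvd (p := 2) (m - m') 3).1 (by
    push_cast
    rw [h1, show s * s * m' - m' = (s * s - 1) * (m' : ℚ_[2]) by ring, norm_mul, norm_odd hm',
      mul_one]
    norm_num at h3 ⊢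
    exact h3)
  simpa using this

variable {W : Type*} [AddCommGroup W] [Module ℚ_[2] W] [Module ℤ_[2] W]
  [IsScalarTower ℤ_[2] ℚ_[2] W] {Q : QuadraticForm ℚ_[2] W}

/-- The dual values fix the rank of the tail, hence that of the head; comparing determinants up to
squares, which for units means modulo 8, leaves only the finite checks above. -/
theorem IsTwoNormalFamily.flatMap_eq {L L' : Submodule ℤ_[2] W} (hL : IsMaximalLattice Q L)
    (hL' : IsMaximalLattice Q L') {c c' : ℕ → TwoComponent} (hc : IsTwoNormalFamily c)
    (hc' : IsTwoNormalFamily c') {K K' : ℕ}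
    (hsize : blockSize ((List.range K).flatMap fun k => (c k).blocks k) =
      Module.finrank ℚ_[2] W)
    (hsize' : blockSize ((List.range K').flatMap fun k => (c' k).blocks k) =
      Module.finrank ℚ_[2] W)
    (h : Realizes Q ((List.range K).flatMap fun k => (c k).blocks k) L)
    (h' : Realizes Q ((List.range K').flatMap fun k => (c' k).blocks k) L') :
    ((List.range K).flatMap fun k => (c k).blocks k) =
      (List.range K').flatMap fun k => (c' k).blocks k := by
  obtain ⟨u, v, t1, t2, t3, ht, htA, e⟩ := hc.exists_head_tail hL hsize h
  obtain ⟨u', v', t1', t2', t3', ht', htA', e'⟩ := hc'.exists_head_tail hL' hsize' h'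
  rw [e] at h hsize ⊢
  rw [e'] at h' hsize' ⊢
  have hmax : ∀ b ∈ headBlocks u v ++ tailBlocks t1 t2 t3, IsMaximalBlock b := fun b hb =>
    (List.mem_append.1 hb).elim isMaximalBlock_of_mem_headBlocks ht.isMaximalBlock
  have hmax' : ∀ b ∈ headBlocks u' v' ++ tailBlocks t1' t2' t3', IsMaximalBlock b := fun b hb =>
    (List.mem_append.1 hb).elim isMaximalBlock_of_mem_headBlocks ht'.isMaximalBlock
  have hv1 := hL.subsetMod_listValues hL' hmax hmax' h h'
  have hv2 := hL'.subsetMod_listValues hL hmax' hmax h' h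
  rw [listValues_headBlocks_append, listValues_headBlocks_append] at hv1 hv2
  have hmem := ht.mem_tailList
  have hmem' := ht'.mem_tailList
  have hsame : SameValues (t1, t2, t3) (t1', t2', t3') := ⟨hv1, hv2⟩
  obtain ⟨hsz, hexp, hodd⟩ := hsame.size_exp_eq _ hmem _ hmem'
  dsimp only at hsz
  obtain ⟨s, hs⟩ := h.exists_det_eq hL.isLattice hL'.isLattice hsize hsize' h'
  have hrank : u + v.toNat = u' + v'.toNat := by
    rw [blockSize_append, blockSize_headBlocks] at hsize hsize'
    omega
  simp only [List.map_append, List.prod_append, prod_det_headBlocks,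
    prod_det_tailBlocks (t1, t2, t3), prod_det_tailBlocks (t1', t2', t3')] at hs
  rw [hrank, ← hexp] at hs
  have hdet : ((if v then -3 else 1) * tailOdd (t1, t2, t3)) % 8 =
      ((if v' then -3 else 1) * tailOdd (t1', t2', t3')) % 8 := by
    have o1 := tailOdd_odd _ hmem
    have o2 := tailOdd_odd _ hmem'
    refine emod_eight_eq_of_sq_mul (k := tailExp (t1, t2, t3)) (s := s)
      (by split_ifs <;> omega) (by split_ifs <;> omega) ?_
    have h1 : ((-1 : ℚ_[2])) ^ (u' + v'.toNat) ≠ 0 := pow_ne_zero _ (by norm_num)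
    refine mul_left_cancel₀ h1 ?_
    push_cast at hs ⊢
    linear_combination hs
  have hfin : (t1, t2, t3) = (t1', t2', t3') ∧ v = v' := by
    -- Without a head the type a condition is not available, but the determinant is then that of the
    -- tail alone.
    by_cases h0 : u + v.toNat = 0
    · have e1 : v = false := by cases v <;> simp_all
      have e2 : v' = false := by cases v' <;> simp_all
      subst e1 e2
      exact ⟨hodd (by simpa using hdet), rfl⟩
    · refine hsame.eq_of_isTypeA _ hmem _ hmem' (htA ?_) (htA' ?_) v v' hdet
      · cases v <;> simp_all
      · cases v' <;> simp_all
  obtain ⟨h1, rfl⟩ := hfin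
  obtain rfl : u = u' := by omega
  simp only [Prod.mk.injEq] at h1
  obtain ⟨rfl, rfl, rfl⟩ := h1
  rfl

end TwoAdic

/-! ### Square classes and Jordan decomposition at odd primes -/

section Odd

variable {p : ℕ} [hp : Fact p.Prime]

theorem norm_two_eq_one (h2 : p ≠ 2) : ‖(2 : ℚ_[p])‖ = 1 := by
  have := norm_intCast_eq_one_iff_not_dvd (p := p) (m := 2)
  push_cast at this
  rw [this]
  intro h
  have h3 : p ∣ 2 := by exact_mod_cast h
  exact h2 ((Nat.prime_dvd_prime_iff_eq hp.out Nat.prime_two).1 h3)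

theorem norm_intCast_eq_one_iff {m : ℤ} : ‖(m : ℚ_[p])‖ = 1 ↔ (m : ZMod p) ≠ 0 := by
  rw [norm_intCast_eq_one_iff_not_dvd, Ne, ZMod.intCast_zmod_eq_zero_iff_dvd]

theorem norm_intCast_lt_one_iff {m : ℤ} : ‖(m : ℚ_[p])‖ < 1 ↔ (m : ZMod p) = 0 := by
  rw [Padic.norm_intCast_lt_one_iff, ZMod.intCast_zmod_eq_zero_iff_dvd]

theorem exists_sq_eq_of_odd (h2 : p ≠ 2) {u : ℚ_[p]} (hu : ‖u - 1‖ < 1) :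
    ∃ s : ℚ_[p], ‖s‖ = 1 ∧ u = s * s := by
  obtain ⟨t, ht, h⟩ := exists_root_quadratic (a := 1) (b := (2 : ℚ_[p])) (c := 1 - u) (by simp)
    (norm_two_eq_one h2) (by rwa [norm_sub_rev])
  refine ⟨1 + t, norm_eq_one_of_norm_sub_lt_one (a := 1) (by simp) (by simpa), ?_⟩
  linear_combination -h

/-- If ab is m² modulo p, then ab/m² is 1 modulo p and hence a square. With the next lemma this
identifies square classes of units with those modulo p. -/
theorem exists_sq_mul_eq_of_isSquare (h2 : p ≠ 2) {a b : ℤ} (ha : (a : ZMod p) ≠ 0)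
    (hb : (b : ZMod p) ≠ 0) (h : IsSquare ((a * b : ℤ) : ZMod p)) :
    ∃ s : ℚ_[p], ‖s‖ = 1 ∧ (a : ℚ_[p]) = s * s * b := by
  obtain ⟨r, hr⟩ := h
  obtain ⟨m, rfl⟩ := ZMod.intCast_surjective r
  have hab : ‖((a * b : ℤ) : ℚ_[p])‖ = 1 := by
    rw [norm_intCast_eq_one_iff]
    push_cast
    exact mul_ne_zero ha hb
  have hm : (m : ZMod p) ≠ 0 := by
    rintro h0
    rw [h0, mul_zero] at hr
    exact norm_intCast_eq_one_iff.1 hab hr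
  have hm1 := norm_intCast_eq_one_iff.2 hm
  have hb1 := norm_intCast_eq_one_iff.2 hb
  have hm0 : (m : ℚ_[p]) ≠ 0 := by rw [← norm_ne_zero_iff, hm1]; exact one_ne_zero
  have hb0 : (b : ℚ_[p]) ≠ 0 := by rw [← norm_ne_zero_iff, hb1]; exact one_ne_zero
  obtain ⟨s, hs, h1⟩ := exists_sq_eq_of_odd h2 (u := (a * b : ℚ_[p]) / (m * m)) (by
    have : ‖((a * b - m * m : ℤ) : ℚ_[p])‖ < 1 := by
      rw [norm_intCast_lt_one_iff]
      push_cast at hr ⊢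
      rw [hr, sub_self]
    push_cast at this
    rw [div_sub_one (mul_ne_zero hm0 hm0), norm_div, norm_mul, hm1]
    simpa using this)
  refine ⟨s * m / b, by rw [norm_div, norm_mul, hs, hm1, hb1]; norm_num, ?_⟩
  rw [div_eq_iff (mul_ne_zero hm0 hm0)] at h1
  field_simp
  linear_combination h1

theorem isSquare_of_sq_mul_eq {a b : ℤ} {s : ℚ_[p]} (hs : ‖s‖ ≤ 1)
    (h : ‖(a : ℚ_[p]) - s * s * b‖ < 1) : IsSquare ((a * b : ℤ) : ZMod p) := by
  obtain ⟨m, -, hm⟩ := exists_nat_norm_sub_le hs 1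
  have hm' : ‖s - m‖ < 1 := by
    refine hm.trans_lt ?_
    rw [pow_one]
    exact inv_lt_one_of_one_lt₀ (by exact_mod_cast hp.out.one_lt)
  have hmn : ‖(m : ℚ_[p])‖ ≤ 1 := by simpa using Padic.norm_int_le_one (p := p) m
  have hb := Padic.norm_int_le_one (p := p) b
  have h1 : ‖((a - m * m * b : ℤ) : ℚ_[p])‖ < 1 := by
    push_cast
    rw [show (a : ℚ_[p]) - m * m * b = (a - s * s * b) + (b * (s + m)) * (s - m) by ring]
    exact norm_add_lt_one h (norm_mul_lt_one (norm_mul_le_one hb (norm_add_le_one hs hmn)) hm')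
  rw [norm_intCast_lt_one_iff] at h1
  push_cast at h1 ⊢
  rw [sub_eq_zero.1 h1]
  exact ⟨m * b, by ring⟩

theorem not_isSquare_leastNonresidue (h2 : p ≠ 2) : ¬ IsSquare (leastNonresidue p : ZMod p) := by
  refine Nat.sInf_mem (s := {u : ℕ | ¬ IsSquare (u : ZMod p)}) ?_
  obtain ⟨a, ha⟩ := FiniteField.exists_nonsquare (F := ZMod p) (by rwa [ZMod.ringChar_zmod_n])
  exact ⟨a.val, by simpa using ha⟩

theorem leastNonresidue_ne_zero (h2 : p ≠ 2) : (leastNonresidue p : ZMod p) ≠ 0 := by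
  intro h
  apply not_isSquare_leastNonresidue (p := p) h2
  rw [h]
  exact IsSquare.zero

theorem norm_leastNonresidue (h2 : p ≠ 2) : ‖(leastNonresidue p : ℚ_[p])‖ = 1 := by
  have := (norm_intCast_eq_one_iff (p := p) (m := leastNonresidue p)).2 (by
    simpa using leastNonresidue_ne_zero h2)
  simpa using this

theorem isSquare_mul_of_not_isSquare {a b : ZMod p} (ha : ¬ IsSquare a)
    (hb : ¬ IsSquare b) : IsSquare (a * b) := by
  by_contra h
  rw [← quadraticChar_neg_one_iff_not_isSquare] at ha hb h
  rw [map_mul, ha, hb] at h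
  norm_num at h

/-- `1` and the least nonresidue represent the units modulo squares. -/
theorem exists_unit_representative_odd (h2 : p ≠ 2) {u : ℚ_[p]} (hu : ‖u‖ = 1) :
    ∃ (ε : ℤ) (s : ℚ_[p]), (ε = 1 ∨ ε = leastNonresidue p) ∧ ‖s‖ = 1 ∧ s * s * u = ε := by
  obtain ⟨m, -, hm⟩ := exists_nat_norm_sub_le hu.le 1
  have hm' : ‖u - m‖ < 1 := by
    refine hm.trans_lt ?_
    rw [pow_one]
    exact inv_lt_one_of_one_lt₀ (by exact_mod_cast hp.out.one_lt)
  have hm1 : ‖((m : ℤ) : ℚ_[p])‖ = 1 := by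
    have := norm_eq_one_of_norm_sub_lt_one hu hm'
    simpa using this
  have hmz := norm_intCast_eq_one_iff.1 hm1
  obtain ⟨ε, hε, hεz, hsq⟩ : ∃ ε : ℤ, (ε = 1 ∨ ε = leastNonresidue p) ∧ (ε : ZMod p) ≠ 0 ∧
      IsSquare ((ε * m : ℤ) : ZMod p) := by
    by_cases h : IsSquare (m : ZMod p)
    · exact ⟨1, Or.inl rfl, by simp, by simpa using h⟩
    · refine ⟨leastNonresidue p, Or.inr rfl, by simpa using leastNonresidue_ne_zero h2, ?_⟩
      push_cast
      exact isSquare_mul_of_not_isSquare (not_isSquare_leastNonresidue h2) h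
  obtain ⟨s, hs, h1⟩ := exists_sq_mul_eq_of_isSquare h2 hεz hmz hsq
  have hu0 : u ≠ 0 := by rw [← norm_ne_zero_iff, hu]; exact one_ne_zero
  obtain ⟨t, ht, h3⟩ := exists_sq_eq_of_odd h2 (u := (m : ℚ_[p]) / u) (by
    rw [div_sub_one hu0, norm_div, hu, div_one, norm_sub_rev]
    exact hm')
  refine ⟨ε, s * t, hε, by rw [norm_mul, hs, ht, one_mul], ?_⟩
  rw [div_eq_iff hu0] at h3
  rw [h1]
  push_cast
  rw [h3]
  ring

variable {W : Type*} [AddCommGroup W] [Module ℚ_[p] W] [Module ℤ_[p] W]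
  [IsScalarTower ℤ_[p] ℚ_[p] W] {Q : QuadraticForm ℚ_[p] W}

theorem rewrites_one_of_sq {a b : ℤ} {s : ℚ_[p]} (hs : ‖s‖ = 1) (h : (a : ℚ_[p]) = s * s * b) :
    Rewrites Q [.one b] [.one a] := by
  rintro L ⟨_, K', ⟨x, hx, rfl⟩, hK, ho, rfl⟩
  refine ⟨_, K', ⟨s • x, ?_, (span_singleton_smul_eq hs).symm⟩, hK, ho, rfl⟩
  rw [polar_smul_left, polar_smul_right, smul_eq_mul, smul_eq_mul, hx, h]
  ring

/-- The Jordan blocks of lattices at an odd prime, in normal form. -/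
inductive IsJordanOdd (p : ℕ) : Block → Prop
  | zero : IsJordanOdd p (.one 0)
  | one (k : ℕ) (ε : ℤ) (hε : ε = 1 ∨ ε = leastNonresidue p) : IsJordanOdd p (.one (p ^ k * ε))

theorem exists_isBlock_odd (h2 : p ≠ 2) {x : W} (hx : ‖polar Q x x‖ ≤ 1) :
    ∃ c, IsJordanOdd p (.one c) ∧ IsBlock Q (.one c) (Submodule.span ℤ_[p] {x}) := by
  by_cases h0 : polar Q x x = 0
  · exact ⟨0, .zero, x, by simpa using h0, rfl⟩
  · obtain ⟨k, u, hu, h⟩ := exists_eq_pow_mul hx h0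
    obtain ⟨ε, s, hε, hs, h1⟩ := exists_unit_representative_odd h2 hu
    refine ⟨_, .one k ε hε, s • x, ?_, (span_singleton_smul_eq hs).symm⟩
    rw [polar_smul_left, polar_smul_right, smul_eq_mul, smul_eq_mul, h]
    push_cast
    rw [← h1]
    ring

/-- Polarization: if the largest norm of B occurs only off the diagonal, at (x, y), then B(x + y, x
+ y) is 2B(x, y) plus smaller terms. As 2 is a unit, x + y attains the maximum and can replace x as
a generator. -/
theorem exists_norm_polar_self (h2 : p ≠ 2) {vs : List W} (hne : vs ≠ []) :
    ∃ (z : W) (ws : List W), ws.length + 1 = vs.length ∧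
      Submodule.span ℤ_[p] {v | v ∈ z :: ws} = Submodule.span ℤ_[p] {v | v ∈ vs} ∧
      ∀ v ∈ ws, ‖polar Q z v‖ ≤ ‖polar Q z z‖ := by
  classical
  have hne' : (vs.toFinset ×ˢ vs.toFinset).Nonempty := by
    obtain ⟨v, hv⟩ := List.exists_mem_of_ne_nil _ hne
    exact ⟨(v, v), by simp [hv]⟩
  obtain ⟨⟨x, y⟩, hxy, hmax⟩ := Finset.exists_max_image _ (fun z : W × W => ‖polar Q z.1 z.2‖) hne'
  simp only [Finset.mem_product, List.mem_toFinset] at hxy hmax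
  have hmax' : ∀ a ∈ vs, ∀ b ∈ vs, ‖polar Q a b‖ ≤ ‖polar Q x y‖ := fun a ha b hb =>
    hmax (a, b) ⟨ha, hb⟩
  have hperm : ∀ {z : W}, z ∈ vs →
      {v | v ∈ z :: vs.erase z} = {v | v ∈ vs} ∧ (vs.erase z).length + 1 = vs.length := by
    intro z hz
    have h := List.perm_cons_erase hz
    refine ⟨by ext v; exact h.mem_iff.symm, ?_⟩
    have := h.length_eq
    simpa using this.symm
  by_cases hd : ∃ z ∈ vs, ‖polar Q x y‖ ≤ ‖polar Q z z‖
  · obtain ⟨z, hz, hzm⟩ := hd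
    obtain ⟨hs, hl⟩ := hperm hz
    exact ⟨z, vs.erase z, hl, by rw [hs], fun v hv =>
      (hmax' z hz v (List.mem_of_mem_erase hv)).trans hzm⟩
  · push Not at hd
    have hyx : y ≠ x := by
      rintro rfl
      exact lt_irrefl _ (hd y hxy.1)
    obtain ⟨hs, hl⟩ := hperm hxy.1
    have hy : y ∈ vs.erase x := (List.mem_erase_of_ne hyx).2 hxy.2
    refine ⟨x + y, vs.erase x, hl, ?_, fun v hv => ?_⟩
    · rw [← hs, span_cons_list, span_cons_list]
      have hy' : y ∈ Submodule.span ℤ_[p] {v | v ∈ vs.erase x} := Submodule.subset_span hy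
      apply le_antisymm <;> refine sup_le ?_ le_sup_right <;>
        rw [Submodule.span_le, Set.singleton_subset_iff]
      · exact add_mem (Submodule.mem_sup_left (Submodule.mem_span_singleton_self x))
          (Submodule.mem_sup_right hy')
      · have := sub_mem (Submodule.mem_sup_left (T := Submodule.span ℤ_[p] {v | v ∈ vs.erase x})
          (Submodule.mem_span_singleton_self (R := ℤ_[p]) (x + y))) (Submodule.mem_sup_right hy')
        rwa [add_sub_cancel_right] at this
    · have hv' := List.mem_of_mem_erase hv
      have e : ‖polar Q (x + y) (x + y)‖ = ‖polar Q x y‖ := by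
        have e1 : polar Q (x + y) (x + y) = (polar Q x x + polar Q y y) + 2 * polar Q x y := by
          rw [polar_add_left, polar_add_right, polar_add_right, polar_comm Q y x]
          ring
        have e2 : ‖2 * polar Q x y‖ = ‖polar Q x y‖ := by
          rw [norm_mul, norm_two_eq_one h2, one_mul]
        have e3 : ‖polar Q x x + polar Q y y‖ < ‖polar Q x y‖ :=
          (Padic.nonarchimedean _ _).trans_lt (max_lt (hd x hxy.1) (hd y hxy.2))
        rw [e1, Padic.add_eq_max_of_ne (by rw [e2]; exact e3.ne), e2, max_eq_right e3.le]
      rw [e, polar_add_left]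
      exact (Padic.nonarchimedean _ _).trans (max_le (hmax' x hxy.1 v hv') (hmax' y hxy.2 v hv'))

theorem exists_realizes_odd (h2 : p ≠ 2) (n : ℕ) : ∀ vs : List W, vs.length = n →
    (∀ x ∈ Submodule.span ℤ_[p] {v | v ∈ vs}, ∀ y ∈ Submodule.span ℤ_[p] {v | v ∈ vs},
      ‖polar Q x y‖ ≤ 1) →
    ∃ l, blockSize l = n ∧ (∀ b ∈ l, IsJordanOdd p b) ∧
      Realizes Q l (Submodule.span ℤ_[p] {v | v ∈ vs}) := by
  induction n with
  | zero =>
    intro vs hn _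
    obtain rfl := List.eq_nil_of_length_eq_zero hn
    exact ⟨[], rfl, by simp, by simp [Realizes]⟩
  | succ n ih =>
    intro vs hn hint
    obtain ⟨z, ws, hl, hs, hz⟩ := exists_norm_polar_self (Q := Q) h2 (vs := vs)
      (by rintro rfl; simp at hn)
    obtain ⟨vs', hlen, ho, hs'⟩ := exists_orth_complement_singleton hz
    rw [hs] at hs'
    have hle : Submodule.span ℤ_[p] {v | v ∈ vs'} ≤ Submodule.span ℤ_[p] {v | v ∈ vs} := by
      rw [hs']; exact le_sup_right
    have hzm : z ∈ Submodule.span ℤ_[p] {v | v ∈ vs} := by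
      rw [← hs]; exact Submodule.subset_span (by simp)
    obtain ⟨l, h3, h4, h5⟩ := ih vs' (by omega) fun a ha b hb => hint a (hle ha) b (hle hb)
    obtain ⟨c, hc, hb⟩ := exists_isBlock_odd h2 (hint z hzm z hzm)
    refine ⟨.one c :: l, by simp only [blockSize]; omega, ?_, _, _, hb, h5, ho, hs'⟩
    intro b hb
    rcases List.mem_cons.1 hb with rfl | hb
    · exact hc
    · exact h4 b hb

/-- Two summands `⟨m a⟩` with the same unit `a` may be replaced by two summands `⟨m b⟩`. -/
theorem rewrites_pair_odd (h2 : p ≠ 2) {m a b : ℤ} (ha : (a : ZMod p) ≠ 0)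
    (hb : (b : ZMod p) ≠ 0) :
    Rewrites Q [.one (m * a), .one (m * a)] [.one (m * b), .one (m * b)] := by
  -- Modulo p every element is a sum of two squares. With x² + y² = ab, the orthogonal combinations
  -- (x, y) and (-y, x) both have norm ma(x² + y²), in the square class of mb.
  obtain ⟨x, y, hxy⟩ := ZMod.sq_add_sq p ((a * b : ℤ) : ZMod p)
  obtain ⟨x, rfl⟩ := ZMod.intCast_surjective x
  obtain ⟨y, rfl⟩ := ZMod.intCast_surjective y
  have hxy0 : ((x ^ 2 + y ^ 2 : ℤ) : ZMod p) ≠ 0 := by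
    push_cast at hxy ⊢
    rw [hxy]
    exact mul_ne_zero ha hb
  have h := rewrites_one_one (Q := Q) (A := m * a) (B := m * a) (x := x) (y := y) (z := -y)
    (w := x) (by
      rw [norm_intCast_eq_one_iff, show x * x - y * -y = x ^ 2 + y ^ 2 by ring]
      exact hxy0) (by ring)
  obtain ⟨s, hs, h1⟩ := exists_sq_mul_eq_of_isSquare h2 (a := b) (b := a * (x ^ 2 + y ^ 2)) hb (by
    push_cast at hxy0 ⊢
    exact mul_ne_zero ha hxy0) (by
    push_cast at hxy ⊢
    rw [hxy]
    exact ⟨a * b, by ring⟩)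
  have h3 : ∀ t : ℤ, t = m * (a * (x ^ 2 + y ^ 2)) → Rewrites Q [.one t] [.one (m * b)] := by
    rintro _ rfl
    refine rewrites_one_of_sq hs ?_
    push_cast at h1 ⊢
    rw [h1]
    ring
  exact h.trans ((h3 _ (by ring)).append (h3 _ (by ring)))

/-- A second entry u combines with the one already present to two entries 1. -/
theorem OddComponent.exists_rewrites_cons (h2 : p ≠ 2) (k : ℕ) {ε : ℤ}
    (hε : ε = 1 ∨ ε = leastNonresidue p) (c : OddComponent) :
    ∃ c' : OddComponent, Rewrites Q (.one (p ^ k * ε) :: c.blocks p k) (c'.blocks p k) := by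
  obtain ⟨a, e⟩ := c
  rcases hε with rfl | rfl
  · refine ⟨⟨a + 1, e⟩, ?_⟩
    simp only [blocks, List.replicate_succ, mul_one]
    exact Rewrites.refl _
  · cases e with
    | false =>
      refine ⟨⟨a, true⟩, Rewrites.of_perm ?_⟩
      simpa [blocks] using
        (List.perm_append_singleton (Block.one (p ^ k * leastNonresidue p)) _).symm
    | true =>
      refine ⟨⟨a + 2, false⟩, ?_⟩
      have h1 : Rewrites Q (Block.one (p ^ k * leastNonresidue p) :: (blocks p k ⟨a, true⟩))
          (List.replicate a (Block.one (p ^ k)) ++ [.one (p ^ k * leastNonresidue p),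
            .one (p ^ k * leastNonresidue p)]) := by
        refine Rewrites.of_perm ?_
        simp only [blocks, if_true]
        exact (List.perm_middle (a := Block.one (p ^ k * leastNonresidue p))
          (l₁ := List.replicate a (Block.one (p ^ k)))
          (l₂ := [.one (p ^ k * leastNonresidue p)])).symm
      have h3 := rewrites_pair_odd (Q := Q) h2 (m := p ^ k) (a := leastNonresidue p) (b := 1)
        (by simpa using leastNonresidue_ne_zero h2) (by simp)
      refine h1.trans (((Rewrites.refl _).append h3).trans ?_)
      simp only [blocks, List.replicate_add, mul_one]
      exact Rewrites.of_perm (by simp [List.replicate_succ])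

end Odd

/-! ### Maximal lattices at odd primes: obstructions and existence of the normal form -/

section Odd

variable {p : ℕ} [hp : Fact p.Prime] {W : Type*} [AddCommGroup W] [Module ℚ_[p] W]
  [Module ℤ_[p] W] [IsScalarTower ℤ_[p] ℚ_[p] W] {Q : QuadraticForm ℚ_[p] W}

theorem norm_map_eq (h2 : p ≠ 2) (x : W) : ‖Q x‖ = ‖polar Q x x‖ := by
  rw [polar_self, nsmul_eq_mul, norm_mul]
  push_cast
  rw [norm_two_eq_one h2, one_mul]

/-- A maximal lattice has no orthogonal summand `⟨c⟩` with `p ^ 2 ∣ c`. -/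
theorem IsMaximalLattice.not_realizes_one_sq (h2 : p ≠ 2) {L : Submodule ℤ_[p] W}
    (hL : IsMaximalLattice Q L) {c : ℤ} (hc : c ≠ 0) {l : List Block} :
    ¬ Realizes Q (.one (p ^ 2 * c) :: l) L := by
  rintro ⟨_, K, ⟨x, hx, rfl⟩, -, ho, rfl⟩
  have hp0 : (p : ℚ_[p]) ≠ 0 := by exact_mod_cast hp.out.ne_zero
  have hc0 : (c : ℚ_[p]) ≠ 0 := by exact_mod_cast hc
  have hpc : ‖(p : ℚ_[p]) * c‖ ≤ 1 := by
    simpa using Padic.norm_int_le_one (p := p) (p * c)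
  push_cast at hx
  have key : ∀ y ∈ Submodule.span ℤ_[p] {x} ⊔ K, ‖polar Q x y‖ ≤ ‖(p : ℚ_[p]) ^ 2 * c‖ := by
    intro y hy
    obtain ⟨a, ha, b, hb, rfl⟩ := Submodule.mem_sup.1 hy
    obtain ⟨s, rfl⟩ := Submodule.mem_span_singleton.1 ha
    rw [polar_add_right, ho x (Submodule.mem_span_singleton_self x) b hb, add_zero, ← coe_smul_eq,
      polar_smul_right, hx, smul_eq_mul, norm_mul]
    exact mul_le_of_le_one_left (norm_nonneg _) s.2
  have hnp : (0 : ℝ) < ‖(p : ℚ_[p])‖ := norm_pos_iff.2 hp0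
  have hnp1 : ‖(p : ℚ_[p])‖ < 1 := Padic.norm_p_lt_one
  -- The vector x/p lies in the dual and has integral norm, so it lies in the lattice; but its
  -- pairing with x is pc, while all pairings of x are multiples of p²c.
  have hmem : (p : ℚ_[p])⁻¹ • x ∈ Submodule.span ℤ_[p] {x} ⊔ K := by
    refine hL.mem_of_mem_dual (mem_dual.2 fun y hy => ?_) ?_
    · rw [polar_smul_left, smul_eq_mul, norm_mul, norm_inv]
      refine (mul_le_mul_of_nonneg_left (key y hy) (inv_nonneg.2 hnp.le)).trans ?_
      rw [pow_two, mul_assoc, norm_mul, inv_mul_cancel_left₀ hnp.ne']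
      exact hpc
    · rw [norm_map_eq h2, polar_smul_left, polar_smul_right, hx, smul_eq_mul, smul_eq_mul,
        show (p : ℚ_[p])⁻¹ * ((p : ℚ_[p])⁻¹ * ((p : ℚ_[p]) ^ 2 * c)) = c by field_simp]
      exact Padic.norm_int_le_one c
  have h := key _ hmem
  rw [polar_smul_right, hx, smul_eq_mul, pow_two, mul_assoc, inv_mul_cancel_left₀ hp0,
    norm_mul _ ((p : ℚ_[p]) * c)] at h
  have : 0 < ‖(p : ℚ_[p]) * c‖ := norm_pos_iff.2 (mul_ne_zero hp0 hc0)
  nlinarith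

/-- A maximal lattice has no orthogonal summand `⟨p a⟩ ⊥ ⟨p b⟩` that is isotropic modulo `p`. -/
theorem IsMaximalLattice.not_realizes_one_one (h2 : p ≠ 2) {L : Submodule ℤ_[p] W}
    (hL : IsMaximalLattice Q L) {a b y : ℤ} (ha : (a : ZMod p) ≠ 0)
    (hy : ((a + b * y ^ 2 : ℤ) : ZMod p) = 0) {l : List Block} :
    ¬ Realizes Q (.one (p * a) :: .one (p * b) :: l) L := by
  rintro ⟨_, _, ⟨x, hx, rfl⟩, ⟨_, K, ⟨x', hx', rfl⟩, -, ho', rfl⟩, ho, rfl⟩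
  have hp0 : (p : ℚ_[p]) ≠ 0 := by exact_mod_cast hp.out.ne_zero
  have hp1 : ‖(p : ℚ_[p])‖ < 1 := Padic.norm_p_lt_one
  push_cast at hx hx'
  have hxx' : polar Q x x' = 0 := ho x (Submodule.mem_span_singleton_self x) x'
    (Submodule.mem_sup_left (Submodule.mem_span_singleton_self x'))
  set M := Submodule.span ℤ_[p] {x} ⊔ (Submodule.span ℤ_[p] {x'} ⊔ K) with hM
  have hform : ∀ z ∈ M, ∃ s t : ℚ_[p], ‖s‖ ≤ 1 ∧ ‖t‖ ≤ 1 ∧ polar Q x z = s * (p * a) ∧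
      polar Q x' z = t * (p * b) := by
    intro z hz
    obtain ⟨u, hu, v, hv, rfl⟩ := Submodule.mem_sup.1 hz
    obtain ⟨s, rfl⟩ := Submodule.mem_span_singleton.1 hu
    obtain ⟨u', hu', v', hv', rfl⟩ := Submodule.mem_sup.1 hv
    obtain ⟨t, rfl⟩ := Submodule.mem_span_singleton.1 hu'
    refine ⟨s, t, s.2, t.2, ?_, ?_⟩
    · rw [polar_add_right, ho x (Submodule.mem_span_singleton_self x) _ hv, ← coe_smul_eq,
        polar_smul_right, hx, add_zero, smul_eq_mul]
    · rw [polar_add_right, polar_add_right, ho' x' (Submodule.mem_span_singleton_self x') _ hv',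
        ← coe_smul_eq, ← coe_smul_eq, polar_smul_right, polar_smul_right, hx', polar_comm Q x' x,
        hxx', smul_zero, zero_add, add_zero, smul_eq_mul]
  -- The isotropic combination modulo p, divided by p, lies in the dual and has integral norm. It
  -- pairs with x to the unit a, although all pairings of x are divisible by p.
  set w := (p : ℚ_[p])⁻¹ • (x + (y : ℚ_[p]) • x') with hw
  have ha1 := Padic.norm_int_le_one (p := p) a
  have hb1 := Padic.norm_int_le_one (p := p) b
  have hy1 := Padic.norm_int_le_one (p := p) y
  have hmem : w ∈ M := by
    refine hL.mem_of_mem_dual (mem_dual.2 fun z hz => ?_) ?_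
    · obtain ⟨s, t, hs, ht, e1, e2⟩ := hform z hz
      rw [hw, polar_smul_left, polar_add_left, polar_smul_left, e1, e2, smul_eq_mul, smul_eq_mul,
        show (p : ℚ_[p])⁻¹ * (s * (p * a) + y * (t * (p * b))) = s * a + y * (t * b) by
          field_simp]
      exact norm_add_le_one (norm_mul_le_one hs ha1)
        (norm_mul_le_one hy1 (norm_mul_le_one ht hb1))
    · rw [norm_map_eq h2, hw]
      simp only [polar_smul_left, polar_smul_right, polar_add_left, polar_add_right, hx, hx',
        hxx', polar_comm Q x' x, smul_eq_mul]
      rw [ZMod.intCast_zmod_eq_zero_iff_dvd] at hy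
      obtain ⟨k, hk⟩ := hy
      have hk' := congrArg (Int.cast : ℤ → ℚ_[p]) hk
      push_cast at hk'
      rw [show (p : ℚ_[p])⁻¹ * ((p : ℚ_[p])⁻¹ * (p * a + y * 0) +
          y * ((p : ℚ_[p])⁻¹ * (0 + y * (p * b)))) =
          (p : ℚ_[p])⁻¹ * ((p : ℚ_[p])⁻¹ * (p * (a + b * y ^ 2))) by ring, hk',
        inv_mul_cancel_left₀ hp0, inv_mul_cancel_left₀ hp0]
      exact Padic.norm_int_le_one k
  obtain ⟨s, -, hs, -, e1, -⟩ := hform w hmem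
  rw [hw, polar_smul_right, polar_add_right, polar_smul_right, hxx', hx, smul_zero, add_zero,
    smul_eq_mul, inv_mul_cancel_left₀ hp0] at e1
  have h1 := norm_intCast_eq_one_iff.2 ha
  have h3 : ‖s * (p * a)‖ < 1 := by
    rw [mul_comm (p : ℚ_[p])]
    exact norm_mul_lt_one hs (norm_mul_lt_one ha1 hp1)
  rw [← e1, h1] at h3
  exact lt_irrefl _ h3

/-- Scales from p² on are excluded by maximality; the blocks of scales 1 and p are then collected
one at a time. -/
theorem IsMaximalLattice.exists_oddComponents (h2 : p ≠ 2) {L : Submodule ℤ_[p] W}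
    (hL : IsMaximalLattice Q L) : ∃ c₀ c₁ : OddComponent,
      Realizes Q (c₀.blocks p 0 ++ c₁.blocks p 1) L := by
  have := hL.finite
  have := hL.isLattice
  obtain ⟨e⟩ := exists_basis_of_isLattice L rfl
  have hspan : Submodule.span ℤ_[p] {v | v ∈ List.ofFn fun i => (e i : W)} = L := by
    have h1 : {v | v ∈ List.ofFn fun i => (e i : W)} = L.subtype '' Set.range e := by
      ext v
      simp [List.mem_ofFn]
    rw [h1, Submodule.span_image, e.span_eq, Submodule.map_top, Submodule.range_subtype]
  obtain ⟨l, hl, hj, h⟩ := exists_realizes_odd (Q := Q) h2 _ _ (List.length_ofFn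
    (f := fun i => (e i : W))) (by
      rw [hspan]
      exact fun x hx y hy => hL.even.norm_polar_le hx hy)
  rw [hspan] at h
  have hj' : ∀ b ∈ l, ∃ ε : ℤ, (ε = 1 ∨ ε = leastNonresidue p) ∧
      (b = .one (p ^ 0 * ε) ∨ b = .one (p ^ 1 * ε)) := by
    intro b hb
    obtain ⟨l', hperm, h3⟩ := Realizes.mem_block (l' := []) hb (by simpa using h)
    rw [List.append_nil] at hperm
    cases hj b hb with
    | zero => exact (hL.not_realizes_one_zero ((blockSize_perm hperm).trans hl) h3).elim
    | one k ε hε =>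
      match k with
      | 0 => exact ⟨ε, hε, Or.inl rfl⟩
      | 1 => exact ⟨ε, hε, Or.inr rfl⟩
      | k + 2 =>
        refine (hL.not_realizes_one_sq h2 (c := p ^ k * ε) ?_ (l := l') ?_).elim
        · refine mul_ne_zero (pow_ne_zero _ (by exact_mod_cast hp.out.ne_zero)) ?_
          rcases hε with rfl | rfl
          · exact one_ne_zero
          · intro h0
            apply leastNonresidue_ne_zero (p := p) h2
            exact_mod_cast congrArg (Int.cast : ℤ → ZMod p) h0
        · rwa [show (p : ℤ) ^ 2 * (p ^ k * ε) = p ^ (k + 2) * ε by ring]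
  have key : ∀ l : List Block, (∀ b ∈ l, ∃ ε : ℤ, (ε = 1 ∨ ε = leastNonresidue p) ∧
      (b = .one (p ^ 0 * ε) ∨ b = .one (p ^ 1 * ε))) → ∃ c₀ c₁ : OddComponent,
      Rewrites Q l (c₀.blocks p 0 ++ c₁.blocks p 1) := by
    intro l hl
    induction l with
    | nil => exact ⟨⟨0, false⟩, ⟨0, false⟩, by simpa [OddComponent.blocks] using Rewrites.refl _⟩
    | cons b l ih =>
      obtain ⟨c₀, c₁, h3⟩ := ih fun b hb => hl b (by simp [hb])
      have h4 := (Rewrites.refl (Q := Q) [b]).append h3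
      obtain ⟨ε, hε, rfl | rfl⟩ := hl b (by simp)
      · obtain ⟨c, hc⟩ := OddComponent.exists_rewrites_cons (Q := Q) h2 0 hε c₀
        refine ⟨c, c₁, h4.trans ?_⟩
        exact hc.append (Rewrites.refl _)
      · obtain ⟨c, hc⟩ := OddComponent.exists_rewrites_cons (Q := Q) h2 1 hε c₁
        refine ⟨c₀, c, h4.trans (Rewrites.trans (Rewrites.of_perm ?_)
          ((Rewrites.refl (c₀.blocks p 0)).append hc))⟩
        exact (List.perm_middle (l₁ := c₀.blocks p 0)).symm
  obtain ⟨c₀, c₁, h3⟩ := key l hj'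
  exact ⟨c₀, c₁, h3 L h⟩

theorem OddComponent.exists_of_mem_blocks {c : OddComponent} {k : ℕ} {b : Block}
    (h : b ∈ c.blocks p k) : ∃ ε : ℤ, (ε = 1 ∨ ε = leastNonresidue p) ∧ b = .one (p ^ k * ε) := by
  simp only [blocks, List.mem_append, List.mem_replicate] at h
  rcases h with ⟨-, rfl⟩ | h
  · exact ⟨1, Or.inl rfl, by simp⟩
  · split at h
    · exact ⟨_, Or.inr rfl, by simpa using h⟩
    · simp at h

theorem IsMaximalLattice.exists_flatMap_eq (h2 : p ≠ 2) {L : Submodule ℤ_[p] W}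
    (hL : IsMaximalLattice Q L) {c : ℕ → OddComponent} {K : ℕ}
    (h : Realizes Q ((List.range K).flatMap fun k => (c k).blocks p k) L) :
    ∃ c₀ c₁ : OddComponent, ((List.range K).flatMap fun k => (c k).blocks p k) =
      c₀.blocks p 0 ++ c₁.blocks p 1 := by
  match K with
  | 0 => exact ⟨⟨0, false⟩, ⟨0, false⟩, by simp [OddComponent.blocks]⟩
  | 1 => exact ⟨c 0, ⟨0, false⟩, by simp [OddComponent.blocks, List.range_succ]⟩
  | K + 2 =>
    refine ⟨c 0, c 1, ?_⟩
    have hmem : ∀ k, k + 2 < K + 2 → (c (k + 2)).blocks p (k + 2) = [] := by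
      intro k hk
      rw [List.eq_nil_iff_forall_not_mem]
      intro b hb
      obtain ⟨l', -, h3⟩ := Realizes.mem_block (l' := []) (b := b)
        (List.mem_flatMap.2 ⟨k + 2, List.mem_range.2 hk, hb⟩) (by simpa using h)
      obtain ⟨ε, hε, rfl⟩ := OddComponent.exists_of_mem_blocks hb
      refine hL.not_realizes_one_sq h2 (c := p ^ k * ε) ?_ (l := l') ?_
      · refine mul_ne_zero (pow_ne_zero _ (by exact_mod_cast hp.out.ne_zero)) ?_
        rcases hε with rfl | rfl
        · exact one_ne_zero
        · intro h0
          apply leastNonresidue_ne_zero (p := p) h2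
          exact_mod_cast congrArg (Int.cast : ℤ → ZMod p) h0
      · rwa [show (p : ℤ) ^ 2 * (p ^ k * ε) = p ^ (k + 2) * ε by ring]
    rw [add_comm K 2, List.range_add, List.flatMap_append]
    have h6 : (((List.range K).map fun x => 2 + x).flatMap fun k => (c k).blocks p k) = [] := by
      rw [List.flatMap_eq_nil_iff]
      intro k hk
      obtain ⟨x, hx, rfl⟩ := List.mem_map.1 hk
      rw [List.mem_range] at hx
      rw [add_comm 2 x]
      exact hmem x (by omega)
    rw [h6]
    simp [List.range_succ]

end Odd

/-! ### Uniqueness of the normal form of maximal lattices at odd primes -/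

section Odd

variable {p : ℕ} [hp : Fact p.Prime]

theorem OddComponent.prod_det_blocks (c : OddComponent) (k : ℕ) :
    ((c.blocks p k).map Block.det).prod =
      ((p : ℤ) ^ k) ^ (c.ones + c.nonres.toNat) * (leastNonresidue p : ℤ) ^ c.nonres.toNat := by
  obtain ⟨a, e⟩ := c
  cases e <;> simp [blocks, Block.det, pow_add, mul_assoc]

theorem OddComponent.blockSize_blocks (c : OddComponent) (k : ℕ) :
    blockSize (c.blocks p k) = c.ones + c.nonres.toNat := by
  have : ∀ (a : ℕ) (m : ℤ), blockSize (List.replicate a (.one m)) = a := by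
    intro a m
    induction a with
    | zero => rfl
    | succ a ih => rw [List.replicate_succ, blockSize, ih, add_comm]
  obtain ⟨a, e⟩ := c
  rw [blocks, blockSize_append, this]
  cases e <;> simp [blockSize]

variable {W : Type*} [AddCommGroup W] [Module ℚ_[p] W]
  [Module ℤ_[p] W] [IsScalarTower ℤ_[p] ℚ_[p] W] {Q : QuadraticForm ℚ_[p] W}

theorem map_eq_half_mul (c : ℚ_[p]) {x : W} {b : ℚ_[p]} (hx : polar Q x x = b) :
    Q (c • x) = c * c * b / 2 := by
  rw [polar_self, nsmul_eq_mul] at hx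
  push_cast at hx
  rw [QuadraticMap.map_smul, smul_eq_mul, ← hx]
  ring

theorem hasValues_one_unit (h2 : p ≠ 2) {c : ℤ} (hc : ‖(c : ℚ_[p])‖ = 1) {K : Submodule ℤ_[p] W}
    (h : IsBlock Q (.one c) K) : HasValues Q K {0} := by
  obtain ⟨x, hx, rfl⟩ := h
  constructor
  · rintro _ rfl
    exact ⟨0, zero_mem _, zero_mem _, by simp⟩
  · intro z hz hd
    rw [Submodule.span_span_of_tower] at hz
    obtain ⟨s, rfl⟩ := Submodule.mem_span_singleton.1 hz
    have hs := mem_dual.1 hd x (Submodule.mem_span_singleton_self x)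
    rw [polar_smul_left, hx, smul_eq_mul, norm_mul, hc, mul_one] at hs
    refine ⟨0, rfl, ?_⟩
    rw [map_eq_half_mul s hx, sub_zero, norm_div, norm_two_eq_one h2, div_one]
    exact norm_mul_le_one (norm_mul_le_one hs hs) hc.le

theorem hasValues_one_prime {c : ℤ} (hc : ‖(c : ℚ_[p])‖ = 1) {K : Submodule ℤ_[p] W}
    (h : IsBlock Q (.one (p * c)) K) :
    HasValues Q K {k | ∃ s : ℚ_[p], ‖s‖ ≤ 1 ∧ k = s * s * c / (2 * p)} := by
  have hp0 : (p : ℚ_[p]) ≠ 0 := by exact_mod_cast hp.out.ne_zero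
  obtain ⟨x, hx, rfl⟩ := h
  push_cast at hx
  constructor
  · rintro _ ⟨s, hs, rfl⟩
    refine ⟨(s / p) • x, Submodule.smul_mem _ _ (Submodule.subset_span
      (Submodule.mem_span_singleton_self x)), mem_dual.2 fun z hz => ?_, ?_⟩
    · obtain ⟨t, rfl⟩ := Submodule.mem_span_singleton.1 hz
      rw [← coe_smul_eq, polar_smul_left, polar_smul_right, hx, smul_eq_mul, smul_eq_mul,
        show s / p * (t * ((p : ℚ_[p]) * c)) = s * (t * c) by field_simp]
      exact norm_mul_le_one hs (norm_mul_le_one t.2 hc.le)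
    · rw [map_eq_half_mul _ hx, show s / p * (s / p) * ((p : ℚ_[p]) * c) / 2 =
        s * s * c / (2 * p) by field_simp]
      simp
  · intro z hz hd
    rw [Submodule.span_span_of_tower] at hz
    obtain ⟨s, rfl⟩ := Submodule.mem_span_singleton.1 hz
    have hs := mem_dual.1 hd x (Submodule.mem_span_singleton_self x)
    rw [polar_smul_left, hx, smul_eq_mul, ← mul_assoc, norm_mul, hc, mul_one] at hs
    refine ⟨_, ⟨s * p, hs, rfl⟩, ?_⟩
    rw [map_eq_half_mul _ hx, show s * s * ((p : ℚ_[p]) * c) / 2 =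
      s * p * (s * p) * c / (2 * p) by field_simp]
    simp

theorem Realizes.hasValues_unit (h2 : p ≠ 2) {l : List Block}
    (hl : ∀ b ∈ l, ∃ c : ℤ, ‖(c : ℚ_[p])‖ = 1 ∧ b = .one c) {K : Submodule ℤ_[p] W}
    (h : Realizes Q l K) : HasValues Q K {0} := by
  induction l generalizing K with
  | nil =>
    obtain rfl := h
    exact hasValues_bot
  | cons b l ih =>
    obtain ⟨K₁, K₂, hb, h3, ho, rfl⟩ := h
    obtain ⟨c, hc, rfl⟩ := hl b (by simp)
    convert (hasValues_one_unit h2 hc hb).sup (ih (fun b hb => hl b (by simp [hb])) h3) ho using 1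
    simp

theorem norm_unit_eq_one (h2 : p ≠ 2) {ε : ℤ} (hε : ε = 1 ∨ ε = leastNonresidue p) :
    ‖(ε : ℚ_[p])‖ = 1 := by
  rcases hε with rfl | rfl
  · simp
  · simpa using norm_leastNonresidue (p := p) h2

/-- Without an entry 1, the component of scale p is empty or ⟨pu⟩ with u the least nonresidue, so up
to integers the dual values are us²/(2p). -/
theorem IsMaximalLattice.exists_norm_sub_le (h2 : p ≠ 2) {L : Submodule ℤ_[p] W}
    (hL : IsMaximalLattice Q L) {c₀ c₁ : OddComponent} (h1 : c₁.ones = 0)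
    (h : Realizes Q (c₀.blocks p 0 ++ c₁.blocks p 1) L) {x : W} (hx : x ∈ dual Q L) :
    ∃ s : ℚ_[p], ‖s‖ ≤ 1 ∧ ‖Q x - s * s * leastNonresidue p / (2 * p)‖ ≤ 1 := by
  obtain ⟨K, K', hK, hK', ho, rfl⟩ := realizes_append.1 h
  have hv := hK.hasValues_unit h2 fun b hb => by
    obtain ⟨ε, hε, rfl⟩ := OddComponent.exists_of_mem_blocks hb
    exact ⟨_, by simpa using norm_unit_eq_one h2 hε, rfl⟩
  have htop : x ∈ Submodule.span ℚ_[p] ((K ⊔ K' : Submodule ℤ_[p] W) : Set W) := by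
    rw [hL.isLattice.span_eq_top]; trivial
  obtain ⟨a, e⟩ := c₁
  dsimp only at h1
  subst h1
  cases e with
  | false =>
    simp only [OddComponent.blocks, List.replicate_zero, List.nil_append, Bool.false_eq_true,
      if_false] at hK'
    obtain rfl := hK'
    obtain ⟨_, ⟨k, hk, k', hk', rfl⟩, h3⟩ := (hv.sup hasValues_bot ho).2 x htop hx
    obtain rfl := Set.mem_singleton_iff.1 hk
    obtain rfl := Set.mem_singleton_iff.1 hk'
    exact ⟨0, by simp, by simpa using h3⟩
  | true =>
    simp only [OddComponent.blocks, List.replicate_zero, List.nil_append, if_true, pow_one] at hK'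
    obtain ⟨K₁, _, hb, rfl, -, rfl⟩ := hK'
    rw [sup_bot_eq] at ho hx htop
    obtain ⟨_, ⟨k, hk, k', ⟨s, hs, rfl⟩, rfl⟩, h3⟩ :=
      (hv.sup (hasValues_one_prime (norm_unit_eq_one h2 (Or.inr rfl)) hb) ho).2 x htop hx
    obtain rfl := Set.mem_singleton_iff.1 hk
    exact ⟨s, hs, by simpa using h3⟩

theorem Realizes.exists_mem_dual {l : List Block} {L : Submodule ℤ_[p] W}
    (h : Realizes Q (.one p :: l) L) : ∃ x ∈ dual Q L, Q x = 1 / (2 * p) := by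
  have hp0 : (p : ℚ_[p]) ≠ 0 := by exact_mod_cast hp.out.ne_zero
  obtain ⟨_, K, ⟨x, hx, rfl⟩, -, ho, rfl⟩ := h
  push_cast at hx
  refine ⟨(p : ℚ_[p])⁻¹ • x, mem_dual.2 fun y hy => ?_, ?_⟩
  · obtain ⟨a, ha, b, hb, rfl⟩ := Submodule.mem_sup.1 hy
    obtain ⟨s, rfl⟩ := Submodule.mem_span_singleton.1 ha
    rw [polar_smul_left, polar_add_right, ho x (Submodule.mem_span_singleton_self x) b hb,
      ← coe_smul_eq, polar_smul_right, hx, add_zero, smul_eq_mul, smul_eq_mul,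
      show (p : ℚ_[p])⁻¹ * (s * p) = s by field_simp]
    exact s.2
  · rw [map_eq_half_mul _ hx]
    field_simp

/-- An entry 1 at scale p produces the dual value 1/(2p). If the other form had no such entry, this
would agree with some us²/(2p) up to an integer, and u would be a square modulo p. -/
theorem IsMaximalLattice.ones_ne_zero (h2 : p ≠ 2) {L L' : Submodule ℤ_[p] W}
    (hL : IsMaximalLattice Q L) (hL' : IsMaximalLattice Q L') {c₀ c₁ c₀' c₁' : OddComponent}
    (h : Realizes Q (c₀.blocks p 0 ++ c₁.blocks p 1) L)
    (h' : Realizes Q (c₀'.blocks p 0 ++ c₁'.blocks p 1) L') (h1 : c₁.ones ≠ 0) :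
    c₁'.ones ≠ 0 := by
  intro h0
  have hp0 : (p : ℚ_[p]) ≠ 0 := by exact_mod_cast hp.out.ne_zero
  have hmem : Block.one p ∈ c₁.blocks p 1 := by simp [OddComponent.blocks, h1]
  obtain ⟨l, -, h3⟩ := Realizes.mem_block hmem h.append_comm
  obtain ⟨x, hx, hQx⟩ := h3.exists_mem_dual
  obtain ⟨y, hy, hxy⟩ := hL.exists_mem_dual_sub hL' hx
  obtain ⟨s, hs, h4⟩ := hL'.exists_norm_sub_le h2 h0 h' hy
  refine not_isSquare_leastNonresidue (p := p) h2 ?_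
  have := isSquare_of_sq_mul_eq (a := 1) (b := leastNonresidue p) hs (by
    have h5 := norm_add_le_one hxy h4
    have h6 : (Q x - Q y) + (Q y - s * s * leastNonresidue p / (2 * p)) =
        (1 - s * s * leastNonresidue p) / (2 * p) := by
      rw [hQx]; ring
    rw [h6] at h5
    have h7 : ‖(p : ℚ_[p])‖ < 1 := Padic.norm_p_lt_one
    rw [norm_div, norm_mul, norm_two_eq_one h2, one_mul, div_le_one (norm_pos_iff.2 hp0)] at h5
    push_cast
    exact h5.trans_lt h7)
  simpa using this

/-- The component of scale p must be anisotropic modulo p. This bounds its rank by 2, and in rank 2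
the square class of -1 decides which form is anisotropic. -/
theorem IsMaximalLattice.oddComponent_cases (h2 : p ≠ 2) {L : Submodule ℤ_[p] W}
    (hL : IsMaximalLattice Q L) {c₀ c₁ : OddComponent}
    (h : Realizes Q (c₀.blocks p 0 ++ c₁.blocks p 1) L) :
    c₁ = ⟨0, false⟩ ∨ c₁ = ⟨1, false⟩ ∨ c₁ = ⟨0, true⟩ ∨
      (c₁ = ⟨2, false⟩ ∧ ¬ IsSquare (-1 : ZMod p)) ∨ (c₁ = ⟨1, true⟩ ∧ IsSquare (-1 : ZMod p)) := by
  have h' := h.append_comm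
  have hr := leastNonresidue_ne_zero (p := p) h2
  obtain ⟨a, e⟩ := c₁
  have hpp : ∀ m, IsSquare (-1 : ZMod p) → a ≠ m + 2 := by
    rintro m ⟨y, hy⟩ rfl
    obtain ⟨y, rfl⟩ := ZMod.intCast_surjective y
    refine hL.not_realizes_one_one h2 (a := 1) (b := 1) (y := y) (by simp) ?_ (L := L)
      (l := List.replicate m (.one (p ^ 1)) ++
        ((if e then [.one (p ^ 1 * leastNonresidue p)] else []) ++ c₀.blocks p 0)) ?_
    · push_cast
      rw [one_mul, pow_two, ← hy, add_neg_cancel]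
    · simpa [OddComponent.blocks, List.replicate_succ] using h'
  have hpr : ∀ l, ¬ IsSquare (-1 : ZMod p) →
      ¬ Realizes Q (.one (p * leastNonresidue p) :: .one (p * 1) :: l) L := by
    intro l hm
    obtain ⟨y, hy⟩ := isSquare_mul_of_not_isSquare hm (not_isSquare_leastNonresidue h2)
    obtain ⟨y, rfl⟩ := ZMod.intCast_surjective y
    refine hL.not_realizes_one_one h2 (y := y) (by simpa using hr) ?_
    push_cast
    rw [one_mul, pow_two, ← hy]
    ring
  by_cases hm : IsSquare (-1 : ZMod p)
  · match a, e with
    | 0, false | 1, false | 0, true | 1, true => simp [hm]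
    | m + 2, _ => exact (hpp m hm rfl).elim
  · match a, e with
    | 0, false | 1, false | 0, true | 2, false => simp [hm]
    | m + 1, true =>
      refine (hpr (List.replicate m (.one (p ^ 1)) ++ c₀.blocks p 0) hm
        (Rewrites.of_perm ?_ L h')).elim
      simp only [OddComponent.blocks, if_true, List.replicate_succ, pow_one, mul_one]
      rw [← Multiset.coe_eq_coe]
      simp only [← Multiset.coe_add, ← Multiset.cons_coe, ← Multiset.singleton_add]
      simp only [Multiset.coe_nil]
      abel
    | m + 3, false =>
      have h3 := rewrites_pair_odd (Q := Q) h2 (m := p) (a := 1) (b := leastNonresidue p)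
        (by simp) (by simpa using hr)
      have h4 : Realizes Q ([.one (p * 1), .one (p * 1)] ++ (.one (p * 1) ::
          (List.replicate m (.one (p ^ 1)) ++ c₀.blocks p 0))) L := by
        simpa [OddComponent.blocks, List.replicate_succ] using h'
      have h5 := (h3.append (Rewrites.refl _)) L h4
      refine (hpr (.one (p * leastNonresidue p) ::
        (List.replicate m (.one (p ^ 1)) ++ c₀.blocks p 0)) hm (Rewrites.of_perm ?_ L h5)).elim
      exact (List.Perm.swap _ _ _).cons _

theorem even_sub_of_sq_mul {m m' : ℕ} {u u' s : ℚ_[p]} (hu : ‖u‖ = 1) (hu' : ‖u'‖ = 1)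
    (h : (p : ℚ_[p]) ^ m * u = s * s * ((p : ℚ_[p]) ^ m' * u')) : m % 2 = m' % 2 := by
  have hp0 : (p : ℚ_[p]) ≠ 0 := by exact_mod_cast hp.out.ne_zero
  have hs0 : s ≠ 0 := by
    rintro rfl
    rw [mul_zero, zero_mul, mul_eq_zero] at h
    rcases h with h | h
    · exact pow_ne_zero _ hp0 h
    · simp [h] at hu
  have h1 := congrArg norm h
  rw [norm_mul, norm_mul, norm_mul, norm_mul, hu, hu', Padic.norm_p_pow, Padic.norm_p_pow,
    Padic.norm_eq_zpow_neg_valuation hs0, mul_one, mul_one] at h1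
  have hpR : (p : ℝ) ≠ 0 := by exact_mod_cast hp.out.ne_zero
  rw [← zpow_add₀ hpR, ← zpow_add₀ hpR] at h1
  have := zpow_right_injective₀ (by exact_mod_cast hp.out.pos) (by
    exact_mod_cast hp.out.one_lt.ne') h1
  omega

/-- The parity of the valuation of the determinant and the presence of an entry 1 separate the
possible components of scale p. The square class of the determinant then fixes the last unit at
scale 1, and the rank fixes the number of ones. -/
theorem IsMaximalLattice.blocks_append_eq (h2 : p ≠ 2) {L L' : Submodule ℤ_[p] W}
    (hL : IsMaximalLattice Q L) (hL' : IsMaximalLattice Q L') {c₀ c₁ c₀' c₁' : OddComponent}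
    (hsize : blockSize (c₀.blocks p 0 ++ c₁.blocks p 1) = Module.finrank ℚ_[p] W)
    (hsize' : blockSize (c₀'.blocks p 0 ++ c₁'.blocks p 1) = Module.finrank ℚ_[p] W)
    (h : Realizes Q (c₀.blocks p 0 ++ c₁.blocks p 1) L)
    (h' : Realizes Q (c₀'.blocks p 0 ++ c₁'.blocks p 1) L') :
    c₀.blocks p 0 ++ c₁.blocks p 1 = c₀'.blocks p 0 ++ c₁'.blocks p 1 := by
  have hp0 : (p : ℚ_[p]) ≠ 0 := by exact_mod_cast hp.out.ne_zero
  have hr := norm_leastNonresidue (p := p) h2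
  have hr0 : (leastNonresidue p : ℚ_[p]) ≠ 0 := by
    rw [← norm_ne_zero_iff, hr]; exact one_ne_zero
  obtain ⟨s, hs⟩ := h.exists_det_eq hL.isLattice hL'.isLattice hsize hsize' h'
  simp only [List.map_append, List.prod_append, OddComponent.prod_det_blocks, pow_zero, one_pow,
    one_mul, pow_one] at hs
  push_cast at hs
  have hs' : (p : ℚ_[p]) ^ (c₁.ones + c₁.nonres.toNat) *
      (leastNonresidue p ^ c₀.nonres.toNat * leastNonresidue p ^ c₁.nonres.toNat) =
      s * s * ((p : ℚ_[p]) ^ (c₁'.ones + c₁'.nonres.toNat) *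
        (leastNonresidue p ^ c₀'.nonres.toNat * leastNonresidue p ^ c₁'.nonres.toNat)) := by
    linear_combination hs
  have hpar := even_sub_of_sq_mul (by simp [hr]) (by simp [hr]) hs'
  have e1 := hL.ones_ne_zero h2 hL' h h'
  have e2 := hL'.ones_ne_zero h2 hL h' h
  obtain rfl : c₁ = c₁' := by
    rcases hL.oddComponent_cases h2 h with rfl | rfl | rfl | ⟨rfl, h5⟩ | ⟨rfl, h5⟩ <;>
      rcases hL'.oddComponent_cases h2 h' with rfl | rfl | rfl | ⟨rfl, h6⟩ | ⟨rfl, h6⟩ <;>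
      first
      | rfl
      | exact (h5 h6).elim
      | exact (h6 h5).elim
      | (simp at e1; done)
      | (simp at e2; done)
      | (simp at hpar)
  have hdet : (leastNonresidue p : ℚ_[p]) ^ c₀.nonres.toNat =
      s * s * leastNonresidue p ^ c₀'.nonres.toNat := by
    refine mul_right_cancel₀ (b := (p : ℚ_[p]) ^ (c₁.ones + c₁.nonres.toNat) *
      leastNonresidue p ^ c₁.nonres.toNat)
      (mul_ne_zero (pow_ne_zero _ hp0) (pow_ne_zero _ hr0)) ?_
    linear_combination hs
  have hs1 : ‖s‖ ≤ 1 := by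
    have := congrArg norm hdet
    simp only [norm_mul, norm_pow, hr, one_pow, mul_one] at this
    nlinarith [norm_nonneg s]
  have hnr : c₀.nonres = c₀'.nonres := by
    have hns := not_isSquare_leastNonresidue (p := p) h2
    cases he : c₀.nonres <;> cases he' : c₀'.nonres <;> first | rfl | exfalso
    all_goals
      rw [he, he'] at hdet
      simp only [Bool.toNat_true, Bool.toNat_false, pow_one, pow_zero,
        mul_one] at hdet
    · have := isSquare_of_sq_mul_eq (a := 1) (b := leastNonresidue p) hs1 (by
        push_cast
        rw [← hdet]
        simp)
      exact hns (by simpa using this)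
    · have := isSquare_of_sq_mul_eq (a := leastNonresidue p) (b := 1) hs1 (by
        push_cast
        rw [hdet]
        simp)
      exact hns (by simpa using this)
  rw [blockSize_append, OddComponent.blockSize_blocks, OddComponent.blockSize_blocks]
    at hsize hsize'
  obtain ⟨a, e⟩ := c₀
  obtain ⟨a', e'⟩ := c₀'
  dsimp only at hnr hsize hsize'
  subst hnr
  obtain rfl : a = a' := by omega
  rfl

end Odd

/-! ### Normal forms for all primes, in terms of matrices -/

section NormalForm

variable {p : ℕ} [hp : Fact p.Prime]

/-- The lists of blocks of matrices in normal form. -/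
def IsNormalList (p : ℕ) (l : List Block) : Prop :=
  if p = 2 then ∃ (K : ℕ) (c : ℕ → TwoComponent), IsTwoNormalFamily c ∧
    l = (List.range K).flatMap fun k => (c k).blocks k
  else ∃ (K : ℕ) (c : ℕ → OddComponent), l = (List.range K).flatMap fun k => (c k).blocks p k

theorem isNormalForm_iff {n : ℕ} {J : Matrix (Fin n) (Fin n) ℤ} :
    IsNormalForm p J ↔ ∃ l, IsNormalList p l ∧ IsBlockDiagonal J l := by
  unfold IsNormalForm IsNormalList
  split_ifs with h
  · constructor
    · rintro ⟨K, c, h1, h2⟩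
      exact ⟨_, ⟨K, c, h2, rfl⟩, h1⟩
    · rintro ⟨_, ⟨K, c, h2, rfl⟩, h1⟩
      exact ⟨K, c, h1, h2⟩
  · constructor
    · rintro ⟨K, c, h1⟩
      exact ⟨_, ⟨K, c, rfl⟩, h1⟩
    · rintro ⟨_, ⟨K, c, rfl⟩, h1⟩
      exact ⟨K, c, h1⟩

theorem IsNormalList.det_ne_zero {l : List Block} (h : IsNormalList p l) :
    (l.map Block.det).prod ≠ 0 := by
  rw [Ne, List.prod_eq_zero_iff, List.mem_map]
  rintro ⟨b, hb, h0⟩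
  unfold IsNormalList at h
  split_ifs at h with h2
  · obtain ⟨K, c, hc, rfl⟩ := h
    obtain ⟨k, -, hb⟩ := List.mem_flatMap.1 hb
    simp only [TwoComponent.blocks, List.mem_append, List.mem_replicate, List.mem_map] at hb
    have h2k : (2 : ℤ) ^ k ≠ 0 := pow_ne_zero _ two_ne_zero
    rcases hb with (⟨-, rfl⟩ | hb) | ⟨ε, hε, rfl⟩
    · simp [Block.det] at h0
    · split at hb
      · obtain rfl := List.mem_singleton.1 hb
        have : (3 : ℤ) * (2 ^ k * 2 ^ k) = 0 := by
          simp only [Block.det] at h0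
          linear_combination h0
        simp at this
      · simp at hb
    · have := (hc.1 k).mem_w hε
      have hε0 : ε ≠ 0 := by omega
      simp [Block.det, hε0] at h0
  · obtain ⟨K, c, rfl⟩ := h
    obtain ⟨k, -, hb⟩ := List.mem_flatMap.1 hb
    obtain ⟨ε, hε, rfl⟩ := OddComponent.exists_of_mem_blocks hb
    have h3 := norm_unit_eq_one (p := p) h2 hε
    simp only [Block.det, mul_eq_zero] at h0
    rcases h0 with h0 | rfl
    · exact pow_ne_zero _ (by exact_mod_cast hp.out.ne_zero) h0
    · simp at h3

variable {W : Type*} [AddCommGroup W] [Module ℚ_[p] W]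
  [Module ℤ_[p] W] [IsScalarTower ℤ_[p] ℚ_[p] W] {Q : QuadraticForm ℚ_[p] W}

/-- A family with nonsingular Gram matrix is independent. Since normal forms have nonzero
determinant, this complements `Realizes.finrank_le` and makes the size of the block list equal to
the rank. -/
theorem Realizes.le_finrank [Module.Finite ℚ_[p] W] {l : List Block} {L : Submodule ℤ_[p] W}
    (h : Realizes Q l L) (h0 : (l.map Block.det).prod ≠ 0) :
    blockSize l ≤ Module.finrank ℚ_[p] W := by
  obtain ⟨f, -, hf⟩ := h.exists_family
  have hli : LinearIndependent ℚ_[p] fun i : Fin (blockSize l) => f i := by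
    rw [Fintype.linearIndependent_iff]
    intro g hg
    have hdet : ((Matrix.of fun i j : Fin (blockSize l) => blockEntry l i j).map
        (Int.castRingHom ℚ_[p])).det ≠ 0 := by
      rw [← RingHom.mapMatrix_apply, ← RingHom.map_det, det_blockEntry rfl]
      simpa using h0
    refine congrFun (Matrix.eq_zero_of_mulVec_eq_zero hdet ?_)
    ext i
    have hi : polarBilin Q (f i) (∑ j, g j • f j) = 0 := by rw [hg, map_zero]
    simp only [map_sum, map_smul, smul_eq_mul, polarBilin_apply_apply] at hi
    rw [Matrix.mulVec, dotProduct, Pi.zero_apply, ← hi]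
    refine Finset.sum_congr rfl fun j _ => ?_
    rw [hf i i.2 j j.2, Matrix.map_apply, Matrix.of_apply, eq_intCast, mul_comm]
  simpa using hli.fintype_card_le_finrank

theorem IsMaximalLattice.exists_isNormalList {L : Submodule ℤ_[p] W}
    (hL : IsMaximalLattice Q L) :
    ∃ l, IsNormalList p l ∧ blockSize l = Module.finrank ℚ_[p] W ∧ Realizes Q l L := by
  have := hL.finite
  obtain ⟨l, hl, h⟩ : ∃ l, IsNormalList p l ∧ Realizes Q l L := by
    by_cases h2 : p = 2
    · subst h2
      obtain ⟨K, c, hc, h⟩ := hL.exists_isTwoNormalFamily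
      exact ⟨_, by rw [IsNormalList, if_pos rfl]; exact ⟨K, c, hc, rfl⟩, h⟩
    · obtain ⟨c₀, c₁, h⟩ := hL.exists_oddComponents h2
      refine ⟨_, ?_, h⟩
      rw [IsNormalList, if_neg h2]
      exact ⟨2, fun k => if k = 0 then c₀ else c₁, by simp [List.range_succ]⟩
  exact ⟨l, hl, le_antisymm (h.le_finrank hl.det_ne_zero) (h.finrank_le hL.isLattice), h⟩

theorem IsNormalList.eq {L L' : Submodule ℤ_[p] W} (hL : IsMaximalLattice Q L)
    (hL' : IsMaximalLattice Q L') {l l' : List Block} (hl : IsNormalList p l)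
    (hl' : IsNormalList p l') (hsize : blockSize l = Module.finrank ℚ_[p] W)
    (hsize' : blockSize l' = Module.finrank ℚ_[p] W) (h : Realizes Q l L)
    (h' : Realizes Q l' L') : l = l' := by
  by_cases h2 : p = 2
  · subst h2
    rw [IsNormalList, if_pos rfl] at hl hl'
    obtain ⟨K, c, hc, rfl⟩ := hl
    obtain ⟨K', c', hc', rfl⟩ := hl'
    exact hc.flatMap_eq hL hL' hc' hsize hsize' h h'
  · rw [IsNormalList, if_neg h2] at hl hl'
    obtain ⟨K, c, rfl⟩ := hl
    obtain ⟨K', c', rfl⟩ := hl'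
    obtain ⟨c₀, c₁, e⟩ := hL.exists_flatMap_eq h2 h
    obtain ⟨c₀', c₁', e'⟩ := hL'.exists_flatMap_eq h2 h'
    rw [e] at hsize h ⊢
    rw [e'] at hsize' h' ⊢
    exact hL.blocks_append_eq h2 hL' hsize hsize' h h'

theorem gram_sum {n : ℕ} (e : Fin n → W) (T : Matrix (Fin n) (Fin n) ℚ_[p]) :
    gram Q (fun i => ∑ j, T i j • e j) = T * gram Q e * Tᵀ := by
  ext i j
  have hb : ∀ x y, polar Q x y = polarBilin Q x y := fun _ _ => rfl
  simp only [gram, Matrix.of_apply, Matrix.mul_apply, Matrix.transpose_apply, hb, map_sum,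
    LinearMap.sum_apply, map_smul, LinearMap.smul_apply, smul_eq_mul, Finset.sum_mul,
    Finset.mul_sum]
  refine Finset.sum_congr rfl fun k _ => Finset.sum_congr rfl fun k' _ => ?_
  ring

theorem toQp_mul {n : ℕ} (A B : Matrix (Fin n) (Fin n) ℤ_[p]) :
    toQp (A * B) = toQp A * toQp B := Matrix.map_mul

theorem toQp_one {n : ℕ} : toQp (1 : Matrix (Fin n) (Fin n) ℤ_[p]) = 1 :=
  Matrix.map_one _ (map_zero _) (map_one _)

theorem toQp_injective {n : ℕ} :
    Function.Injective (toQp : Matrix (Fin n) (Fin n) ℤ_[p] → Matrix (Fin n) (Fin n) ℚ_[p]) :=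
  Matrix.map_injective (FaithfulSMul.algebraMap_injective _ _)

theorem toQp_smul {n : ℕ} (T : Matrix (Fin n) (Fin n) ℤ_[p]) (i j : Fin n) (x : W) :
    toQp T i j • x = T i j • x := coe_smul_eq _ _

theorem sum_mul_smul {n : ℕ} (A B : Matrix (Fin n) (Fin n) ℚ_[p]) (e : Fin n → W) (i : Fin n) :
    ∑ j, (A * B) i j • e j = ∑ j, A i j • ∑ k, B j k • e k := by
  simp only [Matrix.mul_apply, Finset.sum_smul, Finset.smul_sum, smul_smul]
  exact Finset.sum_comm

theorem span_range_sum_toQp {n : ℕ} (e : Fin n → W) (T : GL (Fin n) ℤ_[p]) :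
    Submodule.span ℤ_[p] (Set.range fun i => ∑ j, toQp T.val i j • e j) =
      Submodule.span ℤ_[p] (Set.range e) := by
  apply le_antisymm <;> rw [Submodule.span_le] <;> rintro _ ⟨i, rfl⟩
  · exact Submodule.sum_mem _ fun j _ => by
      rw [toQp_smul]
      exact Submodule.smul_mem _ _ (Submodule.subset_span ⟨j, rfl⟩)
  · have h : e i = ∑ j, toQp T⁻¹.val i j • ∑ k, toQp T.val j k • e k := by
      rw [← sum_mul_smul, ← toQp_mul, ← Units.val_mul, inv_mul_cancel, Units.val_one, toQp_one]
      simp [Matrix.one_apply]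
    rw [SetLike.mem_coe, h]
    exact Submodule.sum_mem _ fun j _ => by
      rw [toQp_smul]
      exact Submodule.smul_mem _ _ (Submodule.subset_span ⟨j, rfl⟩)

theorem exists_toQp_sum_eq {n : ℕ} {e f : Fin n → W}
    (h : ∀ i, f i ∈ Submodule.span ℤ_[p] (Set.range e)) :
    ∃ T : Matrix (Fin n) (Fin n) ℤ_[p], ∀ i, f i = ∑ j, toQp T i j • e j := by
  have h' : ∀ i, ∃ c : Fin n → ℤ_[p], ∑ j, c j • e j = f i := fun i =>
    Submodule.mem_span_range_iff_exists_fun _ |>.1 (h i)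
  choose T hT using h'
  exact ⟨Matrix.of T, fun i => by simp_rw [toQp_smul]; exact (hT i).symm⟩

theorem exists_gl_of_span_eq {n : ℕ} (hn : Module.finrank ℚ_[p] W = n)
    {L : Submodule ℤ_[p] W} (hL : L.IsLattice ℚ_[p]) {e f : Fin n → W}
    (he : Submodule.span ℤ_[p] (Set.range e) = L) (hf : Submodule.span ℤ_[p] (Set.range f) = L) :
    ∃ T : GL (Fin n) ℤ_[p], ∀ i, f i = ∑ j, toQp T.val i j • e j := by
  have key : ∀ {e f : Fin n → W}, Submodule.span ℤ_[p] (Set.range e) = L →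
      Submodule.span ℤ_[p] (Set.range f) = L →
      ∃ T : Matrix (Fin n) (Fin n) ℤ_[p], ∀ i, f i = ∑ j, toQp T i j • e j := fun {e f} he hf =>
    exists_toQp_sum_eq fun i => by
      rw [he, ← hf]
      exact Submodule.subset_span ⟨i, rfl⟩
  obtain ⟨T, hT⟩ := key he hf
  obtain ⟨S, hS⟩ := key hf he
  have htop : ⊤ ≤ Submodule.span ℚ_[p] (Set.range e) := by
    rw [← hL.span_eq_top, ← he, Submodule.span_span_of_tower]
  have hli := linearIndependent_of_top_le_span_of_card_eq_finrank htop (by simp [hn])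
  have h1 : S * T = 1 := by
    apply toQp_injective
    rw [toQp_mul, toQp_one]
    ext i j
    have h2 : ∑ j, (toQp S * toQp T) i j • e j =
        ∑ j, (1 : Matrix (Fin n) (Fin n) ℚ_[p]) i j • e j := by
      rw [sum_mul_smul]
      simp only [← hT]
      rw [← hS]
      simp [Matrix.one_apply]
    rw [← sub_eq_zero, ← Finset.sum_sub_distrib] at h2
    simp only [← sub_smul] at h2
    exact sub_eq_zero.1 (Fintype.linearIndependent_iff.1 hli _ h2 j)
  exact ⟨⟨T, S, mul_eq_one_comm.1 h1, h1⟩, hT⟩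

/-- Maximal lattices have a normal form. -/
theorem IsMaximalLattice.exists_isNormalFormOutput {n : ℕ} (hn : Module.finrank ℚ_[p] W = n)
    {L : Submodule ℤ_[p] W} (hL : IsMaximalLattice Q L) {e : Fin n → W}
    (he : Submodule.span ℤ_[p] (Set.range e) = L) :
    ∃ T : GL (Fin n) ℤ_[p], IsNormalFormOutput (gram Q e) T := by
  obtain ⟨l, hl, hsize, h⟩ := hL.exists_isNormalList
  rw [hn] at hsize
  obtain ⟨f, hf, hspan⟩ := h.exists_basis hL.isLattice hsize hn
  obtain ⟨T, hT⟩ := exists_gl_of_span_eq hn hL.isLattice he hspan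
  refine ⟨T, Matrix.of fun i j => blockEntry l i j,
    isNormalForm_iff.2 ⟨l, hl, hsize, fun i j => rfl⟩, ?_⟩
  rw [← gram_sum]
  simp only [← hT]
  ext i j
  simp [gram, hf]

theorem IsNormalFormOutput.exists_isNormalList {n : ℕ} {L : Submodule ℤ_[p] W} {e : Fin n → W}
    (he : Submodule.span ℤ_[p] (Set.range e) = L) {T : GL (Fin n) ℤ_[p]}
    (hT : IsNormalFormOutput (gram Q e) T) :
    ∃ l, IsNormalList p l ∧ blockSize l = n ∧ Realizes Q l L ∧
      toQp T.val * gram Q e * (toQp T.val)ᵀ =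
        Matrix.of fun i j : Fin n => (blockEntry l i j : ℚ_[p]) := by
  obtain ⟨J, hJ, h⟩ := hT
  obtain ⟨l, hl, hsize, hJ⟩ := isNormalForm_iff.1 hJ
  have hJ' : J.map (Int.cast : ℤ → ℚ_[p]) =
      Matrix.of fun i j : Fin n => (blockEntry l i j : ℚ_[p]) := by
    ext i j
    simp [hJ]
  rw [hJ'] at h
  refine ⟨l, hl, hsize, ?_, h⟩
  rw [← gram_sum] at h
  let f : ℕ → W := fun i => if h : i < n then ∑ j, toQp T.val ⟨i, h⟩ j • e j else 0
  have hfi : ∀ i : Fin n, f i = ∑ j, toQp T.val i j • e j := fun i => by simp [f]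
  have hf : Realizes Q l (Submodule.span ℤ_[p] (f '' Set.Iio (blockSize l))) := by
    refine realizes_of_family fun i hi j hj => ?_
    rw [hsize] at hi hj
    have := congrFun (congrFun h ⟨i, hi⟩) ⟨j, hj⟩
    simp only [gram, Matrix.of_apply, ← hfi] at this
    exact this
  have hrange : f '' Set.Iio (blockSize l) = Set.range fun i => ∑ j, toQp T.val i j • e j := by
    rw [hsize]
    ext x
    constructor
    · rintro ⟨i, hi, rfl⟩
      exact ⟨⟨i, hi⟩, (hfi ⟨i, hi⟩).symm⟩
    · rintro ⟨i, rfl⟩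
      exact ⟨i, i.2, hfi i⟩
  rwa [hrange, span_range_sum_toQp, he] at hf

/-- Maximal lattices of isometric spaces have the same normal form. -/
theorem IsNormalFormOutput.eq {W' : Type*} [AddCommGroup W'] [Module ℚ_[p] W']
    [Module ℤ_[p] W'] [IsScalarTower ℤ_[p] ℚ_[p] W'] {Q' : QuadraticForm ℚ_[p] W'}
    (φ : Q.IsometryEquiv Q') {n : ℕ} (hn : Module.finrank ℚ_[p] W = n)
    {L : Submodule ℤ_[p] W} (hL : IsMaximalLattice Q L) {L' : Submodule ℤ_[p] W'}
    (hL' : IsMaximalLattice Q' L') {e : Fin n → W}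
    (he : Submodule.span ℤ_[p] (Set.range e) = L) {e' : Fin n → W'}
    (he' : Submodule.span ℤ_[p] (Set.range e') = L') {T T' : GL (Fin n) ℤ_[p]}
    (hT : IsNormalFormOutput (gram Q e) T) (hT' : IsNormalFormOutput (gram Q' e') T') :
    toQp T.val * gram Q e * (toQp T.val)ᵀ = toQp T'.val * gram Q' e' * (toQp T'.val)ᵀ := by
  have hgram : gram Q e = gram Q' fun i => φ (e i) := by
    ext i j
    simp only [gram, Matrix.of_apply, polar, ← map_add, QuadraticMap.IsometryEquiv.map_app]
  rw [hgram] at hT ⊢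
  -- The first lattice is transported along φ, so that both maximal lattices lie in the same space.
  have hspan : Submodule.span ℤ_[p] (Set.range fun i => φ (e i)) =
      L.map (φ.toLinearEquiv.toLinearMap.restrictScalars ℤ_[p]) := by
    rw [← he, Submodule.map_span, ← Set.range_comp]
    rfl
  obtain ⟨l, hl, hs, hr, h⟩ := hT.exists_isNormalList hspan
  obtain ⟨l', hl', hs', hr', h'⟩ := hT'.exists_isNormalList he'
  have hn' : Module.finrank ℚ_[p] W' = n := by rw [← hn, φ.toLinearEquiv.finrank_eq]
  have := hl.eq (hL.map φ) hL' hl' (hs.trans hn'.symm) (hs'.trans hn'.symm) hr hr'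
  rw [h, h', this]

end NormalForm

/-! ### Completions of lattices over `ℤ` -/

section Localization

variable {p : ℕ} [hp : Fact p.Prime] {V : Type*} [AddCommGroup V] [Module ℚ V]

theorem span_toLocal_basis {n : ℕ} {M : Submodule ℤ V} (b : Module.Basis (Fin n) ℤ M) :
    Submodule.span ℤ_[p] (Set.range fun i => toLocal p (b i : V)) = localAt p M := by
  apply le_antisymm
  · rw [Submodule.span_le]
    rintro _ ⟨i, rfl⟩
    exact Submodule.subset_span ⟨_, (b i).2, rfl⟩
  · rw [localAt, Submodule.span_le]
    rintro _ ⟨x, hx, rfl⟩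
    have h : x = ∑ i, b.repr ⟨x, hx⟩ i • (b i : V) := by
      have := congrArg M.subtype (b.sum_repr ⟨x, hx⟩)
      rw [map_sum] at this
      simp only [map_smul, Submodule.subtype_apply] at this
      exact this.symm
    rw [h, map_sum]
    refine Submodule.sum_mem _ fun i _ => ?_
    rw [map_smul, ← Int.cast_smul_eq_zsmul ℤ_[p]]
    exact Submodule.smul_mem _ _ (Submodule.subset_span ⟨i, rfl⟩)

theorem localForm_toLocal (Q : QuadraticForm ℚ V) (x : V) :
    localForm p Q (toLocal p x) = algebraMap ℚ ℚ_[p] (Q x) := by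
  change Q.baseChange ℚ_[p] ((1 : ℚ_[p]) ⊗ₜ x) = _
  rw [QuadraticForm.baseChange_tmul, mul_one, Algebra.algebraMap_eq_smul_one]

theorem gram_toLocal_basis (Q : QuadraticForm ℚ V) {n : ℕ} {M : Submodule ℤ V}
    (b : Module.Basis (Fin n) ℤ M) :
    gram (localForm p Q) (fun i => toLocal p (b i : V)) = gramOfBasis p Q b := by
  ext i j
  simp only [gram, gramOfBasis, Matrix.of_apply, Matrix.map_apply, polar, ← map_add,
    localForm_toLocal, map_sub]

theorem finrank_tensor {n : ℕ} (hn : Module.rank ℚ V = n) :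
    Module.finrank ℚ_[p] (ℚ_[p] ⊗[ℚ] V) = n := by
  rw [Module.finrank_baseChange, Module.finrank_eq_of_rank_eq hn]

theorem nonempty_basis_of_isLattice {n : ℕ} (hn : Module.rank ℚ V = n) (M : Submodule ℤ V)
    (hM : M.IsLattice ℚ) : Nonempty (Module.Basis (Fin n) ℤ M) := by
  have : Module.finrank ℤ M = n :=
    Module.finrank_eq_of_rank_eq ((Submodule.IsLattice.rank' ℚ M).trans hn)
  exact ⟨Module.finBasisOfFinrankEq ℤ M this⟩

/-- A lattice `N` with `p ^ k M_p ⊆ N ⊆ M_p` is the completion of `(N ∩ M) + p ^ k M`. -/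
theorem localAt_inf_sup {M : Submodule ℤ V} {n : ℕ} (b : Module.Basis (Fin n) ℤ M)
    {N : Submodule ℤ_[p] (ℚ_[p] ⊗[ℚ] V)} {k : ℕ} (hN : N ≤ localAt p M)
    (hk : ∀ x ∈ localAt p M, (p : ℚ_[p]) ^ k • x ∈ N) :
    localAt p (((N.restrictScalars ℤ).comap (toLocal p) ⊓ M) ⊔ ((p ^ k : ℕ) : ℤ) • M) = N := by
  have hsmul : ∀ x : V, toLocal p (((p ^ k : ℕ) : ℤ) • x) = (p : ℚ_[p]) ^ k • toLocal p x := by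
    intro x
    rw [map_smul, ← Int.cast_smul_eq_zsmul ℚ_[p]]
    push_cast
    rfl
  apply le_antisymm
  · rw [localAt, Submodule.span_le]
    rintro _ ⟨x, hx, rfl⟩
    obtain ⟨y, hy, z, hz, rfl⟩ := Submodule.mem_sup.1 hx
    obtain ⟨w, hw, rfl⟩ := (Submodule.mem_smul_pointwise_iff_exists _ _ _).1 hz
    rw [map_add]
    refine N.add_mem hy.1 ?_
    rw [hsmul]
    exact hk _ (Submodule.subset_span ⟨w, hw, rfl⟩)
  · intro y hy
    have hyM := hN hy
    rw [← span_toLocal_basis b, Submodule.mem_span_range_iff_exists_fun] at hyM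
    obtain ⟨c, hc⟩ := hyM
    -- The coordinates of y are approximated by integers modulo p^k, so that y differs from an
    -- element x of M by an element of p^k M_p. As this lies in N, so does x.
    have happ : ∀ i, ∃ (m : ℤ) (t : ℚ_[p]), ‖t‖ ≤ 1 ∧ (c i : ℚ_[p]) = m + t * (p : ℚ_[p]) ^ k := by
      intro i
      have hp0 : (p : ℚ_[p]) ≠ 0 := by exact_mod_cast hp.out.ne_zero
      obtain ⟨m, -, hm⟩ := exists_nat_norm_sub_le (c i).2 k
      refine ⟨m, (c i - m) / (p : ℚ_[p]) ^ k, ?_, ?_⟩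
      · rw [norm_div, norm_pow, Padic.norm_p, inv_pow]
        exact div_le_one_of_le₀ hm (by positivity)
      · rw [div_mul_cancel₀ _ (pow_ne_zero _ hp0)]
        push_cast
        ring
    choose m t ht hmt using happ
    set x : V := ∑ i, m i • (b i : V) with hx
    have hxM : x ∈ M := Submodule.sum_mem _ fun i _ => M.smul_mem _ (b i).2
    have hyx : y = toLocal p x + ∑ i, t i • toLocal p (((p ^ k : ℕ) : ℤ) • (b i : V)) := by
      rw [← hc, hx, map_sum, ← Finset.sum_add_distrib]
      refine Finset.sum_congr rfl fun i _ => ?_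
      rw [← coe_smul_eq, hmt, add_smul, hsmul, smul_smul, map_smul, Int.cast_smul_eq_zsmul]
    have hrest : ∀ i, toLocal p (((p ^ k : ℕ) : ℤ) • (b i : V)) ∈ N := fun i => by
      rw [hsmul]
      exact hk _ (Submodule.subset_span ⟨_, (b i).2, rfl⟩)
    have hxN : toLocal p x ∈ N := by
      rw [eq_sub_of_add_eq hyx.symm]
      exact N.sub_mem hy (Submodule.sum_mem _ fun i _ =>
        smul_mem_of_norm_le_one _ (ht i) (hrest i))
    rw [hyx]
    refine Submodule.add_mem _ (Submodule.subset_span ⟨x, ?_, rfl⟩) (Submodule.sum_mem _ fun i _ =>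
      smul_mem_of_norm_le_one _ (ht i) (Submodule.subset_span ⟨_, ?_, rfl⟩))
    · exact Submodule.mem_sup_left ⟨hxN, hxM⟩
    · exact Submodule.mem_sup_right (Submodule.smul_mem_pointwise_smul _ _ _ (b i).2)

/-- At q ≠ p the number p^k is a unit, so M and p^k M have the same completion. -/
theorem localAt_eq_of_smul_le {q : ℕ} [Fact q.Prime] (hqp : q ≠ p) {M M' : Submodule ℤ V}
    (h : M' ≤ M) {k : ℕ} (h' : ((p ^ k : ℕ) : ℤ) • M ≤ M') : localAt q M' = localAt q M := by
  apply le_antisymm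
  · exact Submodule.span_mono (Set.image_mono h)
  · rw [localAt, Submodule.span_le]
    rintro _ ⟨x, hx, rfl⟩
    have hnorm : ‖((p : ℚ_[q]) ^ k)⁻¹‖ ≤ 1 := by
      have : ‖((p : ℤ) : ℚ_[q])‖ = 1 := by
        rw [norm_intCast_eq_one_iff_not_dvd]
        intro hd
        have hd' : q ∣ p := by exact_mod_cast hd
        exact hqp ((Nat.prime_dvd_prime_iff_eq Fact.out hp.out).1 hd')
      rw [norm_inv, norm_pow]
      push_cast at this
      rw [this]
      simp
    have hq0 : ((p : ℚ_[q]) ^ k) ≠ 0 := pow_ne_zero _ (by exact_mod_cast hp.out.ne_zero)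
    have hx' : toLocal q x = ((p : ℚ_[q]) ^ k)⁻¹ • toLocal q (((p ^ k : ℕ) : ℤ) • x) := by
      rw [map_smul, ← Int.cast_smul_eq_zsmul ℚ_[q], smul_smul]
      push_cast
      rw [inv_mul_cancel₀ hq0, one_smul]
    rw [SetLike.mem_coe, hx']
    exact smul_mem_of_norm_le_one _ hnorm
      (Submodule.subset_span ⟨_, h' (Submodule.smul_mem_pointwise_smul _ _ _ hx), rfl⟩)

theorem isLattice_of_smul_le {M M' : Submodule ℤ V} (hM : M.IsLattice ℚ) (h : M' ≤ M) {d : ℤ}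
    (hd : d ≠ 0) (h' : d • M ≤ M') : M'.IsLattice ℚ := by
  have : Module.Finite ℤ M := hM.finite
  refine ⟨Submodule.FG.of_le hM.fg h, ?_⟩
  rw [eq_top_iff, ← hM.span_eq_top, Submodule.span_le]
  intro x hx
  have hx' : x = (d : ℚ)⁻¹ • (d • x) := by
    rw [← Int.cast_smul_eq_zsmul ℚ, smul_smul, inv_mul_cancel₀ (by exact_mod_cast hd), one_smul]
  rw [SetLike.mem_coe, hx']
  exact Submodule.smul_mem _ _ (Submodule.subset_span
    (h' (Submodule.smul_mem_pointwise_smul _ _ _ hx)))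

end Localization

/-! ### The standard lattice and the denominator of a matrix -/

section Standard

variable {p : ℕ} [hp : Fact p.Prime] {n : ℕ}

theorem isLattice_stdLattice : (stdLattice p n).IsLattice ℚ_[p] := by
  refine ⟨Submodule.fg_span (Set.finite_range _), ?_⟩
  rw [stdLattice, Submodule.span_span_of_tower]
  have h : (fun i : Fin n => (Pi.single i 1 : Fin n → ℚ_[p])) = Pi.basisFun ℚ_[p] (Fin n) := by
    ext i : 1
    rw [Pi.basisFun_apply]
  rw [h, Module.Basis.span_eq]

theorem gram_formOf {G : Matrix (Fin n) (Fin n) ℤ_[p]} (hG : G.IsSymm) :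
    gram (formOf G) (fun i => (Pi.single i 1 : Fin n → ℚ_[p])) = toQp G := by
  ext i j
  have hij : G j i = G i j := congrFun (congrFun hG i) j
  have h : ∀ x, formOf G x = (2 : ℚ_[p])⁻¹ * (x ⬝ᵥ (toQp G *ᵥ x)) := fun x =>
    congrArg (fun t => (2 : ℚ_[p])⁻¹ * t) (Matrix.toLinearMap₂'_apply' (toQp G) x x)
  simp only [gram, Matrix.of_apply, polar, h, Matrix.mulVec_add, add_dotProduct, dotProduct_add,
    Matrix.mulVec_single_one, single_one_dotProduct, Matrix.col_apply]
  have e : toQp G j i = toQp G i j := congrArg (algebraMap ℤ_[p] ℚ_[p]) hij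
  rw [e]
  ring

theorem norm_denomExp_mul_le (A : Matrix (Fin n) (Fin n) ℚ_[p]) (i j : Fin n) :
    ‖(p : ℚ_[p]) ^ denomExp A * A i j‖ ≤ 1 := by
  -- Only for a nonempty set is the infimum attained; a common exponent is the sum of the exponents
  -- needed for the single entries.
  have hne : {k : ℕ | ∀ i j, (p : ℚ_[p]) ^ k * A i j ∈
      Set.range (algebraMap ℤ_[p] ℚ_[p])}.Nonempty := by
    choose m hm using fun i j => norm_p_pow_mul_le_one (A i j)
    refine ⟨∑ i, ∑ j, m i j, fun i j => mem_range_iff_norm_le_one.2 ?_⟩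
    have h1 : m i j ≤ ∑ i, ∑ j, m i j :=
      (Finset.single_le_sum (f := fun j => m i j) (fun _ _ => Nat.zero_le _)
        (Finset.mem_univ j)).trans
        (Finset.single_le_sum (f := fun i => ∑ j, m i j) (fun _ _ => Nat.zero_le _)
          (Finset.mem_univ i))
    obtain ⟨t, ht⟩ := Nat.exists_eq_add_of_le h1
    rw [ht, add_comm, pow_add, mul_assoc]
    exact norm_mul_le_one (by
      rw [norm_pow]
      exact pow_le_one₀ (norm_nonneg _) Padic.norm_p_lt_one.le) (hm i j)
  exact mem_range_iff_norm_le_one.1 (Nat.sInf_mem hne i j)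

theorem exists_toQp_eq {A : Matrix (Fin n) (Fin n) ℚ_[p]} (h : ∀ i j, ‖A i j‖ ≤ 1) :
    ∃ C : Matrix (Fin n) (Fin n) ℤ_[p], toQp C = A :=
  ⟨Matrix.of fun i j => ⟨A i j, h i j⟩, rfl⟩

end Standard

/-! ### Correctness of the algorithm -/

section Algorithm

variable {p : ℕ} [hp : Fact p.Prime] {n : ℕ} {V : Type*} [AddCommGroup V] [Module ℚ V]
  {Q : QuadraticForm ℚ V} {M : Submodule ℤ V} {G : Matrix (Fin n) (Fin n) ℤ_[p]}

theorem span_range_coe_basis {W : Type*} [AddCommGroup W] [Module ℤ_[p] W]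
    {L : Submodule ℤ_[p] W} (b : Module.Basis (Fin n) ℤ_[p] L) :
    Submodule.span ℤ_[p] (Set.range fun i => (b i : W)) = L := by
  have h : (Set.range fun i => (b i : W)) = L.subtype '' Set.range b := by
    rw [← Set.range_comp]
    rfl
  rw [h, ← Submodule.map_span, b.span_eq, Submodule.map_top, Submodule.range_subtype]

theorem mul_of_eq_one_iff {A : Matrix (Fin n) (Fin n) ℚ_[p]} {f : Fin n → Fin n → ℚ_[p]} :
    A * Matrix.of f = 1 ↔ ∀ i, (Pi.single i 1 : Fin n → ℚ_[p]) = ∑ j, A i j • f j := by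
  have h1 : ∀ i j, (A * Matrix.of f) i j = (∑ k, A i k • f k) j := fun i j => by
    simp [Matrix.mul_apply, Finset.sum_apply]
  have h2 : ∀ i j, (1 : Matrix (Fin n) (Fin n) ℚ_[p]) i j = (Pi.single i 1 : Fin n → ℚ_[p]) j :=
    fun i j => by simp [Matrix.one_apply, Pi.single_apply, eq_comm]
  constructor
  · intro h i
    ext j
    rw [← h1, ← h2, h]
  · intro h
    ext i j
    rw [h1, h2, h]

theorem eq_zero_of_polar_formOf
    (hMmax : IsMaximalLattice (localForm p Q) (localAt p M))
    (φ : (formOf G).IsometryEquiv (localForm p Q)) {x : Fin n → ℚ_[p]}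
    (hx : ∀ y, polar (formOf G) x y = 0) : x = 0 := by
  have h : φ x = 0 := by
    refine hMmax.eq_zero_of_polar_eq_zero fun y => ?_
    obtain ⟨y, rfl⟩ := φ.toLinearEquiv.surjective y
    have := hx y
    simp only [polar, ← φ.map_app] at this
    rw [map_add] at this
    exact this
  exact φ.toLinearEquiv.map_eq_zero_iff.1 h

theorem neverStuck (hn : Module.rank ℚ V = n) (hM : M.IsLattice ℚ)
    (hMmax : IsMaximalLattice (localForm p Q) (localAt p M))
    (hGeven : IsEven (formOf G) (stdLattice p n))
    (φ : (formOf G).IsometryEquiv (localForm p Q)) : NeverStuck Q M G where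
  opMaximal := exists_isMaximalLattice_ge (fun _ => eq_zero_of_polar_formOf hMmax φ) _
    isLattice_stdLattice hGeven
  basisL Lmax h := by
    have := h.2.isLattice
    exact exists_basis_of_isLattice Lmax (by simp)
  normalFormL Lmax h LB := h.2.exists_isNormalFormOutput (by simp) (span_range_coe_basis LB)
  basisM := nonempty_basis_of_isLattice hn M hM
  normalFormM MB := by
    rw [← gram_toLocal_basis]
    exact hMmax.exists_isNormalFormOutput (finrank_tensor hn) (span_toLocal_basis MB)

namespace Run

/-- The normalized basis of `M_p`. -/
def basisM (r : Run Q M G) (i : Fin n) : ℚ_[p] ⊗[ℚ] V :=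
  ∑ j, toQp r.TM.val i j • toLocal p (r.MB j : V)

/-- The normalized basis of `L_max`. -/
def basisL (r : Run Q M G) (i : Fin n) : Fin n → ℚ_[p] :=
  ∑ j, toQp r.TL.val i j • (r.LB j : Fin n → ℚ_[p])

theorem span_basisM (r : Run Q M G) :
    Submodule.span ℤ_[p] (Set.range r.basisM) = localAt p M :=
  (span_range_sum_toQp (fun j => toLocal p (r.MB j : V)) r.TM).trans (span_toLocal_basis r.MB)

theorem span_basisL (r : Run Q M G) : Submodule.span ℤ_[p] (Set.range r.basisL) = r.Lmax :=
  (span_range_sum_toQp (fun j => (r.LB j : Fin n → ℚ_[p])) r.TL).trans (span_range_coe_basis r.LB)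

theorem of_basisL (r : Run Q M G) : Matrix.of r.basisL = toQp r.TL.val * rows r.LB := by
  ext i j
  simp [basisL, rows, Matrix.mul_apply, Finset.sum_apply]

theorem B'_eq (r : Run Q M G) (i : Fin n) : r.B' i = ∑ j, r.B i j • r.basisM j :=
  sum_mul_smul _ _ _ _

/-- The two normalized bases have the same Gram matrix. -/
theorem gram_basis_eq (r : Run Q M G) (hMmax : IsMaximalLattice (localForm p Q) (localAt p M))
    (φ : (formOf G).IsometryEquiv (localForm p Q)) :
    gram (formOf G) r.basisL = gram (localForm p Q) r.basisM := by
  have h := r.TM_spec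
  rw [← gram_toLocal_basis] at h
  have := IsNormalFormOutput.eq φ (by simp) r.Lmax_spec.2 hMmax (span_range_coe_basis r.LB)
    (span_toLocal_basis r.MB) r.TL_spec h
  rwa [← gram_sum, ← gram_sum] at this

/-- The matrix `B` is integral, and inverse to the matrix of the normalized basis of `L_max`. -/
theorem exists_toQp_eq_B (r : Run Q M G) :
    ∃ C : Matrix (Fin n) (Fin n) ℤ_[p], toQp C = r.B ∧ r.B * Matrix.of r.basisL = 1 := by
  obtain ⟨C, hC⟩ := exists_toQp_sum_eq (e := r.basisL)
    (f := fun i => (Pi.single i 1 : Fin n → ℚ_[p])) fun i => by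
      rw [r.span_basisL]
      exact r.Lmax_spec.1 (Submodule.subset_span ⟨i, rfl⟩)
  have h1 : toQp C * Matrix.of r.basisL = 1 := mul_of_eq_one_iff.2 hC
  have h2 : r.B = toQp C := by
    rw [B, ← r.of_basisL]
    exact Matrix.inv_eq_left_inv h1
  exact ⟨C, h2.symm, by rw [h2, h1]⟩

/-- The matrix B expresses the standard basis through the normalized basis of L_max, and B' through
that of M_p. As the two normalized bases have the same Gram matrix, so do the standard basis and B'.
-/
theorem gram_B' (r : Run Q M G) (hMmax : IsMaximalLattice (localForm p Q) (localAt p M))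
    (hGsymm : G.IsSymm) (φ : (formOf G).IsometryEquiv (localForm p Q)) :
    gram (localForm p Q) r.B' = toQp G := by
  obtain ⟨C, -, hB⟩ := r.exists_toQp_eq_B
  have h1 : r.B' = fun i => ∑ j, r.B i j • r.basisM j := funext r.B'_eq
  have h2 : (fun i => (Pi.single i 1 : Fin n → ℚ_[p])) = fun i => ∑ j, r.B i j • r.basisL j :=
    funext (mul_of_eq_one_iff.1 hB)
  rw [h1, gram_sum, ← r.gram_basis_eq hMmax φ, ← gram_sum, ← h2, gram_formOf hGsymm]

theorem N_le (r : Run Q M G) : r.N ≤ localAt p M := by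
  obtain ⟨C, hC, -⟩ := r.exists_toQp_eq_B
  rw [N, Submodule.span_le]
  rintro _ ⟨i, rfl⟩
  rw [SetLike.mem_coe, r.B'_eq, ← r.span_basisM, ← hC]
  refine Submodule.sum_mem _ fun j _ => ?_
  rw [toQp_smul]
  exact Submodule.smul_mem _ _ (Submodule.subset_span ⟨j, rfl⟩)

theorem basisM_eq (r : Run Q M G) (i : Fin n) :
    r.basisM i = ∑ j, Matrix.of r.basisL i j • r.B' j := by
  obtain ⟨C, -, hB⟩ := r.exists_toQp_eq_B
  simp only [r.B'_eq]
  rw [← sum_mul_smul, mul_eq_one_comm.1 hB]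
  simp [Matrix.one_apply]

theorem isUnit_det (hMmax : IsMaximalLattice (localForm p Q) (localAt p M))
    (hGsymm : G.IsSymm) (φ : (formOf G).IsometryEquiv (localForm p Q)) :
    IsUnit (toQp G).det := by
  rw [isUnit_iff_ne_zero]
  intro h0
  obtain ⟨v, hv, h⟩ := Matrix.exists_mulVec_eq_zero_iff.2 h0
  refine hv (eq_zero_of_polar_formOf hMmax φ fun y => ?_)
  have hexp : ∀ x : Fin n → ℚ_[p], x = ∑ j, x j • (Pi.single j 1 : Fin n → ℚ_[p]) := fun x => by
    simpa using (pi_eq_sum_univ' x)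
  have hpol : ∀ i, polar (formOf G) (Pi.single i 1) v = 0 := fun i => by
    have hi := congrFun h i
    rw [Matrix.mulVec, dotProduct, Pi.zero_apply, ← gram_formOf hGsymm] at hi
    rw [hexp v, ← hi]
    change polarBilin (formOf G) _ _ = _
    rw [map_sum]
    refine Finset.sum_congr rfl fun j _ => ?_
    rw [map_smul, smul_eq_mul, mul_comm]
    rfl
  rw [polar_comm, hexp y]
  change polarBilin (formOf G) _ _ = _
  rw [map_sum, LinearMap.sum_apply]
  refine Finset.sum_eq_zero fun i _ => ?_
  rw [map_smul, LinearMap.smul_apply]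
  change _ • polar (formOf G) (Pi.single i 1) v = 0
  rw [hpol, smul_zero]

/-- `d` times the matrix of the normalized basis of `L_max` is integral. -/
theorem exists_toQp_eq_smul (r : Run Q M G)
    (hMmax : IsMaximalLattice (localForm p Q) (localAt p M))
    (hGsymm : G.IsSymm) (φ : (formOf G).IsometryEquiv (localForm p Q)) :
    ∃ C : Matrix (Fin n) (Fin n) ℤ_[p],
      toQp C = (p : ℚ_[p]) ^ denomExp (toQp G)⁻¹ • Matrix.of r.basisL := by
  obtain ⟨D, hD⟩ := exists_toQp_eq (A := (p : ℚ_[p]) ^ denomExp (toQp G)⁻¹ • (toQp G)⁻¹)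
    (norm_denomExp_mul_le _)
  -- The entries of this product are the pairings of L_max with the standard basis, which lies in
  -- L_max; they are integral because L_max is even. Multiplying by the integral matrix d G⁻¹ gives
  -- d times the basis matrix.
  obtain ⟨H, hH⟩ := exists_toQp_eq (A := Matrix.of r.basisL * toQp G) fun i j => by
    have h1 : r.basisL i ∈ r.Lmax := by
      rw [← r.span_basisL]; exact Submodule.subset_span ⟨i, rfl⟩
    have h2 := r.Lmax_spec.2.even.norm_polar_le h1
      (r.Lmax_spec.1 (Submodule.subset_span ⟨j, rfl⟩))
    have h3 : (Matrix.of r.basisL * toQp G) i j =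
        polar (formOf G) (r.basisL i) (Pi.single j 1) := by
      have hexp : r.basisL i = ∑ k, r.basisL i k • (Pi.single k 1 : Fin n → ℚ_[p]) := by
        simpa using (pi_eq_sum_univ' (r.basisL i))
      rw [hexp, Matrix.mul_apply, ← gram_formOf hGsymm]
      change _ = polarBilin (formOf G) _ _
      rw [map_sum, LinearMap.sum_apply]
      refine Finset.sum_congr rfl fun k _ => ?_
      rw [map_smul, LinearMap.smul_apply, smul_eq_mul]
      rfl
    rw [h3]
    exact h2
  refine ⟨H * D, ?_⟩
  rw [toQp_mul, hH, hD, Matrix.mul_smul, Matrix.mul_assoc,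
    Matrix.mul_nonsing_inv _ (isUnit_det hMmax hGsymm φ), Matrix.mul_one]

theorem smul_mem_N (r : Run Q M G)
    (hMmax : IsMaximalLattice (localForm p Q) (localAt p M))
    (hGsymm : G.IsSymm) (φ : (formOf G).IsometryEquiv (localForm p Q)) {x : ℚ_[p] ⊗[ℚ] V}
    (hx : x ∈ localAt p M) : (p : ℚ_[p]) ^ denomExp (toQp G)⁻¹ • x ∈ r.N := by
  obtain ⟨C, hC⟩ := r.exists_toQp_eq_smul hMmax hGsymm φ
  rw [← r.span_basisM] at hx
  induction hx using Submodule.span_induction with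
  | zero => simp
  | add a b _ _ ha hb => rw [smul_add]; exact r.N.add_mem ha hb
  | smul c a _ ha => rw [smul_comm]; exact r.N.smul_mem c ha
  | mem x hx =>
    obtain ⟨i, rfl⟩ := hx
    have h : (p : ℚ_[p]) ^ denomExp (toQp G)⁻¹ • r.basisM i = ∑ j, toQp C i j • r.B' j := by
      rw [r.basisM_eq, Finset.smul_sum, hC]
      refine Finset.sum_congr rfl fun j _ => ?_
      rw [smul_smul, Matrix.smul_apply, smul_eq_mul]
    rw [h]
    refine Submodule.sum_mem _ fun j _ => ?_
    rw [toQp_smul]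
    exact Submodule.smul_mem _ _ (Submodule.subset_span ⟨j, rfl⟩)

theorem linearIndependent_B' (r : Run Q M G) (hn : Module.rank ℚ V = n)
    (hMmax : IsMaximalLattice (localForm p Q) (localAt p M)) :
    LinearIndependent ℚ_[p] r.B' := by
  refine linearIndependent_of_top_le_span_of_card_eq_finrank ?_ (by simp [finrank_tensor hn])
  rw [← hMmax.isLattice.span_eq_top, ← r.span_basisM, Submodule.span_span_of_tower,
    Submodule.span_le]
  rintro _ ⟨i, rfl⟩
  rw [SetLike.mem_coe, r.basisM_eq]
  exact Submodule.sum_mem _ fun j _ => Submodule.smul_mem _ _ (Submodule.subset_span ⟨j, rfl⟩)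

theorem output_le (r : Run Q M G) : r.output ≤ M := by
  refine sup_le inf_le_right ?_
  intro x hx
  obtain ⟨y, hy, rfl⟩ := (Submodule.mem_smul_pointwise_iff_exists _ _ _).1 hx
  exact M.smul_mem _ hy

theorem localAt_output (r : Run Q M G)
    (hMmax : IsMaximalLattice (localForm p Q) (localAt p M))
    (hGsymm : G.IsSymm) (φ : (formOf G).IsometryEquiv (localForm p Q)) :
    localAt p r.output = r.N :=
  localAt_inf_sup r.MB r.N_le fun _ hx => r.smul_mem_N hMmax hGsymm φ hx

theorem hasGram_N (r : Run Q M G) (hn : Module.rank ℚ V = n)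
    (hMmax : IsMaximalLattice (localForm p Q) (localAt p M))
    (hGsymm : G.IsSymm) (φ : (formOf G).IsometryEquiv (localForm p Q)) :
    HasGram (localForm p Q) r.N G := by
  have hli : LinearIndependent ℤ_[p] r.B' :=
    (r.linearIndependent_B' hn hMmax).restrict_scalars' ℤ_[p]
  have h : (fun i => (Module.Basis.span hli i : ℚ_[p] ⊗[ℚ] V)) = r.B' :=
    funext fun i => congrArg Subtype.val (Module.Basis.span_apply hli i)
  exact ⟨Module.Basis.span hli,
    (congrArg (gram (localForm p Q)) h).trans (r.gram_B' hMmax hGsymm φ)⟩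

end Run

end Algorithm

end LocalMod

end

theorem mainTheorem7 {V : Type*} [AddCommGroup V] [Module ℚ V] (n : ℕ)
    (hn : Module.rank ℚ V = n) (Q : QuadraticForm ℚ V) (p : ℕ) [Fact p.Prime]
    (M : Submodule ℤ V) (hM : M.IsLattice ℚ)
    (hMmax : LocalMod.IsMaximalLattice (LocalMod.localForm p Q) (LocalMod.localAt p M))
    (G : Matrix (Fin n) (Fin n) ℤ_[p]) (hGsymm : G.IsSymm)
    (hGeven : LocalMod.IsEven (LocalMod.formOf G) (LocalMod.stdLattice p n))
    (hGM : (LocalMod.formOf G).Equivalent (LocalMod.localForm p Q)) :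
    LocalMod.NeverStuck Q M G ∧
    ∀ r : LocalMod.Run Q M G,
      r.output.IsLattice ℚ ∧
      (∀ (q : ℕ) [Fact q.Prime], q ≠ p →
        LocalMod.localAt q r.output = LocalMod.localAt q M) ∧
      LocalMod.HasGram (LocalMod.localForm p Q) (LocalMod.localAt p r.output) G := by
  obtain ⟨φ⟩ := hGM
  refine ⟨LocalMod.neverStuck hn hM hMmax hGeven φ, fun r => ⟨?_, fun q _ hqp => ?_, ?_⟩⟩
  · exact LocalMod.isLattice_of_smul_le hM r.output_le
      (d := ((p ^ LocalMod.denomExp (LocalMod.toQp G)⁻¹ : ℕ) : ℤ))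
      (by exact_mod_cast pow_ne_zero _ (Fact.out : p.Prime).ne_zero) le_sup_right
  · exact LocalMod.localAt_eq_of_smul_le hqp r.output_le le_sup_right
  · rw [r.localAt_output hMmax hGsymm φ]
    exact r.hasGram_N hn hMmax hGsymm φ
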